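/- Let $n\ge 1$ be an integer and let $f:[0,\infty)\to\mathbb{R}$ be continuous with $f(s)>0$ for all $s>0$ and $\int_0^1 \frac{f(z)}{z}\,dz<\infty$. Set $$\tilde f(s)=\int_0^s \frac{f(z)}{z}\,dz,\qquad s>0 .$$ Assume that either $n=1$, or there is $p$ with $1<p<p_B:=\frac{n(n+2)}{(n-1)^2}$ such that $f(s)\le p\,\tilde f(s)$ for all $s>0$. Assume moreover that there are constants $c>0$ and $m_1,m_2$ with $$\tfrac23<m_2<m_1<\frac{2(n+2)}{3n+2}$$ such that $$f(s)\ge c\,s^{m_1}\tilde f(s)^{2m_1-1}\ \text{ for all } s\in(0,1],\qquad f(s)\ge c\,s^{m_2}\tilde f(s)^{2m_2-1}\ \text{ for all } s\in(1,\infty).$$ Then the equation $$u_t-\Delta u=f(u)\qquad\text{in }\mathbb{R}^n\times\mathbb{R}$$ has no nontrivial nonnegative strong solution. Here a nonnegative strong solution is a function $u\ge 0$ that belongs to $W^{2,1;r}_{\mathrm{loc}}(\mathbb{R}^n\times\mathbb{R})$ for every $r\in[1,\infty)$ (that is, $u$ and its weak derivatives $\partial_t u$, $\partial_{x_i}u$,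 $\partial_{x_i}\partial_{x_j}u$, $1\le i,j\le n$, are in $L^r_{\mathrm{loc}}$) and satisfies the equation almost everywhere; nontrivial means not equal to $0$ almost everywhere. -/

import Mathlib

open MeasureTheory Set
open scoped ContDiff ENNReal

/-- Space-time `ℝⁿ × ℝ`, with points `(x, t)` and Lebesgue measure. -/
abbrev SpaceTime (n : ℕ) : Type := EuclideanSpace ℝ (Fin n) × ℝ

/-- The unit vector of space-time in the `i`-th spatial direction. -/
noncomputable def spaceDir {n : ℕ} (i : Fin n) : SpaceTime n := (EuclideanSpace.single i 1, 0)

/-- The unit vector of space-time in the time direction. -/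
def timeDir (n : ℕ) : SpaceTime n := (0, 1)

/-- `g` is the weak (distributional) derivative of `u` on `ℝⁿ × ℝ` in the direction `e`. -/
def HasWeakDeriv {n : ℕ} (e : SpaceTime n) (u g : SpaceTime n → ℝ) : Prop :=
  LocallyIntegrable u volume ∧ LocallyIntegrable g volume ∧
    ∀ φ : SpaceTime n → ℝ, ContDiff ℝ ∞ φ → HasCompactSupport φ →
      ∫ z, u z * fderiv ℝ φ z e = - ∫ z, g z * φ z

/-- `u` belongs to `L^r` on every compact subset of `ℝⁿ × ℝ`. -/
def MemLpLoc {n : ℕ} (r : ℝ≥0∞) (u : SpaceTime n → ℝ) : Prop :=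
  ∀ K : Set (SpaceTime n), IsCompact K → MemLp u r (volume.restrict K)

/-- `u` belongs to the parabolic Sobolev space `W^{2,1;r}_loc(ℝⁿ × ℝ)`, and its weak derivatives are
`∂_t u = ut`, `∂_{x_i} u = Du i` and `∂_{x_j} ∂_{x_i} u = D2u i j`. -/
structure MemParabolicSobolevLoc {n : ℕ} (r : ℝ≥0∞) (u ut : SpaceTime n → ℝ)
    (Du : Fin n → SpaceTime n → ℝ) (D2u : Fin n → Fin n → SpaceTime n → ℝ) : Prop where
  hasWeakDeriv_time : HasWeakDeriv (timeDir n) u ut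
  hasWeakDeriv_space : ∀ i, HasWeakDeriv (spaceDir i) u (Du i)
  hasWeakDeriv_space_space : ∀ i j, HasWeakDeriv (spaceDir j) (Du i) (D2u i j)
  memLpLoc : MemLpLoc r u
  memLpLoc_time : MemLpLoc r ut
  memLpLoc_space : ∀ i, MemLpLoc r (Du i)
  memLpLoc_space_space : ∀ i j, MemLpLoc r (D2u i j)

/-- `u` is a nonnegative strong solution of `u_t - Δu = f(u)` in `ℝⁿ × ℝ`: it belongs to
`W^{2,1;r}_loc` for every finite `r ≥ 1` and satisfies the equation almost everywhere.
As usual for Sobolev functions, `u` is understood up to equality almost everywhere. -/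
def IsStrongSolution {n : ℕ} (f : ℝ → ℝ) (u : SpaceTime n → ℝ) : Prop :=
  (∀ᵐ z, 0 ≤ u z) ∧
    ∃ (ut : SpaceTime n → ℝ) (Du : Fin n → SpaceTime n → ℝ)
      (D2u : Fin n → Fin n → SpaceTime n → ℝ),
      (∀ r : ℝ≥0∞, 1 ≤ r → r < ⊤ → MemParabolicSobolevLoc r u ut Du D2u) ∧
      ∀ᵐ z, ut z - ∑ i, D2u i i z = f (u z)

/-- `f̃(s) = ∫₀ˢ f(z)/z dz`. -/
noncomputable def fTilde (f : ℝ → ℝ) (s : ℝ) : ℝ := ∫ z in (0 : ℝ)..s, f z / z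

/-!
The proof is the integral Bernstein method of Bidaut-Véron, in a localized and truncated form. Let
`u` be a nonnegative solution, `ψ` a cutoff at parabolic scale `R`, and `φ` a high power of `ψ`.
Three integral relations, all obtained from the divergence theorem for smooth functions and carried
over to `u` by mollification, are combined:

* the Bochner formula for `|∇u|²` together with the divergence of `φ |∇u|² ∇u / u` and the
  inequality `(tr A)² ≤ n |A|²` for `A = D²u - κ ∇u ⊗ ∇u / u`, which bounds `∫ φ |∇u|⁴ / u²` and
  `∫ φ f(u) |∇u|² / u` by a multiple of `∫ φ f(u)²` and terms with `u_t` and derivatives of `φ`;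
* the equation multiplied by `φ f̃(u)`, which bounds `∫ φ f(u) f̃(u)` by `∫ φ f(u) |∇u|² / u` up to
  lower order terms, because `f̃'(u) = f(u) / u`;
* the equation multiplied by `φ u_t`, which bounds `∫ φ u_t²` by lower order terms and
  a small multiple of the gradient terms.

Since `f² ≤ p f f̃` for `n ≥ 2`, the chain closes if `(n - 1) / n * p < κ (n + 2) / n` for some
`κ < n / (n - 1)`, which is the condition `p < n (n + 2) / (n - 1)²`. In one dimension the Bochner
formula is void and `∫ φ f(u)²` does not occur. The outcome is

`∫ φ f(u) f̃(u) ≤ C ∫ (R⁻⁴ ψ^(4q) u² + (R⁻¹ ψ^(3q+2) √u f̃(u))^(4/3))`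

(`exists_energy_estimate`). The lower bounds `f ≥ c s^m f̃^(2m-1)` control both integrands on the
right by a power less than one of `f f̃`, so Young's inequality absorbs them up to `O(R^(-β))`,
where `β ≤ 4m / (3m - 2)` and also `β ≤ 4` if `n = 1`. The upper bound on the
exponents says exactly that one can take `β > n + 2` (`exists_isSubcritical`), and
`R → ∞` gives `f(u) f̃(u) = 0`.

Because `u` is merely a Sobolev function that may vanish, and `f̃` need not have polynomial growth,
the estimates are derived with `u + ε` in the denominators and with `f`, `f̃` replaced by
truncations `truncF f k`, `truncTilde f k`. All integrands are then continuous
functions of polynomial growth of the jet `(u, u_t, ∇u, Δu)` (`Tame`), for which the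
passage from smooth functions to `u` is a dominated convergence argument (`SobolevJet.exists_tendsto`). Finally `ε → 0` and `k → ∞`.
-/

open Filter Topology

/-! ### Mollification in space-time -/

section

open scoped Convolution

/-- The mollification of `g` by the normalised bump function `η`. -/
noncomputable def mollify {n : ℕ} {F : Type*} [NormedAddCommGroup F] [NormedSpace ℝ F]
    (η : ContDiffBump (0 : SpaceTime n)) (g : SpaceTime n → F) (z : SpaceTime n) : F :=
  ∫ y, η.normed volume (z - y) • g y

instance instIsAddHaarMeasureVolumeSpaceTime (n : ℕ) :
    (volume : Measure (SpaceTime n)).IsAddHaarMeasure :=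
  inferInstanceAs ((volume : Measure (EuclideanSpace ℝ (Fin n))).prod volume).IsAddHaarMeasure

variable {n : ℕ} {F : Type*} [NormedAddCommGroup F] [NormedSpace ℝ F]

theorem mollify_eq_convolution (η : ContDiffBump (0 : SpaceTime n)) (g : SpaceTime n → F) :
    mollify η g = (η.normed volume ⋆[ContinuousLinearMap.lsmul ℝ ℝ, volume] g) := by
  funext z
  rw [convolution_eq_swap]
  rfl

theorem lintegral_normed (η : ContDiffBump (0 : SpaceTime n)) :
    ∫⁻ y, ENNReal.ofReal (η.normed volume y) = 1 := by
  rw [← ofReal_integral_eq_lintegral_ofReal η.integrable_normed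
    (Eventually.of_forall η.nonneg_normed), η.integral_normed, ENNReal.ofReal_one]

/-- Mollification is a contraction of `L^m`. -/
theorem lintegral_mollify_pow_le (η : ContDiffBump (0 : SpaceTime n)) {g : SpaceTime n → F}
    (hg : AEStronglyMeasurable g volume) {m : ℕ} (hm : 1 ≤ m) :
    ∫⁻ z, ‖mollify η g z‖ₑ ^ m ≤ ∫⁻ z, ‖g z‖ₑ ^ m := by
  have hm0 : (m : ℝ) ≠ 0 := by positivity
  have hw : ∀ z : SpaceTime n, Measurable fun y => ENNReal.ofReal (η.normed volume (z - y)) :=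
    fun z => (ENNReal.continuous_ofReal.comp
      (η.continuous_normed.comp (continuous_const.sub continuous_id))).measurable
  have key : ∀ z, ‖mollify η g z‖ₑ ^ m ≤
      ∫⁻ y, ENNReal.ofReal (η.normed volume (z - y)) * ‖g y‖ₑ ^ m := by
    intro z
    have h1 : ‖mollify η g z‖ₑ ≤ ∫⁻ y, ENNReal.ofReal (η.normed volume (z - y)) * ‖g y‖ₑ := by
      refine (enorm_integral_le_lintegral_enorm _).trans (lintegral_mono fun y => ?_)
      rw [enorm_smul, Real.enorm_of_nonneg (η.nonneg_normed _)]
    have h2 := ENNReal.lintegral_mul_norm_pow_le (μ := (volume : Measure (SpaceTime n)))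
      (f := fun y => ENNReal.ofReal (η.normed volume (z - y)))
      (g := fun y => ENNReal.ofReal (η.normed volume (z - y)) * ‖g y‖ₑ ^ m)
      (hw z).aemeasurable ((hw z).aemeasurable.mul (hg.enorm.pow_const m))
      (p := 1 - 1 / m) (q := 1 / m)
      (by
        have : (1 : ℝ) ≤ m := by exact_mod_cast hm
        rw [sub_nonneg, div_le_one (by positivity)]; exact this) (by positivity) (by ring)
    have h3 : ∫⁻ y, ENNReal.ofReal (η.normed volume (z - y)) = 1 := by
      rw [lintegral_sub_left_eq_self (fun y => ENNReal.ofReal (η.normed volume y)) z,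
        lintegral_normed]
    have h4 : ∀ y, ENNReal.ofReal (η.normed volume (z - y)) ^ (1 - 1 / (m : ℝ)) *
        (ENNReal.ofReal (η.normed volume (z - y)) * ‖g y‖ₑ ^ m) ^ (1 / (m : ℝ)) =
        ENNReal.ofReal (η.normed volume (z - y)) * ‖g y‖ₑ := by
      intro y
      rw [ENNReal.mul_rpow_of_nonneg _ _ (by positivity), ← mul_assoc,
        ← ENNReal.rpow_natCast, ← ENNReal.rpow_mul, mul_one_div_cancel hm0, ENNReal.rpow_one]
      rcases eq_or_ne (ENNReal.ofReal (η.normed volume (z - y))) 0 with h | h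
      · rw [h]
        rw [ENNReal.zero_rpow_of_pos (y := 1 / (m : ℝ)) (by positivity)]
        simp
      · rw [← ENNReal.rpow_add _ _ h ENNReal.ofReal_ne_top]
        simp
    simp_rw [h4] at h2
    rw [h3, ENNReal.one_rpow, one_mul] at h2
    calc ‖mollify η g z‖ₑ ^ m ≤ _ := pow_le_pow_left' (h1.trans h2) m
      _ = _ := by
        rw [← ENNReal.rpow_natCast, ← ENNReal.rpow_mul, one_div_mul_cancel hm0, ENNReal.rpow_one]
  refine (lintegral_mono key).trans ?_
  rw [lintegral_lintegral_swap]
  · refine (lintegral_congr fun y => ?_).le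
    rw [lintegral_mul_const'']
    · rw [lintegral_sub_right_eq_self (fun z => ENNReal.ofReal (η.normed volume z)) y,
        lintegral_normed, one_mul]
    · exact (ENNReal.continuous_ofReal.comp
        (η.continuous_normed.comp (continuous_id.sub continuous_const))).aemeasurable
  · refine AEMeasurable.mul ?_ ((hg.enorm.pow_const m).comp_snd)
    exact (ENNReal.continuous_ofReal.comp
        (η.continuous_normed.comp (continuous_fst.sub continuous_snd))).aemeasurable

theorem mollify_sub [CompleteSpace F] (η : ContDiffBump (0 : SpaceTime n)) {g h : SpaceTime n → F}
    (hg : LocallyIntegrable g volume) (hh : LocallyIntegrable h volume) :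
    mollify η (g - h) = mollify η g - mollify η h := by
  have hint : ∀ {g : SpaceTime n → F}, LocallyIntegrable g volume → ∀ z,
      Integrable (fun y => η.normed volume (z - y) • g y) := by
    intro g hg z
    refine hg.integrable_smul_left_of_hasCompactSupport
      (η.continuous_normed.comp (continuous_const.sub continuous_id)) ?_
    exact η.hasCompactSupport_normed.comp_homeomorph (Homeomorph.subLeft z)
  funext z
  simp only [mollify, Pi.sub_apply, smul_sub]
  exact integral_sub (hint hg z) (hint hh z)

theorem mollify_congr_of_eqOn (η : ContDiffBump (0 : SpaceTime n)) {g h : SpaceTime n → F}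
    {z : SpaceTime n} (hgh : ∀ y ∈ Metric.ball z η.rOut, g y = h y) :
    mollify η g z = mollify η h z := by
  refine integral_congr_ae (Eventually.of_forall fun y => ?_)
  by_cases hy : y ∈ Metric.ball z η.rOut
  · simp only [hgh y hy]
  · have : η.normed volume (z - y) = 0 := by
      rw [← Function.notMem_support, η.support_normed_eq]
      intro h
      apply hy
      rw [Metric.mem_ball, dist_eq_norm] at h ⊢
      rw [norm_sub_rev]
      simpa using h
    simp only [this, zero_smul]

theorem eLpNorm_natCast_pow {α F : Type*} [NormedAddCommGroup F] [MeasurableSpace α]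
    {μ : Measure α} (g : α → F) {m : ℕ} (hm : 1 ≤ m) : eLpNorm g m μ ^ m = ∫⁻ z, ‖g z‖ₑ ^ m ∂μ := by
  have := eLpNorm_nnreal_pow_eq_lintegral (f := g) (μ := μ) (p := (m : NNReal))
    (by exact_mod_cast (by omega : m ≠ 0))
  simpa using this

theorem eLpNorm_mollify_le (η : ContDiffBump (0 : SpaceTime n)) {g : SpaceTime n → F}
    (hg : AEStronglyMeasurable g volume) {m : ℕ} (hm : 1 ≤ m) :
    eLpNorm (mollify η g) m volume ≤ eLpNorm g m volume := by
  have h := lintegral_mollify_pow_le η hg hm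
  rw [← eLpNorm_natCast_pow _ hm, ← eLpNorm_natCast_pow _ hm] at h
  exact (ENNReal.pow_le_pow_left_iff (by omega)).1 h

theorem continuous_mollify [CompleteSpace F] (η : ContDiffBump (0 : SpaceTime n))
    {g : SpaceTime n → F} (hg : LocallyIntegrable g volume) : Continuous (mollify η g) := by
  rw [mollify_eq_convolution]
  exact η.hasCompactSupport_normed.continuous_convolution_left _ η.continuous_normed hg

/-- Mollifications converge in `L^m` on compact sets. -/
theorem exists_forall_eLpNorm_mollify_sub_le [CompleteSpace F]
    {g : SpaceTime n → F} {m : ℕ} (hm : 1 ≤ m)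
    (hg : ∀ K : Set (SpaceTime n), IsCompact K → MemLp g m (volume.restrict K))
    {K : Set (SpaceTime n)} (hK : IsCompact K) {δ : ℝ≥0∞} (hδ : δ ≠ 0) :
    ∃ r : ℝ, 0 < r ∧ ∀ η : ContDiffBump (0 : SpaceTime n), η.rOut ≤ r →
      eLpNorm (mollify η g - g) m (volume.restrict K) ≤ δ := by
  have hm' : (1 : ℝ≥0∞) ≤ m := by exact_mod_cast hm
  set K' := Metric.cthickening 1 K with hK'def
  have hK' : IsCompact K' := hK.cthickening
  set g₁ := K'.indicator g with hg₁
  have hg₁m : MemLp g₁ m volume := (memLp_indicator_iff_restrict hK'.measurableSet).2 (hg K' hK')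
  have hδ3 : δ / 3 ≠ 0 := (ENNReal.div_pos hδ (by norm_num)).ne'
  obtain ⟨g₂, hg₂c, hg₂s, hg₂n, hg₂m⟩ :=
    hg₁m.exists_hasCompactSupport_eLpNorm_sub_le (ENNReal.natCast_ne_top m) hδ3
  have hKm : volume K ≠ ⊤ := hK.measure_lt_top.ne
  -- a uniform modulus of continuity for which the error on `K` is at most `δ / 3`
  obtain ⟨e, he, heK⟩ : ∃ e : NNReal, 0 < e ∧
      (e : ℝ≥0∞) * volume K ^ (1 / (m : ℝ)) ≤ δ / 3 := by
    have hc : volume K ^ (1 / (m : ℝ)) ≠ ⊤ := ENNReal.rpow_ne_top_of_nonneg (by positivity) hKm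
    obtain ⟨e, he, h⟩ := ENNReal.exists_nnreal_pos_mul_lt hc hδ3
    exact ⟨e, he, h.le⟩
  obtain ⟨r, hr, hru⟩ := Metric.uniformContinuous_iff.1
    (hg₂c.uniformContinuous_of_continuous hg₂n) e he
  have hl₁ : LocallyIntegrable g₁ volume := hg₁m.locallyIntegrable hm'
  have hl₂ : LocallyIntegrable g₂ volume := hg₂n.locallyIntegrable
  refine ⟨min 1 r, lt_min one_pos hr, fun η hη => ?_⟩
  have e1 : eLpNorm (mollify η g - g) m (volume.restrict K) =
      eLpNorm ((mollify η (g₁ - g₂) + (mollify η g₂ - g₂)) + (g₂ - g₁)) m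
        (volume.restrict K) := by
    refine eLpNorm_congr_ae ((ae_restrict_iff' hK.measurableSet).2 (Eventually.of_forall ?_))
    intro z hz
    have hzK : ∀ y ∈ Metric.ball z η.rOut, g y = g₁ y := by
      intro y hy
      rw [hg₁, indicator_of_mem]
      refine Metric.mem_cthickening_of_dist_le y z 1 K hz ?_
      exact (Metric.mem_ball.1 hy).le.trans (hη.trans (min_le_left _ _))
    rw [mollify_sub η hl₁ hl₂]
    simp only [Pi.sub_apply, Pi.add_apply]
    rw [mollify_congr_of_eqOn η hzK, hzK z (Metric.mem_ball_self η.rOut_pos)]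
    abel
  have hc₂ := continuous_mollify η hl₂
  have hc₁ := continuous_mollify η (hl₁.sub hl₂)
  rw [e1]
  have b1 : eLpNorm (mollify η (g₁ - g₂)) m (volume.restrict K) ≤ δ / 3 :=
    (eLpNorm_mono_measure _ Measure.restrict_le_self).trans
      ((eLpNorm_mollify_le η (hg₁m.sub hg₂m).aestronglyMeasurable hm).trans hg₂s)
  have b2 : eLpNorm (mollify η g₂ - g₂) m (volume.restrict K) ≤ δ / 3 := by
    refine (eLpNorm_le_of_ae_bound (C := e) (Eventually.of_forall fun z => ?_)).trans ?_
    · rw [Pi.sub_apply, ← dist_eq_norm, mollify_eq_convolution]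
      refine ContDiffBump.dist_normed_convolution_le hg₂n.aestronglyMeasurable fun x hx => ?_
      exact (hru ((Metric.mem_ball.1 hx).trans_le (hη.trans (min_le_right _ _)))).le
    · rw [Measure.restrict_apply_univ, mul_comm]
      simpa using heK
  have b3 : eLpNorm (g₂ - g₁) m (volume.restrict K) ≤ δ / 3 := by
    rw [eLpNorm_sub_comm]
    exact (eLpNorm_mono_measure _ Measure.restrict_le_self).trans hg₂s
  calc _ ≤ (δ / 3 + δ / 3) + δ / 3 := by
        refine (eLpNorm_add_le ?_ ?_ hm').trans (add_le_add ((eLpNorm_add_le ?_ ?_ hm').trans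
          (add_le_add b1 b2)) b3)
        · exact (hc₁.add (hc₂.sub hg₂n)).aestronglyMeasurable
        · exact (hg₂m.sub hg₁m).aestronglyMeasurable.restrict
        · exact hc₁.aestronglyMeasurable
        · exact (hc₂.sub hg₂n).aestronglyMeasurable
    _ = δ := ENNReal.add_thirds δ

end

/-! ### Jets of Sobolev functions -/

section

open scoped Convolution

/-- The derivative of `v` in the direction `e`. -/
noncomputable def dirDeriv {n : ℕ} (e : SpaceTime n) (v : SpaceTime n → ℝ) (z : SpaceTime n) :
    ℝ :=
  fderiv ℝ v z e

/-- The part of the parabolic 2-jet of a function that enters the estimates: its value, its time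
derivative, its spatial gradient and its spatial Laplacian. -/
abbrev Jet (n : ℕ) : Type := ℝ × ℝ × (Fin n → ℝ) × ℝ

/-- The jet of a smooth function. -/
noncomputable def jetOf {n : ℕ} (v : SpaceTime n → ℝ) (z : SpaceTime n) : Jet n :=
  (v z, dirDeriv (timeDir n) v z, fun i => dirDeriv (spaceDir i) v z,
    ∑ i, dirDeriv (spaceDir i) (dirDeriv (spaceDir i) v) z)

/-- The jet formed from given weak derivatives. -/
def sobolevJet {n : ℕ} (u ut : SpaceTime n → ℝ) (Du : Fin n → SpaceTime n → ℝ)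
    (D2u : Fin n → Fin n → SpaceTime n → ℝ) (z : SpaceTime n) : Jet n :=
  (u z, ut z, fun i => Du i z, ∑ i, D2u i i z)

/-- An integrand `Φ` depending on position and jet which is continuous and has polynomial growth
in the jet, uniformly in the position. -/
def Tame {n : ℕ} (Φ : SpaceTime n → Jet n → ℝ) : Prop :=
  Continuous (fun p : SpaceTime n × Jet n => Φ p.1 p.2) ∧
    ∃ (C : ℝ) (m : ℕ), ∀ z j, |Φ z j| ≤ C * (1 + ‖j‖) ^ m

variable {n : ℕ}

theorem contDiff_mollify (η : ContDiffBump (0 : SpaceTime n)) {u : SpaceTime n → ℝ}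
    (hu : LocallyIntegrable u volume) : ContDiff ℝ ∞ (mollify η u) := by
  rw [mollify_eq_convolution]
  exact η.hasCompactSupport_normed.contDiff_convolution_left _ η.contDiff_normed hu

theorem dirDeriv_mollify (η : ContDiffBump (0 : SpaceTime n)) {e : SpaceTime n}
    {u g : SpaceTime n → ℝ} (h : HasWeakDeriv e u g) :
    dirDeriv e (mollify η u) = mollify η g := by
  obtain ⟨hu, hg, hφ⟩ := h
  funext z
  have hη : ContDiff ℝ ∞ (η.normed (volume : Measure (SpaceTime n))) := η.contDiff_normed
  have h1 := η.hasCompactSupport_normed.hasFDerivAt_convolution_left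
    (ContinuousLinearMap.lsmul ℝ ℝ) (μ := (volume : Measure (SpaceTime n)))
    (hη.of_le (by exact_mod_cast le_top)) hu z
  rw [← mollify_eq_convolution] at h1
  rw [dirDeriv, h1.fderiv, convolution_eq_swap]
  have hcs : HasCompactSupport (fun y => η.normed (volume : Measure (SpaceTime n)) (z - y)) :=
    η.hasCompactSupport_normed.comp_homeomorph (Homeomorph.subLeft z)
  have hsm : ContDiff ℝ ∞ (fun y => η.normed (volume : Measure (SpaceTime n)) (z - y)) :=
    hη.comp (contDiff_const.sub contDiff_id)
  have h2 := hφ _ hsm hcs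
  have h3 : ∀ y, fderiv ℝ (fun y => η.normed (volume : Measure (SpaceTime n)) (z - y)) y e =
      - fderiv ℝ (η.normed (volume : Measure (SpaceTime n))) (z - y) e := by
    intro y
    have hd : HasFDerivAt (η.normed (volume : Measure (SpaceTime n)))
        (fderiv ℝ (η.normed (volume : Measure (SpaceTime n))) (z - y)) (z - y) :=
      ((hη.differentiable (by simp)) (z - y)).hasFDerivAt
    have := hd.comp y ((hasFDerivAt_const z y).sub (hasFDerivAt_id y))
    have h4 := this.fderiv
    simp only [Function.comp_def] at h4
    rw [h4]
    simp
  simp only [h3, mul_neg, integral_neg, neg_inj] at h2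
  rw [ContinuousLinearMap.integral_apply]
  · simp only [mollify, smul_eq_mul]
    rw [← (by simp only [mul_comm] : ∫ y, g y * η.normed volume (z - y) =
      ∫ y, η.normed volume (z - y) * g y), ← h2]
    refine integral_congr_ae (Eventually.of_forall fun y => ?_)
    simp [ContinuousLinearMap.precompL_apply, mul_comm]
  · have hex := (η.hasCompactSupport_normed (μ := (volume : Measure (SpaceTime n)))).fderiv ℝ
      |>.convolutionExists_left
      ((ContinuousLinearMap.lsmul ℝ ℝ : ℝ →L[ℝ] ℝ →L[ℝ] ℝ).precompL (SpaceTime n))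
      (hη.continuous_fderiv (by simp)) hu z
    exact (convolutionExistsAt_iff_integrable_swap).1 hex

theorem mollify_nonneg (η : ContDiffBump (0 : SpaceTime n)) {u : SpaceTime n → ℝ}
    (hu : ∀ᵐ z, 0 ≤ u z) (z : SpaceTime n) : 0 ≤ mollify η u z := by
  refine integral_nonneg_of_ae (hu.mono fun y hy => ?_)
  exact mul_nonneg (η.nonneg_normed _) hy

theorem map_mollify {F G : Type*} [NormedAddCommGroup F] [NormedSpace ℝ F] [CompleteSpace F]
    [NormedAddCommGroup G] [NormedSpace ℝ G] [CompleteSpace G] (A : F →L[ℝ] G)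
    (η : ContDiffBump (0 : SpaceTime n)) {g : SpaceTime n → F} (hg : LocallyIntegrable g volume)
    (z : SpaceTime n) : A (mollify η g z) = mollify η (fun y => A (g y)) z := by
  have : Integrable (fun y => η.normed volume (z - y) • g y) := by
    refine hg.integrable_smul_left_of_hasCompactSupport
      (η.continuous_normed.comp (continuous_const.sub continuous_id)) ?_
    exact η.hasCompactSupport_normed.comp_homeomorph (Homeomorph.subLeft z)
  rw [mollify, ← A.integral_comp_comm this]
  simp [mollify]

theorem mollify_sobolevJet (η : ContDiffBump (0 : SpaceTime n)) {r : ℝ≥0∞}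
    {u ut : SpaceTime n → ℝ} {Du : Fin n → SpaceTime n → ℝ} {D2u : Fin n → Fin n → SpaceTime n → ℝ}
    (h : MemParabolicSobolevLoc r u ut Du D2u)
    (hJ : LocallyIntegrable (sobolevJet u ut Du D2u) volume) :
    mollify η (sobolevJet u ut Du D2u) = jetOf (mollify η u) := by
  funext z
  have h1 := map_mollify (.fst ℝ ℝ (ℝ × (Fin n → ℝ) × ℝ)) η hJ z
  have h2 := map_mollify ((ContinuousLinearMap.fst ℝ ℝ _).comp
    (.snd ℝ ℝ (ℝ × (Fin n → ℝ) × ℝ))) η hJ z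
  have h3 := fun i => map_mollify (((ContinuousLinearMap.proj i).comp (.fst ℝ (Fin n → ℝ) ℝ)).comp
    ((ContinuousLinearMap.snd ℝ ℝ _).comp (.snd ℝ ℝ (ℝ × (Fin n → ℝ) × ℝ)))) η hJ z
  have h4 := map_mollify ((ContinuousLinearMap.snd ℝ (Fin n → ℝ) ℝ).comp
    ((ContinuousLinearMap.snd ℝ ℝ _).comp (.snd ℝ ℝ (ℝ × (Fin n → ℝ) × ℝ)))) η hJ z
  have hsum : mollify η (fun y => ∑ i, D2u i i y) z = ∑ i, mollify η (D2u i i) z := by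
    simp only [mollify, smul_eq_mul, Finset.mul_sum]
    refine integral_finsetSum _ fun i _ => ?_
    refine (h.hasWeakDeriv_space_space i i).2.1.integrable_smul_left_of_hasCompactSupport
      (η.continuous_normed.comp (continuous_const.sub continuous_id)) ?_
    exact η.hasCompactSupport_normed.comp_homeomorph (Homeomorph.subLeft z)
  simp only [ContinuousLinearMap.coe_comp, Function.comp_apply, ContinuousLinearMap.coe_fst',
    ContinuousLinearMap.coe_snd', ContinuousLinearMap.proj_apply, sobolevJet] at h1 h2 h3 h4
  refine Prod.ext h1 (Prod.ext (h2.trans ?_) (Prod.ext (funext fun i => (h3 i).trans ?_)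
    (h4.trans ?_)))
  · simp only [jetOf, dirDeriv_mollify η h.hasWeakDeriv_time]
  · simp only [jetOf, dirDeriv_mollify η (h.hasWeakDeriv_space i)]
  · simp only [jetOf, hsum]
    refine Finset.sum_congr rfl fun i _ => ?_
    rw [dirDeriv_mollify η (h.hasWeakDeriv_space i),
      dirDeriv_mollify η (h.hasWeakDeriv_space_space i i)]

/-- Along mollifications with rapidly shrinking radii, jets converge almost everywhere on a compact
set and are dominated there by a single function in `L^m`. -/
theorem exists_mollify_seq_dominated {F : Type*} [NormedAddCommGroup F] [NormedSpace ℝ F]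
    [CompleteSpace F] {g : SpaceTime n → F} (hgl : LocallyIntegrable g volume) {m : ℕ} (hm : 1 ≤ m)
    (hg : ∀ K : Set (SpaceTime n), IsCompact K → MemLp g m (volume.restrict K))
    {K : Set (SpaceTime n)} (hK : IsCompact K) :
    ∃ (η : ℕ → ContDiffBump (0 : SpaceTime n)) (B : SpaceTime n → ℝ),
      IntegrableOn B K volume ∧
      (∀ᵐ z ∂volume.restrict K, Tendsto (fun k => mollify (η k) g z) atTop (𝓝 (g z))) ∧
      (∀ᵐ z ∂volume.restrict K, (1 + ‖g z‖) ^ m ≤ B z) ∧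
      ∀ᵐ z ∂volume.restrict K, ∀ k, (1 + ‖mollify (η k) g z‖) ^ m ≤ B z := by
  have hm0 : m ≠ 0 := by omega
  have hgl' : AEStronglyMeasurable g (volume.restrict K) := (hg K hK).aestronglyMeasurable
  choose r hr hη using fun k : ℕ => exists_forall_eLpNorm_mollify_sub_le hm hg hK
    (δ := (2⁻¹ : ℝ≥0∞) ^ k) (by simp)
  let η : ℕ → ContDiffBump (0 : SpaceTime n) := fun k =>
    ⟨r k / 2, r k, half_pos (hr k), half_lt_self (hr k)⟩
  -- the errors are summable in `L^m`, so their sum dominates all of them and is finite a.e.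
  set E : ℕ → SpaceTime n → ℝ≥0∞ := fun k z => ‖mollify (η k) g z - g z‖ₑ ^ m with hE
  have hEm : ∀ k, AEMeasurable (E k) (volume.restrict K) := fun k =>
    ((continuous_mollify (η k) hgl).aestronglyMeasurable.sub hgl').enorm.pow_const m
  have hsum : ∫⁻ z in K, ∑' k, E k z ≠ ⊤ := by
    rw [lintegral_tsum hEm]
    refine ne_top_of_le_ne_top (b := ∑' k : ℕ, (2⁻¹ : ℝ≥0∞) ^ k) ?_
      (ENNReal.tsum_le_tsum fun k => ?_)
    · rw [ENNReal.tsum_geometric, ENNReal.one_sub_inv_two, inv_inv]; simp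
    · have h := hη k (η k) le_rfl
      have h2 := eLpNorm_natCast_pow (μ := volume.restrict K) (mollify (η k) g - g) hm
      simp only [Pi.sub_apply] at h2
      simp only [hE]
      rw [← h2]
      refine (pow_le_pow_left' h m).trans ?_
      rw [← pow_mul, mul_comm]
      rw [pow_mul]
      refine pow_le_pow_left' ?_ k
      exact pow_le_of_le_one (by simp) (by simp) hm0
  have hae : ∀ᵐ z ∂volume.restrict K, ∑' k, E k z < ⊤ :=
    ae_lt_top' (AEMeasurable.tsum hEm) hsum
  set S : SpaceTime n → ℝ := fun z => (∑' k, E k z).toReal with hS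
  have hSi : IntegrableOn S K volume := integrable_toReal_of_lintegral_ne_top
    (AEMeasurable.tsum hEm) hsum
  have hEle : ∀ z, ∑' k, E k z < ⊤ → ∀ k, ‖mollify (η k) g z - g z‖ ^ m ≤ S z := by
    intro z hz k
    have h1 : E k z ≤ ∑' k, E k z := ENNReal.le_tsum k
    have h2 := ENNReal.toReal_mono hz.ne h1
    simpa [hE, ENNReal.toReal_pow] using h2
  have hpow : ∀ x y : ℝ, 0 ≤ x → 0 ≤ y → (1 + x + y) ^ m ≤ 3 ^ m * (1 + x ^ m + y ^ m) := by
    intro x y hx hy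
    have h0 : 1 + x + y ≤ 3 * max 1 (max x y) := by
      have := le_max_left 1 (max x y)
      have := (le_max_left x y).trans (le_max_right 1 (max x y))
      have := (le_max_right x y).trans (le_max_right 1 (max x y))
      linarith
    refine (pow_le_pow_left₀ (by positivity) h0 m).trans ?_
    rw [mul_pow]
    refine mul_le_mul_of_nonneg_left ?_ (by positivity)
    have hx' : 0 ≤ x ^ m := by positivity
    have hy' : 0 ≤ y ^ m := by positivity
    rcases max_cases 1 (max x y) with ⟨h, _⟩ | ⟨h, _⟩ <;> rw [h]
    · simp; linarith
    · rcases max_cases x y with ⟨h, _⟩ | ⟨h, _⟩ <;> rw [h] <;> linarith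
  refine ⟨η, fun z => 3 ^ m * (1 + ‖g z‖ ^ m + S z), ?_, ?_, ?_, ?_⟩
  · have : IsFiniteMeasure (volume.restrict K) := ⟨by simpa using hK.measure_lt_top⟩
    refine Integrable.const_mul ((Integrable.add (integrable_const _) ?_).add hSi) _
    exact (hg K hK).integrable_norm_pow hm0
  · filter_upwards [hae] with z hz
    have ht : Tendsto (fun k => E k z) atTop (𝓝 0) :=
      ENNReal.tendsto_atTop_zero_of_tsum_ne_top hz.ne
    have h1 : Tendsto (fun k => ‖mollify (η k) g z - g z‖ₑ) atTop (𝓝 0) := by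
      have h2 := (ENNReal.continuous_rpow_const (y := 1 / (m : ℝ))).tendsto 0 |>.comp ht
      rw [ENNReal.zero_rpow_of_pos (by positivity)] at h2
      refine h2.congr fun k => ?_
      simp only [hE, Function.comp_apply]
      rw [← ENNReal.rpow_natCast, ← ENNReal.rpow_mul, mul_one_div_cancel (by exact_mod_cast hm0),
        ENNReal.rpow_one]
    rw [tendsto_iff_norm_sub_tendsto_zero]
    have h3 := (ENNReal.tendsto_toReal ENNReal.zero_ne_top).comp h1
    simpa [Function.comp_def] using h3
  · filter_upwards [hae] with z hz
    have hS0 : 0 ≤ S z := ENNReal.toReal_nonneg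
    have := hpow ‖g z‖ 0 (norm_nonneg _) le_rfl
    simp only [add_zero, zero_pow hm0] at this
    refine this.trans (mul_le_mul_of_nonneg_left (by linarith) (by positivity))
  · filter_upwards [hae] with z hz k
    have h1 : 1 + ‖mollify (η k) g z‖ ≤ 1 + ‖g z‖ + ‖mollify (η k) g z - g z‖ := by
      have := norm_add_le (g z) (mollify (η k) g z - g z)
      rw [add_sub_cancel] at this
      linarith
    refine (pow_le_pow_left₀ (by positivity) h1 m).trans
      ((hpow _ _ (norm_nonneg _) (norm_nonneg _)).trans ?_)
    exact mul_le_mul_of_nonneg_left (by linarith [hEle z hz k]) (by positivity)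

/-- The Sobolev hypotheses on a nonnegative function `u`, in terms of its jet `J`: the jet is
locally in every `L^m`, and mollification of the jet gives the jet of the mollification. -/
structure SobolevJet (u : SpaceTime n → ℝ) (J : SpaceTime n → Jet n) : Prop where
  nonneg : ∀ᵐ z, 0 ≤ u z
  fst_eq : ∀ z, (J z).1 = u z
  locallyIntegrable : LocallyIntegrable J volume
  locallyIntegrable_fst : LocallyIntegrable u volume
  memLp : ∀ (m : ℕ) (K : Set (SpaceTime n)), IsCompact K → MemLp J m (volume.restrict K)
  mollify_eq : ∀ η : ContDiffBump (0 : SpaceTime n), mollify η J = jetOf (mollify η u)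

theorem sobolevJet_of_forall_mem {u ut : SpaceTime n → ℝ} {Du : Fin n → SpaceTime n → ℝ}
    {D2u : Fin n → Fin n → SpaceTime n → ℝ} (hu : ∀ᵐ z, 0 ≤ u z)
    (h : ∀ r : ℝ≥0∞, 1 ≤ r → r < ⊤ → MemParabolicSobolevLoc r u ut Du D2u) :
    SobolevJet u (sobolevJet u ut Du D2u) := by
  have hmem1 : ∀ (m : ℕ) (K : Set (SpaceTime n)), 1 ≤ m → IsCompact K →
      MemLp (sobolevJet u ut Du D2u) m (volume.restrict K) := by
    intro m K hm hK
    obtain ⟨-, -, -, h0, h1, h2, h3⟩ := h m (by exact_mod_cast hm) (ENNReal.natCast_lt_top m)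
    have g0 := h0 K hK
    have g1 := h1 K hK
    have g2 := fun i => h2 i K hK
    have g3 : MemLp (fun z => ∑ i, D2u i i z) m (volume.restrict K) :=
      memLp_finsetSum _ fun i _ => h3 i i K hK
    have g2' : MemLp (fun z => ∑ i, ‖Du i z‖) m (volume.restrict K) :=
      memLp_finsetSum _ fun i _ => (g2 i).norm
    have gm : AEStronglyMeasurable (sobolevJet u ut Du D2u) (volume.restrict K) := by
      refine g0.1.prodMk (g1.1.prodMk (AEStronglyMeasurable.prodMk ?_ g3.1))
      exact (aemeasurable_pi_lambda _ fun i => (g2 i).1.aemeasurable).aestronglyMeasurable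
    refine MemLp.mono ((((g0.norm.add g1.norm).add g2')).add g3.norm) gm
      (Eventually.of_forall fun z => ?_)
    have e1 : 0 ≤ ‖u z‖ := norm_nonneg _
    have e2 : 0 ≤ ‖ut z‖ := norm_nonneg _
    have e3 : 0 ≤ ∑ i, ‖Du i z‖ := Finset.sum_nonneg fun i _ => norm_nonneg _
    have e4 : 0 ≤ ‖∑ i, D2u i i z‖ := norm_nonneg _
    have e5 : ‖fun i => Du i z‖ ≤ ∑ i, ‖Du i z‖ := by
      refine (pi_norm_le_iff_of_nonneg e3).2 fun i => ?_
      exact Finset.single_le_sum (f := fun i => ‖Du i z‖) (fun i _ => norm_nonneg _)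
        (Finset.mem_univ i)
    simp only [Pi.add_apply]
    rw [Real.norm_of_nonneg (r := ‖u z‖ + ‖ut z‖ + ∑ i, ‖Du i z‖ + ‖∑ i, D2u i i z‖)
      (by positivity)]
    simp only [sobolevJet, Prod.norm_def]
    refine max_le (by linarith) (max_le (by linarith) (max_le (by linarith) (by linarith)))
  have hmem : ∀ (m : ℕ) (K : Set (SpaceTime n)), IsCompact K →
      MemLp (sobolevJet u ut Du D2u) m (volume.restrict K) := by
    intro m K hK
    have : IsFiniteMeasure (volume.restrict K) := ⟨by simpa using hK.measure_lt_top⟩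
    exact (hmem1 (m + 1) K (by omega) hK).mono_exponent (by exact_mod_cast Nat.le_succ m)
  have hloc : LocallyIntegrable (sobolevJet u ut Du D2u) volume := by
    rw [locallyIntegrable_iff]
    intro K hK
    have := hmem 1 K hK
    rw [Nat.cast_one, memLp_one_iff_integrable] at this
    exact this
  exact ⟨hu, fun z => rfl, hloc, (h 1 le_rfl (by simp)).hasWeakDeriv_time.1, hmem,
    fun η => mollify_sobolevJet η (h 1 le_rfl (by simp)) hloc⟩

theorem Tame.exists_pos {Φ : SpaceTime n → Jet n → ℝ} (h : Tame Φ) :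
    ∃ (C : ℝ) (m : ℕ), 0 ≤ C ∧ 1 ≤ m ∧ ∀ z j, |Φ z j| ≤ C * (1 + ‖j‖) ^ m := by
  obtain ⟨-, C, m, hC⟩ := h
  refine ⟨|C|, m + 1, abs_nonneg _, by omega, fun z j => (hC z j).trans ?_⟩
  have h1 : (1 : ℝ) ≤ 1 + ‖j‖ := by linarith [norm_nonneg j]
  exact mul_le_mul (le_abs_self C) (pow_le_pow_right₀ h1 (by omega)) (by positivity)
    (abs_nonneg _)

theorem SobolevJet.integrable {u : SpaceTime n → ℝ} {J : SpaceTime n → Jet n}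
    (hJ : SobolevJet u J) {Φ : SpaceTime n → Jet n → ℝ} (hΦ : Tame Φ) {K : Set (SpaceTime n)}
    (hK : IsCompact K) (hΦK : ∀ z ∉ K, ∀ j, Φ z j = 0) :
    Integrable (fun z => Φ z (J z)) := by
  obtain ⟨C, m, hC, hm, hb⟩ := hΦ.exists_pos
  obtain ⟨η, B, hB, -, hB1, -⟩ := exists_mollify_seq_dominated hJ.locallyIntegrable hm
    (hJ.memLp m) hK
  have : IntegrableOn (fun z => Φ z (J z)) K := by
    refine Integrable.mono' (hB.const_mul C) ?_ ?_
    · exact (hΦ.1.comp_aestronglyMeasurable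
        (aestronglyMeasurable_id.prodMk hJ.locallyIntegrable.aestronglyMeasurable)).restrict
    · filter_upwards [hB1] with z hz
      exact (hb z _).trans (mul_le_mul_of_nonneg_left hz hC)
  exact (integrableOn_iff_integrable_of_support_subset
    (fun z hz => by_contra fun h => hz (hΦK z h _))).1 this

/-- The value of a tame, compactly supported integral functional at a Sobolev function is the limit
of its values at smooth nonnegative functions. -/
theorem SobolevJet.exists_tendsto {u : SpaceTime n → ℝ} {J : SpaceTime n → Jet n}
    (hJ : SobolevJet u J) {Φ : SpaceTime n → Jet n → ℝ} (hΦ : Tame Φ) {K : Set (SpaceTime n)}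
    (hK : IsCompact K) (hΦK : ∀ z ∉ K, ∀ j, Φ z j = 0) :
    ∃ v : ℕ → SpaceTime n → ℝ, (∀ k, ContDiff ℝ ∞ (v k)) ∧ (∀ k z, 0 ≤ v k z) ∧
      Tendsto (fun k => ∫ z, Φ z (jetOf (v k) z)) atTop (𝓝 (∫ z, Φ z (J z))) := by
  obtain ⟨C, m, hC, hm, hb⟩ := hΦ.exists_pos
  obtain ⟨η, B, hB, hlim, -, hB2⟩ := exists_mollify_seq_dominated hJ.locallyIntegrable hm
    (hJ.memLp m) hK
  refine ⟨fun k => mollify (η k) u, fun k => contDiff_mollify _ hJ.locallyIntegrable_fst,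
    fun k z => mollify_nonneg _ hJ.nonneg z, ?_⟩
  have hset : ∀ j : SpaceTime n → Jet n, ∫ z, Φ z (j z) = ∫ z in K, Φ z (j z) := fun j =>
    (setIntegral_eq_integral_of_forall_compl_eq_zero fun z hz => hΦK z hz _).symm
  simp_rw [hset, ← hJ.mollify_eq]
  refine tendsto_integral_of_dominated_convergence (fun z => C * B z) (fun k => ?_)
    (hB.const_mul C) (fun k => ?_) ?_
  · exact (hΦ.1.comp (continuous_id.prodMk
      (continuous_mollify (η k) hJ.locallyIntegrable))).aestronglyMeasurable
  · filter_upwards [hB2] with z hz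
    exact (hb z _).trans (mul_le_mul_of_nonneg_left (hz k) hC)
  · filter_upwards [hlim] with z hz
    exact (hΦ.1.tendsto (z, J z)).comp (tendsto_const_nhds.prodMk_nhds hz)

theorem SobolevJet.integral_eq_zero {u : SpaceTime n → ℝ} {J : SpaceTime n → Jet n}
    (hJ : SobolevJet u J) {Φ : SpaceTime n → Jet n → ℝ} (hΦ : Tame Φ) {K : Set (SpaceTime n)}
    (hK : IsCompact K) (hΦK : ∀ z ∉ K, ∀ j, Φ z j = 0)
    (h : ∀ v : SpaceTime n → ℝ, ContDiff ℝ ∞ v → (∀ z, 0 ≤ v z) →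
      ∫ z, Φ z (jetOf v z) = 0) : ∫ z, Φ z (J z) = 0 := by
  obtain ⟨v, hv, hv0, hlim⟩ := hJ.exists_tendsto hΦ hK hΦK
  simp only [fun k => h (v k) (hv k) (hv0 k)] at hlim
  exact tendsto_nhds_unique hlim tendsto_const_nhds

theorem SobolevJet.integral_nonpos {u : SpaceTime n → ℝ} {J : SpaceTime n → Jet n}
    (hJ : SobolevJet u J) {Φ : SpaceTime n → Jet n → ℝ} (hΦ : Tame Φ) {K : Set (SpaceTime n)}
    (hK : IsCompact K) (hΦK : ∀ z ∉ K, ∀ j, Φ z j = 0)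
    (h : ∀ v : SpaceTime n → ℝ, ContDiff ℝ ∞ v → (∀ z, 0 ≤ v z) →
      ∫ z, Φ z (jetOf v z) ≤ 0) : ∫ z, Φ z (J z) ≤ 0 := by
  obtain ⟨v, hv, hv0, hlim⟩ := hJ.exists_tendsto hΦ hK hΦK
  exact le_of_tendsto' hlim fun k => h (v k) (hv k) (hv0 k)

end

/-! ### Integral identities for smooth functions -/

section

variable {n : ℕ}

theorem contDiff_dirDeriv {v : SpaceTime n → ℝ} (hv : ContDiff ℝ ∞ v) (e : SpaceTime n) :
    ContDiff ℝ ∞ (dirDeriv e v) :=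
  (hv.fderiv_right (m := ∞) (by simp)).clm_apply contDiff_const

theorem continuous_dirDeriv {v : SpaceTime n → ℝ} (hv : ContDiff ℝ 1 v) (e : SpaceTime n) :
    Continuous (dirDeriv e v) :=
  (hv.continuous_fderiv (by simp)).clm_apply continuous_const

theorem dirDeriv_sub {a b : SpaceTime n → ℝ} {e z : SpaceTime n} (ha : DifferentiableAt ℝ a z)
    (hb : DifferentiableAt ℝ b z) :
    dirDeriv e (fun z => a z - b z) z = dirDeriv e a z - dirDeriv e b z := by
  simp [dirDeriv, fderiv_fun_sub ha hb]

theorem dirDeriv_mul {a b : SpaceTime n → ℝ} {e z : SpaceTime n} (ha : DifferentiableAt ℝ a z)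
    (hb : DifferentiableAt ℝ b z) :
    dirDeriv e (fun z => a z * b z) z = dirDeriv e a z * b z + a z * dirDeriv e b z := by
  simp [dirDeriv, fderiv_fun_mul ha hb]; ring

theorem dirDeriv_sum {ι : Type*} {s : Finset ι} {a : ι → SpaceTime n → ℝ} {e z : SpaceTime n}
    (ha : ∀ i ∈ s, DifferentiableAt ℝ (a i) z) :
    dirDeriv e (fun z => ∑ i ∈ s, a i z) z = ∑ i ∈ s, dirDeriv e (a i) z := by
  simp only [dirDeriv, fderiv_fun_sum ha, sum_apply]

theorem dirDeriv_comp {h : ℝ → ℝ} {h' : ℝ} {a : SpaceTime n → ℝ} {e z : SpaceTime n}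
    (hh : HasDerivAt h h' (a z)) (ha : DifferentiableAt ℝ a z) :
    dirDeriv e (fun z => h (a z)) z = h' * dirDeriv e a z := by
  have := (hh.comp_hasFDerivAt z ha.hasFDerivAt).fderiv
  simp only [Function.comp_def] at this
  simp [dirDeriv, this]

theorem dirDeriv_comm {v : SpaceTime n → ℝ} (hv : ContDiff ℝ ∞ v) (e e' z : SpaceTime n) :
    dirDeriv e (dirDeriv e' v) z = dirDeriv e' (dirDeriv e v) z := by
  have hd : DifferentiableAt ℝ (fderiv ℝ v) z :=
    (hv.fderiv_right (m := ∞) (by simp)).differentiable (by simp) z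
  have h : ∀ e e' : SpaceTime n, dirDeriv e (dirDeriv e' v) z = fderiv ℝ (fderiv ℝ v) z e e' := by
    intro e e'
    have := (hd.hasFDerivAt.clm_apply (hasFDerivAt_const e' z)).fderiv
    simp only [dirDeriv] at this ⊢
    have h' : dirDeriv e' v = fun y => (fderiv ℝ v y) e' := rfl
    rw [h', this]
    simp
  rw [h, h]
  have hs : IsSymmSndFDerivAt ℝ v z :=
    hv.contDiffAt.isSymmSndFDerivAt (by
      rw [minSmoothness_of_isRCLikeNormedField]; exact WithTop.coe_le_coe.2 le_top)
  exact hs e e'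

theorem integral_dirDeriv_eq_zero {w : SpaceTime n → ℝ} (hw : ContDiff ℝ 1 w)
    (hc : HasCompactSupport w) (e : SpaceTime n) : ∫ z, dirDeriv e w z = 0 := by
  have hcd : HasCompactSupport (dirDeriv e w) := hc.fderiv_apply ℝ e
  have h := integral_mul_fderiv_eq_neg_fderiv_mul_of_integrable (𝕜 := ℝ)
    (μ := (volume : Measure (SpaceTime n))) (f := fun _ => (1 : ℝ)) (g := w) (v := e)
    (by simp) ?_ ?_ (by simp)
    (fun x _ => hw.differentiable (by simp) x)
  · simpa [dirDeriv] using h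
  · simp only [one_mul]
    exact (continuous_dirDeriv hw e).integrable_of_hasCompactSupport hcd
  · simp only [one_mul]
    exact hw.continuous.integrable_of_hasCompactSupport hc

/-- The divergence theorem for compactly supported space-time vector fields. -/
theorem integral_divergence_eq_zero {W : Fin n → SpaceTime n → ℝ} {W₀ : SpaceTime n → ℝ}
    (hW : ∀ i, ContDiff ℝ 1 (W i)) (hWc : ∀ i, HasCompactSupport (W i)) (hW₀ : ContDiff ℝ 1 W₀)
    (hW₀c : HasCompactSupport W₀) :
    Integrable (fun z => ∑ i, dirDeriv (spaceDir i) (W i) z + dirDeriv (timeDir n) W₀ z) ∧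
    ∫ z, (∑ i, dirDeriv (spaceDir i) (W i) z + dirDeriv (timeDir n) W₀ z) = 0 := by
  have h1 : ∀ (w : SpaceTime n → ℝ) (e : SpaceTime n), ContDiff ℝ 1 w → HasCompactSupport w →
      Integrable (dirDeriv e w) := fun w e hw hc =>
    (continuous_dirDeriv hw e).integrable_of_hasCompactSupport (hc.fderiv_apply ℝ e)
  have h2 : Integrable (fun z => ∑ i, dirDeriv (spaceDir i) (W i) z) :=
    integrable_finsetSum _ fun i _ => h1 _ _ (hW i) (hWc i)
  refine ⟨h2.add (h1 _ _ hW₀ hW₀c), ?_⟩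
  rw [integral_add h2 (h1 _ _ hW₀ hW₀c), integral_finsetSum _ fun i _ => h1 _ _ (hW i) (hWc i),
    integral_dirDeriv_eq_zero hW₀ hW₀c]
  simp [integral_dirDeriv_eq_zero (hW _) (hWc _)]

/-- The squared length of the gradient stored in a jet. -/
def Jet.gradSq (j : Jet n) : ℝ := ∑ i, j.2.2.1 i ^ 2

/-- The inner product of the gradient stored in a jet with the gradient of `φ`. -/
noncomputable def Jet.gradInner (φ : SpaceTime n → ℝ) (z : SpaceTime n) (j : Jet n) : ℝ :=
  ∑ i, j.2.2.1 i * dirDeriv (spaceDir i) φ z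

/-- The spatial Laplacian. -/
noncomputable def spaceLaplacian (φ : SpaceTime n → ℝ) (z : SpaceTime n) : ℝ :=
  ∑ i, dirDeriv (spaceDir i) (dirDeriv (spaceDir i) φ) z

theorem dirDeriv_gradSq {v : SpaceTime n → ℝ} (hv : ContDiff ℝ ∞ v) (e z : SpaceTime n) :
    dirDeriv e (fun z => (jetOf v z).gradSq) z =
      ∑ i, 2 * dirDeriv (spaceDir i) v z * dirDeriv e (dirDeriv (spaceDir i) v) z := by
  have hd : ∀ i, DifferentiableAt ℝ (dirDeriv (spaceDir i) v) z := fun i =>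
    (contDiff_dirDeriv hv _).differentiable (by simp) z
  simp only [Jet.gradSq, jetOf, pow_two]
  rw [dirDeriv_sum (fun i _ => (hd i).fun_mul (hd i))]
  refine Finset.sum_congr rfl fun i _ => ?_
  rw [dirDeriv_mul (hd i) (hd i)]; ring

theorem contDiff_gradSq {v : SpaceTime n → ℝ} (hv : ContDiff ℝ ∞ v) :
    ContDiff ℝ ∞ (fun z => (jetOf v z).gradSq) :=
  ContDiff.sum fun _ _ => (contDiff_dirDeriv hv _).pow 2

/-- Multiplication of the equation by `φ u_t`. -/
theorem integral_timeDeriv_mul_laplacian {φ v : SpaceTime n → ℝ} (hφ : ContDiff ℝ ∞ φ)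
    (hφc : HasCompactSupport φ) (hv : ContDiff ℝ ∞ v) :
    ∫ z, (φ z * (jetOf v z).2.1 * (jetOf v z).2.2.2
      - dirDeriv (timeDir n) φ z * (jetOf v z).gradSq / 2
      + (jetOf v z).2.1 * (jetOf v z).gradInner φ z) = 0 := by
  have hvt := contDiff_dirDeriv hv (timeDir n)
  have hvi := fun i => contDiff_dirDeriv hv (spaceDir i)
  have hg := contDiff_gradSq hv
  have one_le : (1 : WithTop ℕ∞) ≤ (∞ : WithTop ℕ∞) := by exact_mod_cast le_top
  rw [← (integral_divergence_eq_zero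
    (W := fun i z => φ z * (dirDeriv (timeDir n) v z * dirDeriv (spaceDir i) v z))
    (W₀ := fun z => φ z * (-1 / 2 * (jetOf v z).gradSq))
    (fun i => (hφ.mul (hvt.mul (hvi i))).of_le one_le) (fun i => hφc.mul_right)
    ((hφ.mul (contDiff_const.mul hg)).of_le one_le) hφc.mul_right).2]
  refine integral_congr_ae (Eventually.of_forall fun z => ?_)
  have dφ : DifferentiableAt ℝ φ z := hφ.differentiable (by simp) z
  have dt : DifferentiableAt ℝ (dirDeriv (timeDir n) v) z := hvt.differentiable (by simp) z
  have di := fun i => (hvi i).differentiable (by simp) z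
  have dg : DifferentiableAt ℝ (fun z => (jetOf v z).gradSq) z := hg.differentiable (by simp) z
  have e1 : ∀ i, dirDeriv (spaceDir i)
      (fun z => φ z * (dirDeriv (timeDir n) v z * dirDeriv (spaceDir i) v z)) z =
      dirDeriv (timeDir n) v z * (dirDeriv (spaceDir i) v z * dirDeriv (spaceDir i) φ z) +
      φ z * (dirDeriv (spaceDir i) v z * dirDeriv (timeDir n) (dirDeriv (spaceDir i) v) z) +
      φ z * dirDeriv (timeDir n) v z * dirDeriv (spaceDir i) (dirDeriv (spaceDir i) v) z := by
    intro i
    rw [dirDeriv_mul dφ (dt.fun_mul (di i)), dirDeriv_mul dt (di i),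
      dirDeriv_comm hv (spaceDir i) (timeDir n)]
    ring
  have e2 : dirDeriv (timeDir n) (fun z => φ z * (-1 / 2 * (jetOf v z).gradSq)) z =
      dirDeriv (timeDir n) φ z * (-1 / 2 * (jetOf v z).gradSq) - φ z *
      ∑ i, dirDeriv (spaceDir i) v z * dirDeriv (timeDir n) (dirDeriv (spaceDir i) v) z := by
    rw [dirDeriv_mul dφ (dg.const_mul _), dirDeriv_mul (by fun_prop) dg, dirDeriv_gradSq hv]
    simp only [mul_assoc, ← Finset.mul_sum]
    simp [dirDeriv]
    ring
  simp only [e1, e2, Finset.sum_add_distrib, ← Finset.mul_sum]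
  simp only [jetOf, Jet.gradSq, Jet.gradInner]
  ring

/-- Multiplication of the equation by `φ h(u)`, the elliptic part. -/
theorem integral_comp_mul_laplacian {φ v : SpaceTime n → ℝ} (hφ : ContDiff ℝ ∞ φ)
    (hφc : HasCompactSupport φ) (hv : ContDiff ℝ ∞ v) {h ρ : ℝ → ℝ} (hρ : Continuous ρ)
    (hh : ∀ s, HasDerivAt h (ρ s) s) :
    ∫ z, (φ z * h (jetOf v z).1 * (jetOf v z).2.2.2 + φ z * ρ (jetOf v z).1 * (jetOf v z).gradSq
      + h (jetOf v z).1 * (jetOf v z).gradInner φ z) = 0 := by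
  have hvi := fun i => contDiff_dirDeriv hv (spaceDir i)
  have one_le : (1 : WithTop ℕ∞) ≤ (∞ : WithTop ℕ∞) := by exact_mod_cast le_top
  have hh1 : ContDiff ℝ 1 h := contDiff_one_iff_deriv.2
    ⟨fun s => (hh s).differentiableAt, by rwa [show deriv h = ρ from funext fun s => (hh s).deriv]⟩
  have hc : ContDiff ℝ 1 (fun z => h (v z)) := hh1.comp (hv.of_le one_le)
  rw [← (integral_divergence_eq_zero
    (W := fun i z => φ z * (h (v z) * dirDeriv (spaceDir i) v z)) (W₀ := fun z => 0)
    (fun i => (hφ.of_le one_le).mul (hc.mul ((hvi i).of_le one_le))) (fun i => hφc.mul_right)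
    contDiff_const .zero).2]
  refine integral_congr_ae (Eventually.of_forall fun z => ?_)
  have dφ : DifferentiableAt ℝ φ z := hφ.differentiable (by simp) z
  have dv : DifferentiableAt ℝ v z := hv.differentiable (by simp) z
  have di := fun i => (hvi i).differentiable (by simp) z
  have dh : DifferentiableAt ℝ (fun z => h (v z)) z := hc.differentiable (by simp) z
  have e1 : ∀ i, dirDeriv (spaceDir i) (fun z => φ z * (h (v z) * dirDeriv (spaceDir i) v z)) z =
      h (v z) * (dirDeriv (spaceDir i) v z * dirDeriv (spaceDir i) φ z) +
      φ z * ρ (v z) * dirDeriv (spaceDir i) v z ^ 2 +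
      φ z * h (v z) * dirDeriv (spaceDir i) (dirDeriv (spaceDir i) v) z := by
    intro i
    rw [dirDeriv_mul dφ (dh.fun_mul (di i)), dirDeriv_mul dh (di i), dirDeriv_comp (hh _) dv]
    ring
  have e2 : dirDeriv (timeDir n) (fun _ : SpaceTime n => (0 : ℝ)) z = 0 := by simp [dirDeriv]
  simp only [e1, e2, Finset.sum_add_distrib, ← Finset.mul_sum]
  simp only [jetOf, Jet.gradSq, Jet.gradInner]
  ring

/-- Multiplication of the equation by `φ h(u)`, the time derivative. -/
theorem integral_comp_mul_timeDeriv {φ v : SpaceTime n → ℝ} (hφ : ContDiff ℝ ∞ φ)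
    (hφc : HasCompactSupport φ) (hv : ContDiff ℝ ∞ v) {H h : ℝ → ℝ} (hh : Continuous h)
    (hH : ∀ s, HasDerivAt H (h s) s) :
    ∫ z, (φ z * h (jetOf v z).1 * (jetOf v z).2.1
      + dirDeriv (timeDir n) φ z * H (jetOf v z).1) = 0 := by
  have one_le : (1 : WithTop ℕ∞) ≤ (∞ : WithTop ℕ∞) := by exact_mod_cast le_top
  have hH1 : ContDiff ℝ 1 H := contDiff_one_iff_deriv.2
    ⟨fun s => (hH s).differentiableAt, by rwa [show deriv H = h from funext fun s => (hH s).deriv]⟩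
  have hc : ContDiff ℝ 1 (fun z => H (v z)) := hH1.comp (hv.of_le one_le)
  rw [← integral_dirDeriv_eq_zero (w := fun z => φ z * H (v z)) ((hφ.of_le one_le).mul hc)
    hφc.mul_right (timeDir n)]
  refine integral_congr_ae (Eventually.of_forall fun z => ?_)
  have dφ : DifferentiableAt ℝ φ z := hφ.differentiable (by simp) z
  have dv : DifferentiableAt ℝ v z := hv.differentiable (by simp) z
  have dh : DifferentiableAt ℝ (fun z => H (v z)) z := hc.differentiable (by simp) z
  simp only
  rw [dirDeriv_mul dφ dh, dirDeriv_comp (hH _) dv]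
  simp only [jetOf]
  ring

end

/-! ### Tame integrands and the Bochner inequality -/

section

variable {n : ℕ}

theorem Tame.add {Φ Ψ : SpaceTime n → Jet n → ℝ} (h : Tame Φ) (h' : Tame Ψ) :
    Tame (fun z j => Φ z j + Ψ z j) := by
  obtain ⟨C, m, hC, -, hb⟩ := h.exists_pos
  obtain ⟨C', m', hC', -, hb'⟩ := h'.exists_pos
  refine ⟨h.1.add h'.1, C + C', m + m', fun z j => (abs_add_le _ _).trans ?_⟩
  have h1 : (1 : ℝ) ≤ 1 + ‖j‖ := by linarith [norm_nonneg j]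
  rw [add_mul]
  exact add_le_add
    ((hb z j).trans (mul_le_mul_of_nonneg_left (pow_le_pow_right₀ h1 (by omega)) hC))
    ((hb' z j).trans (mul_le_mul_of_nonneg_left (pow_le_pow_right₀ h1 (by omega)) hC'))

theorem Tame.mul {Φ Ψ : SpaceTime n → Jet n → ℝ} (h : Tame Φ) (h' : Tame Ψ) :
    Tame (fun z j => Φ z j * Ψ z j) := by
  obtain ⟨C, m, hC, -, hb⟩ := h.exists_pos
  obtain ⟨C', m', hC', -, hb'⟩ := h'.exists_pos
  refine ⟨h.1.mul h'.1, C * C', m + m', fun z j => ?_⟩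
  rw [abs_mul, pow_add, mul_mul_mul_comm]
  exact mul_le_mul (hb z j) (hb' z j) (abs_nonneg _) (by positivity)

theorem tame_coeff {φ : SpaceTime n → ℝ} (hφ : Continuous φ) (hc : HasCompactSupport φ) :
    Tame (fun z (_ : Jet n) => φ z) := by
  obtain ⟨C, hC⟩ := hc.exists_bound_of_continuous hφ
  exact ⟨hφ.comp continuous_fst, C, 0, fun z j => by simpa using hC z⟩

theorem tame_const (c : ℝ) : Tame (fun (_ : SpaceTime n) (_ : Jet n) => c) :=
  ⟨continuous_const, |c|, 0, fun z j => by simp⟩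

theorem Tame.neg {Φ : SpaceTime n → Jet n → ℝ} (h : Tame Φ) : Tame (fun z j => - Φ z j) := by
  simpa using (tame_const (-1)).mul h

theorem Tame.sub {Φ Ψ : SpaceTime n → Jet n → ℝ} (h : Tame Φ) (h' : Tame Ψ) :
    Tame (fun z j => Φ z j - Ψ z j) := by
  simpa [sub_eq_add_neg] using h.add h'.neg

theorem Tame.pow {Φ : SpaceTime n → Jet n → ℝ} (h : Tame Φ) (k : ℕ) :
    Tame (fun z j => Φ z j ^ k) := by
  induction k with
  | zero => simpa using tame_const 1
  | succ k ih => simpa [pow_succ] using ih.mul h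

theorem Tame.sum {ι : Type*} {s : Finset ι} {Φ : ι → SpaceTime n → Jet n → ℝ}
    (h : ∀ i ∈ s, Tame (Φ i)) : Tame (fun z j => ∑ i ∈ s, Φ i z j) := by
  classical
  induction s using Finset.induction_on with
  | empty => simpa using tame_const 0
  | insert a s ha ih =>
    simp only [Finset.sum_insert ha]
    exact (h a (by simp)).add (ih fun i hi => h i (by simp [hi]))

theorem Tame.of_abs_le {Φ Ψ : SpaceTime n → Jet n → ℝ} (h : Tame Ψ)
    (hc : Continuous (fun p : SpaceTime n × Jet n => Φ p.1 p.2)) (hle : ∀ z j, |Φ z j| ≤ Ψ z j) :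
    Tame Φ := by
  obtain ⟨-, C, m, hb⟩ := h
  exact ⟨hc, C, m, fun z j => (hle z j).trans ((le_abs_self _).trans (hb z j))⟩

theorem Tame.abs {Φ : SpaceTime n → Jet n → ℝ} (h : Tame Φ) : Tame (fun z j => |Φ z j|) := by
  obtain ⟨hc, C, m, hb⟩ := h
  exact ⟨hc.abs, C, m, fun z j => by simpa using hb z j⟩

theorem tame_of_lipschitz_zero {Φ : Jet n → ℝ} (hc : Continuous Φ) (hb : ∀ j, |Φ j| ≤ ‖j‖) :
    Tame (fun (_ : SpaceTime n) j => Φ j) :=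
  ⟨hc.comp continuous_snd, 1, 1, fun z j => (hb j).trans (by simp)⟩

theorem tame_timeDeriv : Tame (fun (_ : SpaceTime n) (j : Jet n) => j.2.1) :=
  tame_of_lipschitz_zero (by fun_prop) fun j => (norm_fst_le j.2).trans (norm_snd_le j)

theorem tame_grad (i : Fin n) : Tame (fun (_ : SpaceTime n) (j : Jet n) => j.2.2.1 i) :=
  tame_of_lipschitz_zero (by fun_prop) fun j => (norm_le_pi_norm j.2.2.1 i).trans
    ((norm_fst_le j.2.2).trans ((norm_snd_le j.2).trans (norm_snd_le j)))

theorem tame_laplacian : Tame (fun (_ : SpaceTime n) (j : Jet n) => j.2.2.2) :=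
  tame_of_lipschitz_zero (by fun_prop) fun j =>
    (norm_snd_le j.2.2).trans ((norm_snd_le j.2).trans (norm_snd_le j))

theorem tame_gradSq : Tame (fun (_ : SpaceTime n) (j : Jet n) => j.gradSq) :=
  Tame.sum fun i _ => (tame_grad i).pow 2

theorem tame_dirDeriv {φ : SpaceTime n → ℝ} (hφ : ContDiff ℝ ∞ φ) (hc : HasCompactSupport φ)
    (e : SpaceTime n) : Tame (fun z (_ : Jet n) => dirDeriv e φ z) :=
  tame_coeff (contDiff_dirDeriv hφ e).continuous (hc.fderiv_apply ℝ e)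

theorem tame_spaceLaplacian {φ : SpaceTime n → ℝ} (hφ : ContDiff ℝ ∞ φ)
    (hc : HasCompactSupport φ) : Tame (fun z (_ : Jet n) => spaceLaplacian φ z) :=
  Tame.sum fun _ _ => tame_dirDeriv (contDiff_dirDeriv hφ _) (hc.fderiv_apply ℝ _) _

theorem tame_gradInner {φ : SpaceTime n → ℝ} (hφ : ContDiff ℝ ∞ φ) (hc : HasCompactSupport φ) :
    Tame (fun z (j : Jet n) => j.gradInner φ z) :=
  Tame.sum fun i _ => (tame_grad i).mul (tame_dirDeriv hφ hc _)

theorem tame_comp_of_bounded {h : ℝ → ℝ} (hh : Continuous h) {C : ℝ} (hb : ∀ s, |h s| ≤ C) :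
    Tame (fun (_ : SpaceTime n) (j : Jet n) => h j.1) :=
  ⟨hh.comp (continuous_fst.comp continuous_snd), C, 0, fun z j => by simpa using hb j.1⟩

/-- The positive number `u + ε` attached to the jet of a nonnegative function `u`; the positive part
makes it positive on all jets. -/
def Jet.shift (ε : ℝ) (j : Jet n) : ℝ := max j.1 0 + ε

theorem Jet.shift_pos {ε : ℝ} (hε : 0 < ε) (j : Jet n) : 0 < j.shift ε := by
  have := le_max_right j.1 0
  simp only [Jet.shift]; linarith

theorem tame_shift (ε : ℝ) : Tame (fun (_ : SpaceTime n) (j : Jet n) => j.shift ε) := by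
  refine Tame.add ?_ (tame_const ε)
  refine tame_of_lipschitz_zero (by fun_prop) fun j => ?_
  rw [abs_of_nonneg (le_max_right _ _)]
  exact max_le ((le_abs_self _).trans (norm_fst_le j)) (norm_nonneg j)

theorem tame_shift_inv {ε : ℝ} (hε : 0 < ε) :
    Tame (fun (_ : SpaceTime n) (j : Jet n) => (j.shift ε)⁻¹) := by
  have h0 : ∀ s : ℝ, ε ≤ max s 0 + ε := fun s => by linarith [le_max_right s 0]
  refine tame_comp_of_bounded (h := fun s => (max s 0 + ε)⁻¹) (C := ε⁻¹) ?_ fun s => ?_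
  · exact Continuous.inv₀ (by fun_prop) fun s => (hε.trans_le (h0 s)).ne'
  · rw [abs_of_nonneg (inv_nonneg.2 (hε.le.trans (h0 s)))]
    exact inv_anti₀ hε (h0 s)

theorem continuous_jetOf {v : SpaceTime n → ℝ} (hv : ContDiff ℝ ∞ v) : Continuous (jetOf v) := by
  refine hv.continuous.prodMk ((contDiff_dirDeriv hv _).continuous.prodMk (Continuous.prodMk ?_ ?_))
  · exact continuous_pi fun i => (contDiff_dirDeriv hv _).continuous
  · exact continuous_finsetSum _ fun i _ =>
      (contDiff_dirDeriv (contDiff_dirDeriv hv _) _).continuous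

theorem Tame.integrable_jetOf {Φ : SpaceTime n → Jet n → ℝ} (hΦ : Tame Φ) {K : Set (SpaceTime n)}
    (hK : IsCompact K) (hΦK : ∀ z ∉ K, ∀ j, Φ z j = 0) {v : SpaceTime n → ℝ}
    (hv : ContDiff ℝ ∞ v) : Integrable (fun z => Φ z (jetOf v z)) :=
  (hΦ.1.comp (continuous_id.prodMk (continuous_jetOf hv))).integrable_of_hasCompactSupport
    (HasCompactSupport.intro hK fun z hz => hΦK z hz _)

/-- The integrand of the Bochner-type inequality, with parameter `κ` and weight `1 / (u + ε)`. -/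
noncomputable def bochnerIntegrand (κ ε : ℝ) (φ : SpaceTime n → ℝ) (z : SpaceTime n) (j : Jet n) :
    ℝ :=
  φ z * ((κ - κ ^ 2 * ((n - 1) / n)) * (j.gradSq * (j.shift ε)⁻¹) ^ 2
      - κ * ((n + 2) / n) * (j.gradSq * (j.shift ε)⁻¹) * j.2.2.2 - (n - 1) / n * j.2.2.2 ^ 2)
    - spaceLaplacian φ z * j.gradSq / 2 - j.2.2.2 * j.gradInner φ z
    - κ * (j.gradSq * (j.shift ε)⁻¹) * j.gradInner φ z

/-- The one-dimensional counterpart of `bochnerIntegrand`. The Bochner formula is void there, which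
leaves the divergence of `φ |∇v|² ∇v / (v + ε)` alone; its integral vanishes. -/
noncomputable def bochnerIntegrandOne (ε : ℝ) (φ : SpaceTime n → ℝ) (z : SpaceTime n) (j : Jet n) :
    ℝ :=
  φ z * ((j.gradSq * (j.shift ε)⁻¹) ^ 2 - 3 * (j.gradSq * (j.shift ε)⁻¹) * j.2.2.2)
    - (j.gradSq * (j.shift ε)⁻¹) * j.gradInner φ z

theorem tame_bochnerIntegrand (κ : ℝ) {ε : ℝ} (hε : 0 < ε) {φ : SpaceTime n → ℝ}
    (hφ : ContDiff ℝ ∞ φ) (hc : HasCompactSupport φ) : Tame (bochnerIntegrand κ ε φ) := by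
  have hq : Tame (fun (_ : SpaceTime n) (j : Jet n) => j.gradSq * (j.shift ε)⁻¹) :=
    tame_gradSq.mul (tame_shift_inv hε)
  refine Tame.sub (Tame.sub (Tame.sub (Tame.mul (tame_coeff hφ.continuous hc) (Tame.sub (Tame.sub
    (Tame.mul (tame_const _) (hq.pow 2)) (Tame.mul (Tame.mul (tame_const _) hq) tame_laplacian))
    (Tame.mul (tame_const _) (tame_laplacian.pow 2)))) ?_) (tame_laplacian.mul
    (tame_gradInner hφ hc))) (Tame.mul (Tame.mul (tame_const _) hq) (tame_gradInner hφ hc))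
  simp only [div_eq_mul_inv]
  exact ((tame_spaceLaplacian hφ hc).mul tame_gradSq).mul (tame_const _)

theorem tame_bochnerIntegrandOne {ε : ℝ} (hε : 0 < ε) {φ : SpaceTime n → ℝ}
    (hφ : ContDiff ℝ ∞ φ) (hc : HasCompactSupport φ) : Tame (bochnerIntegrandOne ε φ) := by
  have hq : Tame (fun (_ : SpaceTime n) (j : Jet n) => j.gradSq * (j.shift ε)⁻¹) :=
    tame_gradSq.mul (tame_shift_inv hε)
  exact Tame.sub (Tame.mul (tame_coeff hφ.continuous hc) (Tame.sub (hq.pow 2)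
    (Tame.mul (Tame.mul (tame_const _) hq) tame_laplacian))) (hq.mul (tame_gradInner hφ hc))

/-- The trace inequality `(tr A)² ≤ n |A|²` for `A = D²v - κ ∇v ⊗ ∇v / V`, expanded. -/
theorem trace_sq_le (hn : 0 < n) (T : Fin n → Fin n → ℝ) (g : Fin n → ℝ) (κ w : ℝ) :
    (∑ i, T i i - κ * w * ∑ i, g i ^ 2) ^ 2 / n ≤
      ∑ j, ∑ i, T i j ^ 2 - 2 * κ * w * ∑ j, (∑ i, g i * T i j) * g j
        + κ ^ 2 * w ^ 2 * (∑ i, g i ^ 2) ^ 2 := by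
  have hn' : (0 : ℝ) < n := by exact_mod_cast hn
  have h1 : (∑ i, (T i i - κ * w * (g i * g i))) ^ 2 ≤
      n * ∑ i, (T i i - κ * w * (g i * g i)) ^ 2 := by
    simpa using sq_sum_le_card_mul_sum_sq (s := Finset.univ)
      (f := fun i => T i i - κ * w * (g i * g i))
  have h2 : ∑ i, (T i i - κ * w * (g i * g i)) ^ 2 ≤
      ∑ j, ∑ i, (T i j - κ * w * (g i * g j)) ^ 2 := by
    refine Finset.sum_le_sum fun j _ => ?_
    exact Finset.single_le_sum (f := fun i => (T i j - κ * w * (g i * g j)) ^ 2)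
      (fun i _ => sq_nonneg _) (Finset.mem_univ j)
  have h3 : ∑ j, ∑ i, (T i j - κ * w * (g i * g j)) ^ 2 =
      ∑ j, ∑ i, T i j ^ 2 - 2 * κ * w * ∑ j, (∑ i, g i * T i j) * g j
        + κ ^ 2 * w ^ 2 * (∑ i, g i ^ 2) ^ 2 := by
    have e : (∑ i, g i ^ 2) ^ 2 = ∑ j, ∑ i, g i ^ 2 * g j ^ 2 := by
      rw [pow_two, Finset.sum_mul_sum, Finset.sum_comm]
    rw [e]
    simp only [Finset.mul_sum, Finset.sum_mul, ← Finset.sum_sub_distrib, ← Finset.sum_add_distrib]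
    exact Finset.sum_congr rfl fun j _ => Finset.sum_congr rfl fun i _ => by ring
  rw [div_le_iff₀ hn', ← h3, mul_comm _ (n : ℝ)]
  have h4 : ∑ i, T i i - κ * w * ∑ i, g i ^ 2 = ∑ i, (T i i - κ * w * (g i * g i)) := by
    rw [Finset.sum_sub_distrib, Finset.mul_sum]
    simp only [pow_two]
  rw [h4]
  exact h1.trans (mul_le_mul_of_nonneg_left h2 hn'.le)

/-- The divergence of `φ ∇(|∇v|²) / 2 - φ Δv ∇v - |∇v|² ∇φ / 2`, in which the third derivatives
of `v` cancel. -/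
theorem divergence_bochner {φ v : SpaceTime n → ℝ} (hφ : ContDiff ℝ ∞ φ) (hv : ContDiff ℝ ∞ v)
    (z : SpaceTime n) :
    ∑ j, dirDeriv (spaceDir j) (fun z =>
        φ z * ∑ i, dirDeriv (spaceDir i) v z * dirDeriv (spaceDir j) (dirDeriv (spaceDir i) v) z
        - φ z * (dirDeriv (spaceDir j) v z * spaceLaplacian v z)
        - 1 / 2 * (dirDeriv (spaceDir j) φ z * (jetOf v z).gradSq)) z =
      φ z * (∑ j, ∑ i, dirDeriv (spaceDir j) (dirDeriv (spaceDir i) v) z ^ 2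
        - spaceLaplacian v z ^ 2)
      - spaceLaplacian φ z * (jetOf v z).gradSq / 2
      - spaceLaplacian v z * (jetOf v z).gradInner φ z := by
  have hvi := fun i => contDiff_dirDeriv hv (spaceDir i)
  have hvij := fun i j => contDiff_dirDeriv (hvi i) (spaceDir j)
  have hg := contDiff_gradSq hv
  have dφ : DifferentiableAt ℝ φ z := hφ.differentiable (by simp) z
  have dφi := fun i => (contDiff_dirDeriv hφ (spaceDir i)).differentiable (by simp) z
  have di := fun i => (hvi i).differentiable (by simp) z
  have dij := fun i j => (hvij i j).differentiable (by simp) z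
  have dg : DifferentiableAt ℝ (fun z => (jetOf v z).gradSq) z := hg.differentiable (by simp) z
  have dL : DifferentiableAt ℝ (spaceLaplacian v) z :=
    DifferentiableAt.fun_sum fun i _ => dij i i
  have dS : ∀ j, DifferentiableAt ℝ (fun z => ∑ i, dirDeriv (spaceDir i) v z *
      dirDeriv (spaceDir j) (dirDeriv (spaceDir i) v) z) z := fun j =>
    DifferentiableAt.fun_sum fun i _ => (di i).fun_mul (dij i j)
  have eL : ∀ j, dirDeriv (spaceDir j) (spaceLaplacian v) z =
      ∑ i, dirDeriv (spaceDir i) (dirDeriv (spaceDir i) (dirDeriv (spaceDir j) v)) z := by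
    intro j
    have : spaceLaplacian v = fun z => ∑ i, dirDeriv (spaceDir i) (dirDeriv (spaceDir i) v) z := rfl
    rw [this, dirDeriv_sum fun i _ => dij i i]
    refine Finset.sum_congr rfl fun i _ => ?_
    rw [dirDeriv_comm (hvi i), show dirDeriv (spaceDir j) (dirDeriv (spaceDir i) v) =
      dirDeriv (spaceDir i) (dirDeriv (spaceDir j) v) from funext fun z => dirDeriv_comm hv _ _ _]
  have eS : ∀ j, dirDeriv (spaceDir j) (fun z => ∑ i, dirDeriv (spaceDir i) v z *
      dirDeriv (spaceDir j) (dirDeriv (spaceDir i) v) z) z =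
      ∑ i, dirDeriv (spaceDir j) (dirDeriv (spaceDir i) v) z ^ 2 + ∑ i, dirDeriv (spaceDir i) v z *
        dirDeriv (spaceDir j) (dirDeriv (spaceDir j) (dirDeriv (spaceDir i) v)) z := by
    intro j
    rw [dirDeriv_sum fun i _ => (di i).fun_mul (dij i j), ← Finset.sum_add_distrib]
    refine Finset.sum_congr rfl fun i _ => ?_
    rw [dirDeriv_mul (di i) (dij i j)]; ring
  have e1 : ∀ j, dirDeriv (spaceDir j) (fun z =>
        φ z * ∑ i, dirDeriv (spaceDir i) v z * dirDeriv (spaceDir j) (dirDeriv (spaceDir i) v) z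
        - φ z * (dirDeriv (spaceDir j) v z * spaceLaplacian v z)
        - 1 / 2 * (dirDeriv (spaceDir j) φ z * (jetOf v z).gradSq)) z =
      φ z * (∑ i, dirDeriv (spaceDir j) (dirDeriv (spaceDir i) v) z ^ 2)
      - φ z * spaceLaplacian v z * dirDeriv (spaceDir j) (dirDeriv (spaceDir j) v) z
      - (jetOf v z).gradSq / 2 * dirDeriv (spaceDir j) (dirDeriv (spaceDir j) φ) z
      - spaceLaplacian v z * (dirDeriv (spaceDir j) v z * dirDeriv (spaceDir j) φ z)
      + φ z * (∑ i, dirDeriv (spaceDir i) v z *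
          dirDeriv (spaceDir j) (dirDeriv (spaceDir j) (dirDeriv (spaceDir i) v)) z)
      - φ z * ∑ i, dirDeriv (spaceDir j) v z *
          dirDeriv (spaceDir i) (dirDeriv (spaceDir i) (dirDeriv (spaceDir j) v)) z := by
    intro j
    rw [dirDeriv_sub ((dφ.fun_mul (dS j)).fun_sub (dφ.fun_mul ((di j).fun_mul dL)))
        (((dφi j).fun_mul dg).const_mul _),
      dirDeriv_sub (dφ.fun_mul (dS j)) (dφ.fun_mul ((di j).fun_mul dL)),
      dirDeriv_mul dφ (dS j), dirDeriv_mul dφ ((di j).fun_mul dL), dirDeriv_mul (di j) dL,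
      dirDeriv_mul (by fun_prop) ((dφi j).fun_mul dg), dirDeriv_mul (dφi j) dg, eL, eS,
      dirDeriv_gradSq hv]
    simp only [mul_assoc, ← Finset.mul_sum]
    simp [dirDeriv]
    ring
  simp only [e1, Finset.sum_add_distrib, Finset.sum_sub_distrib, ← Finset.mul_sum]
  rw [Finset.sum_comm (f := fun j i => dirDeriv (spaceDir i) v z *
    dirDeriv (spaceDir j) (dirDeriv (spaceDir j) (dirDeriv (spaceDir i) v)) z)]
  simp only [← Finset.mul_sum]
  simp only [Jet.gradInner, jetOf]
  simp only [spaceLaplacian]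
  ring

/-- The divergence of `φ |∇v|² ∇v / V`, for `V = v + ε`. -/
theorem divergence_gradSq_mul_grad {φ v : SpaceTime n → ℝ} (hφ : ContDiff ℝ ∞ φ)
    (hv : ContDiff ℝ ∞ v) {ε : ℝ} (z : SpaceTime n) (hz : 0 < v z + ε) :
    ∑ j, dirDeriv (spaceDir j) (fun z =>
        φ z * ((v z + ε)⁻¹ * ((jetOf v z).gradSq * dirDeriv (spaceDir j) v z))) z =
      φ z * (v z + ε)⁻¹ * (2 * (∑ j, (∑ i, dirDeriv (spaceDir i) v z *
          dirDeriv (spaceDir j) (dirDeriv (spaceDir i) v) z) * dirDeriv (spaceDir j) v z)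
        + (jetOf v z).gradSq * spaceLaplacian v z)
      - φ z * ((v z + ε)⁻¹ * (jetOf v z).gradSq) ^ 2
      + (v z + ε)⁻¹ * (jetOf v z).gradSq * (jetOf v z).gradInner φ z := by
  have hvi := fun i => contDiff_dirDeriv hv (spaceDir i)
  have hg := contDiff_gradSq hv
  have dφ : DifferentiableAt ℝ φ z := hφ.differentiable (by simp) z
  have dv : DifferentiableAt ℝ v z := hv.differentiable (by simp) z
  have di := fun i => (hvi i).differentiable (by simp) z
  have dg : DifferentiableAt ℝ (fun z => (jetOf v z).gradSq) z := hg.differentiable (by simp) z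
  have hinv : HasDerivAt (fun s : ℝ => (s + ε)⁻¹) (-(v z + ε)⁻¹ ^ 2) (v z) := by
    have := ((hasDerivAt_id (v z)).add_const ε).inv hz.ne'
    convert! this using 1
    simp [div_eq_mul_inv]
  have dw : DifferentiableAt ℝ (fun z => (v z + ε)⁻¹) z := (dv.add_const ε).inv hz.ne'
  have e1 : ∀ j, dirDeriv (spaceDir j) (fun z =>
        φ z * ((v z + ε)⁻¹ * ((jetOf v z).gradSq * dirDeriv (spaceDir j) v z))) z =
      (v z + ε)⁻¹ * (jetOf v z).gradSq * (dirDeriv (spaceDir j) v z * dirDeriv (spaceDir j) φ z)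
      - φ z * (v z + ε)⁻¹ ^ 2 * (jetOf v z).gradSq * dirDeriv (spaceDir j) v z ^ 2
      + φ z * (v z + ε)⁻¹ * 2 * ((∑ i, dirDeriv (spaceDir i) v z *
          dirDeriv (spaceDir j) (dirDeriv (spaceDir i) v) z) * dirDeriv (spaceDir j) v z)
      + φ z * (v z + ε)⁻¹ * (jetOf v z).gradSq *
          dirDeriv (spaceDir j) (dirDeriv (spaceDir j) v) z := by
    intro j
    rw [dirDeriv_mul dφ (dw.fun_mul (dg.fun_mul (di j))), dirDeriv_mul dw (dg.fun_mul (di j)),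
      dirDeriv_mul dg (di j), dirDeriv_comp (h := fun s => (s + ε)⁻¹) hinv dv, dirDeriv_gradSq hv]
    simp only [mul_assoc, ← Finset.mul_sum]
    ring
  simp only [e1, Finset.sum_add_distrib, Finset.sum_sub_distrib, ← Finset.mul_sum]
  simp only [Jet.gradInner, Jet.gradSq, jetOf, spaceLaplacian]
  ring

theorem Jet.shift_jetOf {v : SpaceTime n → ℝ} {z : SpaceTime n} (hz : 0 ≤ v z) (ε : ℝ) :
    (jetOf v z).shift ε = v z + ε := by
  simp [Jet.shift, jetOf, hz]

theorem integral_divergence_bochner {φ v : SpaceTime n → ℝ} (hφ : ContDiff ℝ ∞ φ)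
    (hφc : HasCompactSupport φ) (hv : ContDiff ℝ ∞ v) :
    Integrable (fun z => φ z * (∑ j, ∑ i, dirDeriv (spaceDir j) (dirDeriv (spaceDir i) v) z ^ 2
        - spaceLaplacian v z ^ 2) - spaceLaplacian φ z * (jetOf v z).gradSq / 2
      - spaceLaplacian v z * (jetOf v z).gradInner φ z) ∧
    ∫ z, (φ z * (∑ j, ∑ i, dirDeriv (spaceDir j) (dirDeriv (spaceDir i) v) z ^ 2
        - spaceLaplacian v z ^ 2) - spaceLaplacian φ z * (jetOf v z).gradSq / 2
      - spaceLaplacian v z * (jetOf v z).gradInner φ z) = 0 := by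
  have one_le : (1 : WithTop ℕ∞) ≤ (∞ : WithTop ℕ∞) := by exact_mod_cast le_top
  have hvi := fun i => contDiff_dirDeriv hv (spaceDir i)
  have hvij := fun i j => contDiff_dirDeriv (hvi i) (spaceDir j)
  have hL : ContDiff ℝ ∞ (spaceLaplacian v) := ContDiff.sum fun i _ => hvij i i
  have h := integral_divergence_eq_zero (W := fun j z =>
        φ z * ∑ i, dirDeriv (spaceDir i) v z * dirDeriv (spaceDir j) (dirDeriv (spaceDir i) v) z
        - φ z * (dirDeriv (spaceDir j) v z * spaceLaplacian v z)
        - 1 / 2 * (dirDeriv (spaceDir j) φ z * (jetOf v z).gradSq)) (W₀ := fun _ => 0)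
    (fun j => ((hφ.mul (ContDiff.sum fun i _ => (hvi i).mul (hvij i j))).sub
      (hφ.mul ((hvi j).mul hL)) |>.sub (contDiff_const.mul ((contDiff_dirDeriv hφ _).mul
        (contDiff_gradSq hv)))).of_le one_le)
    (fun j => by
      refine HasCompactSupport.sub (HasCompactSupport.sub hφc.mul_right hφc.mul_right) ?_
      exact HasCompactSupport.mul_left (HasCompactSupport.mul_right (hφc.fderiv_apply ℝ _)))
    contDiff_const .zero
  simp only [divergence_bochner hφ hv, show ∀ z, dirDeriv (timeDir n) (fun _ => (0 : ℝ)) z = 0 by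
    intro z; simp [dirDeriv], add_zero] at h
  exact h

theorem integral_divergence_gradSq_mul_grad {φ v : SpaceTime n → ℝ} (hφ : ContDiff ℝ ∞ φ)
    (hφc : HasCompactSupport φ) (hv : ContDiff ℝ ∞ v) (hv0 : ∀ z, 0 ≤ v z) {ε : ℝ} (hε : 0 < ε) :
    Integrable (fun z => φ z * (v z + ε)⁻¹ * (2 * (∑ j, (∑ i, dirDeriv (spaceDir i) v z *
          dirDeriv (spaceDir j) (dirDeriv (spaceDir i) v) z) * dirDeriv (spaceDir j) v z)
        + (jetOf v z).gradSq * spaceLaplacian v z)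
      - φ z * ((v z + ε)⁻¹ * (jetOf v z).gradSq) ^ 2
      + (v z + ε)⁻¹ * (jetOf v z).gradSq * (jetOf v z).gradInner φ z) ∧
    ∫ z, (φ z * (v z + ε)⁻¹ * (2 * (∑ j, (∑ i, dirDeriv (spaceDir i) v z *
          dirDeriv (spaceDir j) (dirDeriv (spaceDir i) v) z) * dirDeriv (spaceDir j) v z)
        + (jetOf v z).gradSq * spaceLaplacian v z)
      - φ z * ((v z + ε)⁻¹ * (jetOf v z).gradSq) ^ 2
      + (v z + ε)⁻¹ * (jetOf v z).gradSq * (jetOf v z).gradInner φ z) = 0 := by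
  have one_le : (1 : WithTop ℕ∞) ≤ (∞ : WithTop ℕ∞) := by exact_mod_cast le_top
  have hpos : ∀ z, 0 < v z + ε := fun z => add_pos_of_nonneg_of_pos (hv0 z) hε
  have hw : ContDiff ℝ ∞ (fun z => (v z + ε)⁻¹) :=
    (hv.add contDiff_const).inv fun z => (hpos z).ne'
  have h := integral_divergence_eq_zero (W := fun j z =>
        φ z * ((v z + ε)⁻¹ * ((jetOf v z).gradSq * dirDeriv (spaceDir j) v z)))
    (W₀ := fun _ => 0)
    (fun j => (hφ.mul (hw.mul ((contDiff_gradSq hv).mul (contDiff_dirDeriv hv _)))).of_le one_le)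
    (fun j => hφc.mul_right) contDiff_const .zero
  simp only [fun z => divergence_gradSq_mul_grad hφ hv z (hpos z),
    show ∀ z, dirDeriv (timeDir n) (fun _ => (0 : ℝ)) z = 0 by
    intro z; simp [dirDeriv], add_zero] at h
  exact h

/-- The Bochner-type inequality: the integrated Bochner formula minus `κ` times the integrated
divergence of `φ |∇v|² ∇v / (v + ε)`, with the Hessian eliminated by the trace inequality. -/
theorem integral_bochnerIntegrand_nonpos (hn : 0 < n) {κ : ℝ} {φ v : SpaceTime n → ℝ}
    (hφ : ContDiff ℝ ∞ φ) (hφc : HasCompactSupport φ) (hφ0 : ∀ z, 0 ≤ φ z) (hv : ContDiff ℝ ∞ v)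
    (hv0 : ∀ z, 0 ≤ v z) {ε : ℝ} (hε : 0 < ε)
    (hint : Integrable (fun z => bochnerIntegrand κ ε φ z (jetOf v z))) :
    ∫ z, bochnerIntegrand κ ε φ z (jetOf v z) ≤ 0 := by
  obtain ⟨iA, hA⟩ := integral_divergence_bochner hφ hφc hv
  obtain ⟨iB, hB⟩ := integral_divergence_gradSq_mul_grad hφ hφc hv hv0 hε
  have hn' : (n : ℝ) ≠ 0 := by exact_mod_cast hn.ne'
  have hle := integral_mono hint (iA.sub (iB.const_mul κ)) fun z => ?_
  · refine hle.trans_eq ?_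
    rw [integral_sub' iA (iB.const_mul κ), hA, integral_const_mul, hB]
    simp
  · have ht := trace_sq_le hn (fun i j => dirDeriv (spaceDir j) (dirDeriv (spaceDir i) v) z)
      (fun i => dirDeriv (spaceDir i) v z) κ (v z + ε)⁻¹
    have ht' := mul_le_mul_of_nonneg_left ht (hφ0 z)
    simp only [Pi.sub_apply, bochnerIntegrand, Jet.shift_jetOf (hv0 z)]
    have eL : (jetOf v z).2.2.2 = spaceLaplacian v z := rfl
    have eL' : ∑ i, dirDeriv (spaceDir i) (dirDeriv (spaceDir i) v) z = spaceLaplacian v z := rfl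
    have eG : ∑ i, dirDeriv (spaceDir i) v z ^ 2 = (jetOf v z).gradSq := rfl
    rw [eL', eG] at ht'
    rw [eL]
    set L := spaceLaplacian v z
    set G := (jetOf v z).gradSq
    set S := ∑ j, ∑ i, dirDeriv (spaceDir j) (dirDeriv (spaceDir i) v) z ^ 2
    set Q := ∑ j, (∑ i, dirDeriv (spaceDir i) v z *
      dirDeriv (spaceDir j) (dirDeriv (spaceDir i) v) z) * dirDeriv (spaceDir j) v z
    set w := (v z + ε)⁻¹
    have key : φ z * ((κ - κ ^ 2 * ((n - 1) / n)) * (G * w) ^ 2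
        - κ * ((n + 2) / n) * (G * w) * L - (n - 1) / n * L ^ 2) =
        φ z * (κ * (G * w) ^ 2 - κ ^ 2 * (G * w) ^ 2 - κ * (G * w) * L - L ^ 2)
        + φ z * ((L - κ * w * G) ^ 2 / n) := by
      field_simp
      ring
    rw [key]
    nlinarith [ht']

theorem integral_bochnerIntegrandOne_eq_zero {φ v : SpaceTime 1 → ℝ}
    (hφ : ContDiff ℝ ∞ φ) (hφc : HasCompactSupport φ) (hv : ContDiff ℝ ∞ v)
    (hv0 : ∀ z, 0 ≤ v z) {ε : ℝ} (hε : 0 < ε) :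
    ∫ z, bochnerIntegrandOne ε φ z (jetOf v z) = 0 := by
  obtain ⟨-, hB⟩ := integral_divergence_gradSq_mul_grad hφ hφc hv hv0 hε
  rw [← neg_eq_zero, ← integral_neg, ← hB]
  refine integral_congr_ae (Eventually.of_forall fun z => ?_)
  simp only [bochnerIntegrandOne, Jet.shift_jetOf (hv0 z)]
  simp only [Jet.gradSq, jetOf, spaceLaplacian, Finset.univ_unique, Finset.sum_singleton]
  ring

end

/-! ### The nonlinearity and its truncations -/

/-- The standing hypotheses on the nonlinearity. -/
structure IsNonlinearity (f : ℝ → ℝ) : Prop where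
  continuousOn : ContinuousOn f (Ici 0)
  pos : ∀ s : ℝ, 0 < s → 0 < f s
  integrableOn : IntegrableOn (fun z : ℝ => f z / z) (Ioc 0 1) volume

namespace IsNonlinearity

variable {f : ℝ → ℝ}

theorem nonneg (hf : IsNonlinearity f) {s : ℝ} (hs : 0 ≤ s) : 0 ≤ f s := by
  rcases hs.eq_or_lt with rfl | hs
  · have h : Tendsto f (𝓝[>] 0) (𝓝 (f 0)) :=
      (hf.continuousOn 0 self_mem_Ici).mono_left (nhdsWithin_mono 0 Ioi_subset_Ici_self)
    refine ge_of_tendsto h ?_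
    filter_upwards [self_mem_nhdsWithin] with s hs using (hf.pos s hs).le
  · exact (hf.pos s hs).le

/-- A positive value at `0` would make `f(z) / z` non-integrable. -/
theorem map_zero (hf : IsNonlinearity f) : f 0 = 0 := by
  by_contra h0
  have hpos : 0 < f 0 := lt_of_le_of_ne (hf.nonneg le_rfl) (Ne.symm h0)
  have h : Tendsto f (𝓝[≥] 0) (𝓝 (f 0)) := hf.continuousOn 0 self_mem_Ici
  have hev : ∀ᶠ s in 𝓝[≥] (0 : ℝ), f 0 / 2 < f s := h.eventually_const_lt (half_lt_self hpos)
  obtain ⟨r, hr, hr'⟩ := (mem_nhdsGE_iff_exists_Ico_subset.1 hev)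
  have hr0 : (0 : ℝ) < min (r / 2) 1 := lt_min (half_pos hr) one_pos
  have hsub : Ioc (0 : ℝ) (min (r / 2) 1) ⊆ Ioc 0 1 := Ioc_subset_Ioc_right (min_le_right _ _)
  have hint := hf.integrableOn.mono_set hsub
  have h2 : IntegrableOn (fun z : ℝ => z⁻¹) (Ioc 0 (min (r / 2) 1)) := by
    refine Integrable.mono' (hint.const_mul (2 / f 0)) (by fun_prop) ?_
    refine (ae_restrict_iff' measurableSet_Ioc).2 (Eventually.of_forall fun z hz => ?_)
    have hz1 : f 0 / 2 < f z := hr' ⟨hz.1.le, by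
      have := hz.2.trans (min_le_left _ _); change z < r; have : (0:ℝ) < r := hr; linarith⟩
    rw [Real.norm_of_nonneg (inv_nonneg.2 hz.1.le), div_mul_div_comm, inv_eq_one_div,
      div_le_div_iff₀ hz.1 (mul_pos hpos hz.1)]
    nlinarith [hz.1]
  have h3 : IntervalIntegrable (fun z : ℝ => z⁻¹) volume 0 (min (r / 2) 1) :=
    (intervalIntegrable_iff_integrableOn_Ioc_of_le hr0.le).2 h2
  rw [intervalIntegrable_inv_iff] at h3
  rcases h3 with h3 | h3
  · exact hr0.ne h3
  · exact h3 left_mem_uIcc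

theorem intervalIntegrable (hf : IsNonlinearity f) {s : ℝ} (hs : 0 ≤ s) :
    IntervalIntegrable (fun z => f z / z) volume 0 s := by
  have h1 : IntervalIntegrable (fun z => f z / z) volume 0 1 :=
    (intervalIntegrable_iff_integrableOn_Ioc_of_le zero_le_one).2 hf.integrableOn
  rcases le_total s 1 with h | h
  · exact h1.mono_set (by rw [uIcc_of_le hs, uIcc_of_le zero_le_one]; exact Icc_subset_Icc_right h)
  · refine h1.trans (ContinuousOn.intervalIntegrable ?_)
    rw [uIcc_of_le h]
    refine ContinuousOn.div (hf.continuousOn.mono fun z hz => ?_) continuousOn_id fun z hz => ?_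
    · exact zero_le_one.trans hz.1
    · exact (zero_lt_one.trans_le hz.1).ne'

theorem fTilde_pos (hf : IsNonlinearity f) {s : ℝ} (hs : 0 < s) : 0 < fTilde f s :=
  intervalIntegral.intervalIntegral_pos_of_pos_on (hf.intervalIntegrable hs.le)
    (fun z hz => div_pos (hf.pos z hz.1) hz.1) hs

theorem fTilde_zero (f : ℝ → ℝ) : fTilde f 0 = 0 := by simp [fTilde]

theorem fTilde_nonneg (hf : IsNonlinearity f) {s : ℝ} (hs : 0 ≤ s) : 0 ≤ fTilde f s := by
  rcases hs.eq_or_lt with rfl | hs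
  · rw [fTilde_zero]
  · exact (hf.fTilde_pos hs).le

theorem hasDerivAt_fTilde (hf : IsNonlinearity f) {s : ℝ} (hs : 0 < s) :
    HasDerivAt (fTilde f) (f s / s) s := by
  have hc : ContinuousOn (fun z => f z / z) (Ioi 0) :=
    ContinuousOn.div (hf.continuousOn.mono Ioi_subset_Ici_self) continuousOn_id fun z hz =>
      (ne_of_gt hz)
  refine intervalIntegral.integral_hasDerivAt_right (hf.intervalIntegrable hs.le) ?_
    (hc.continuousAt (Ioi_mem_nhds hs))
  exact hc.stronglyMeasurableAtFilter isOpen_Ioi s hs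

theorem continuousOn_fTilde (hf : IsNonlinearity f) : ContinuousOn (fTilde f) (Ici 0) := by
  intro s hs
  have h := intervalIntegral.continuousOn_primitive_interval' (a := (0 : ℝ)) (b₁ := 0) (b₂ := s + 1)
    (hf.intervalIntegrable (by have : (0 : ℝ) ≤ s := hs; linarith)) left_mem_uIcc
  have h0 : (0 : ℝ) ≤ s := hs
  rw [uIcc_of_le (by linarith)] at h
  refine (h s ⟨h0, by linarith⟩).mono_of_mem_nhdsWithin ?_
  have : Ici (0 : ℝ) ∩ Iio (s + 1) ∈ 𝓝[Ici 0] s :=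
    inter_mem_nhdsWithin _ (Iio_mem_nhds (by linarith))
  exact mem_of_superset this fun z hz => ⟨hz.1, le_of_lt hz.2⟩

theorem fTilde_mono (hf : IsNonlinearity f) {s t : ℝ} (hs : 0 ≤ s) (hst : s ≤ t) :
    fTilde f s ≤ fTilde f t := by
  have h : IntervalIntegrable (fun z => f z / z) volume s t :=
    (hf.intervalIntegrable (hs.trans hst)).mono_set (by
      rw [uIcc_of_le hst, uIcc_of_le (hs.trans hst)]; exact Icc_subset_Icc_left hs)
  have h2 := intervalIntegral.integral_add_adjacent_intervals (hf.intervalIntegrable hs) h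
  have h3 : 0 ≤ ∫ z in s..t, f z / z := intervalIntegral.integral_nonneg hst fun z hz =>
    div_nonneg (hf.nonneg (hs.trans hz.1)) (hs.trans hz.1)
  simp only [fTilde]
  linarith

/-- The bound `f ≤ p f̃` forces polynomial growth, since `f̃(s) s^(-p)` is nonincreasing. -/
theorem exists_fTilde_le (hf : IsNonlinearity f) {p : ℝ}
    (h : ∀ s, 0 < s → f s ≤ p * fTilde f s) :
    ∃ (C : ℝ) (N : ℕ), 0 ≤ C ∧ ∀ s, 0 ≤ s → fTilde f s ≤ C * (1 + s) ^ N := by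
  obtain ⟨N, hN⟩ := exists_nat_ge p
  have hanti : AntitoneOn (fun s => fTilde f s * s ^ (-p)) (Ici 1) := by
    have hd : ∀ s : ℝ, 1 ≤ s → HasDerivAt (fun s => fTilde f s * s ^ (-p))
        (f s / s * s ^ (-p) + fTilde f s * (-p * s ^ (-p - 1))) s := fun s hs =>
      (hf.hasDerivAt_fTilde (by linarith)).mul
        (Real.hasDerivAt_rpow_const (Or.inl (by linarith)))
    refine antitoneOn_of_deriv_nonpos (convex_Ici 1)
      (fun s hs => (hd s hs).continuousAt.continuousWithinAt)
      (fun s hs => ?_) (fun s hs => ?_)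
    · rw [interior_Ici] at hs
      exact (hd s (le_of_lt hs)).differentiableAt.differentiableWithinAt
    · rw [interior_Ici] at hs
      have hs1 : (1 : ℝ) < s := hs
      have hs0 : (0 : ℝ) < s := by linarith
      rw [(hd s hs1.le).deriv, Real.rpow_sub_one hs0.ne']
      have e : f s / s * s ^ (-p) + fTilde f s * (-p * (s ^ (-p) / s)) =
          (f s - p * fTilde f s) * (s ^ (-p) / s) := by ring
      rw [e]
      exact mul_nonpos_of_nonpos_of_nonneg (by linarith [h s hs0])
        (div_nonneg (Real.rpow_nonneg hs0.le _) hs0.le)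
  refine ⟨fTilde f 1, N, hf.fTilde_nonneg zero_le_one, fun s hs => ?_⟩
  rcases le_total s 1 with h1 | h1
  · refine (hf.fTilde_mono hs h1).trans (le_mul_of_one_le_right (hf.fTilde_nonneg zero_le_one) ?_)
    exact one_le_pow₀ (by linarith)
  · have h2 := hanti self_mem_Ici (mem_Ici.2 h1) h1
    simp only [Real.one_rpow, mul_one] at h2
    have hs0 : (0 : ℝ) < s := by linarith
    rw [Real.rpow_neg hs0.le, ← div_eq_mul_inv, div_le_iff₀ (Real.rpow_pos_of_pos hs0 _)] at h2
    refine h2.trans (mul_le_mul_of_nonneg_left ?_ (hf.fTilde_nonneg zero_le_one))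
    calc s ^ p ≤ s ^ (N : ℝ) := Real.rpow_le_rpow_of_exponent_le h1 hN
      _ = s ^ N := Real.rpow_natCast _ _
      _ ≤ (1 + s) ^ N := pow_le_pow_left₀ hs0.le (by linarith) _

end IsNonlinearity

/-- A continuous cutoff with values in `[0, 1]` and support in `[1 / (k + 1), k + 2]`, which tends
to `1` on `(0, ∞)` as `k → ∞`. -/
noncomputable def cutoff (k : ℕ) (s : ℝ) : ℝ :=
  min 1 (max 0 ((k + 1) * s - 1)) * min 1 (max 0 (k + 2 - s))

theorem continuous_cutoff (k : ℕ) : Continuous (cutoff k) := by unfold cutoff; fun_prop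

theorem cutoff_nonneg (k : ℕ) (s : ℝ) : 0 ≤ cutoff k s :=
  mul_nonneg (le_min zero_le_one (le_max_left _ _)) (le_min zero_le_one (le_max_left _ _))

theorem cutoff_le_one (k : ℕ) (s : ℝ) : cutoff k s ≤ 1 :=
  mul_le_one₀ (min_le_left _ _) (le_min zero_le_one (le_max_left _ _)) (min_le_left _ _)

theorem cutoff_eq_zero {k : ℕ} {s : ℝ} (hs : (k + 1) * s ≤ 1) : cutoff k s = 0 := by
  rw [cutoff, max_eq_left (by linarith : (k + 1) * s - 1 ≤ 0), min_eq_right zero_le_one, zero_mul]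

theorem cutoff_eq_zero' {k : ℕ} {s : ℝ} (hs : k + 2 ≤ s) : cutoff k s = 0 := by
  rw [cutoff, max_eq_left (by linarith : (k : ℝ) + 2 - s ≤ 0), min_eq_right zero_le_one, mul_zero]

theorem eventually_cutoff_eq_one {s : ℝ} (hs : 0 < s) : ∀ᶠ k : ℕ in atTop, cutoff k s = 1 := by
  obtain ⟨N, hN⟩ := exists_nat_ge (max (2 / s) s)
  filter_upwards [eventually_ge_atTop N] with k hk
  have hkN : (N : ℝ) ≤ k := by exact_mod_cast hk
  have h1 : 2 / s ≤ k := (le_max_left _ _).trans (hN.trans hkN)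
  have h2 : s ≤ k := (le_max_right _ _).trans (hN.trans hkN)
  rw [div_le_iff₀ hs] at h1
  rw [cutoff, min_eq_left, min_eq_left, one_mul]
  · exact le_max_of_le_right (by linarith)
  · exact le_max_of_le_right (by nlinarith)

theorem hasCompactSupport_cutoff (k : ℕ) : HasCompactSupport (cutoff k) := by
  refine HasCompactSupport.intro (isCompact_Icc (a := (0 : ℝ)) (b := k + 2)) fun s hs => ?_
  by_contra h
  apply hs
  constructor
  · by_contra h'
    exact h (cutoff_eq_zero (by nlinarith [(Nat.cast_nonneg k : (0 : ℝ) ≤ k), not_le.1 h']))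
  · by_contra h'
    exact h (cutoff_eq_zero' (not_le.1 h').le)

/-- The truncation `χ_k f` of `f`, where `χ_k` is `cutoff k`; the absolute value makes it
continuous on the whole line. -/
noncomputable def truncF (f : ℝ → ℝ) (k : ℕ) (s : ℝ) : ℝ := cutoff k s * f |s|

/-- The truncation `χ_k(s) f(s) / s` of the derivative of `f̃`. On the support of the cutoff the
maximum is `s`; it removes the singularity elsewhere. -/
noncomputable def truncDeriv (f : ℝ → ℝ) (k : ℕ) (s : ℝ) : ℝ :=
  cutoff k s * f |s| * (max s (1 / (k + 1)))⁻¹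

/-- The truncation of `f̃`: the primitive of `χ_k(s) f(s) / s`. -/
noncomputable def truncTilde (f : ℝ → ℝ) (k : ℕ) (s : ℝ) : ℝ := ∫ z in (0 : ℝ)..s, truncDeriv f k z

namespace IsNonlinearity

variable {f : ℝ → ℝ}

theorem continuous_comp_abs (hf : IsNonlinearity f) : Continuous (fun s => f |s|) :=
  hf.continuousOn.comp_continuous continuous_abs fun s => abs_nonneg s

theorem continuous_truncF (hf : IsNonlinearity f) (k : ℕ) : Continuous (truncF f k) :=
  (continuous_cutoff k).mul hf.continuous_comp_abs

theorem continuous_truncDeriv (hf : IsNonlinearity f) (k : ℕ) : Continuous (truncDeriv f k) := by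
  refine ((continuous_cutoff k).mul hf.continuous_comp_abs).mul (Continuous.inv₀ (by fun_prop) ?_)
  intro s
  have : (0 : ℝ) < 1 / (k + 1) := by positivity
  exact (this.trans_le (le_max_right _ _)).ne'

theorem exists_abs_truncF_le (hf : IsNonlinearity f) (k : ℕ) : ∃ C, ∀ s, |truncF f k s| ≤ C :=
  ((hasCompactSupport_cutoff k).mul_right).exists_bound_of_continuous (hf.continuous_truncF k)

theorem exists_abs_truncDeriv_le (hf : IsNonlinearity f) (k : ℕ) :
    ∃ C, ∀ s, |truncDeriv f k s| ≤ C :=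
  ((hasCompactSupport_cutoff k).mul_right.mul_right).exists_bound_of_continuous
    (hf.continuous_truncDeriv k)

theorem truncDeriv_nonneg (hf : IsNonlinearity f) (k : ℕ) (s : ℝ) : 0 ≤ truncDeriv f k s := by
  have : (0 : ℝ) < 1 / (k + 1) := by positivity
  exact mul_nonneg (mul_nonneg (cutoff_nonneg k s) (hf.nonneg (abs_nonneg s)))
    (inv_nonneg.2 (this.le.trans (le_max_right _ _)))

theorem truncF_nonneg (hf : IsNonlinearity f) (k : ℕ) (s : ℝ) : 0 ≤ truncF f k s :=
  mul_nonneg (cutoff_nonneg k s) (hf.nonneg (abs_nonneg s))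

theorem truncF_le (hf : IsNonlinearity f) (k : ℕ) {s : ℝ} (hs : 0 ≤ s) : truncF f k s ≤ f s := by
  rw [truncF, abs_of_nonneg hs]
  exact mul_le_of_le_one_left (hf.nonneg hs) (cutoff_le_one k s)

theorem truncDeriv_mul (f : ℝ → ℝ) (k : ℕ) (s : ℝ) :
    truncDeriv f k s * s = truncF f k s := by
  rcases le_total ((k + 1) * s) 1 with h | h
  · simp [truncDeriv, truncF, cutoff_eq_zero h]
  · have hk : (0 : ℝ) < k + 1 := by positivity
    have h1 : 1 / (k + 1 : ℝ) ≤ s := by rw [div_le_iff₀ hk]; linarith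
    have h2 : 0 < s := by
      have : (0 : ℝ) < 1 / (k + 1) := by positivity
      linarith
    rw [truncDeriv, truncF, max_eq_left h1, mul_assoc, inv_mul_cancel₀ h2.ne', mul_one]

theorem truncDeriv_le_div (hf : IsNonlinearity f) (k : ℕ) {s : ℝ} (hs : 0 < s) :
    truncDeriv f k s ≤ f s / s := by
  rw [le_div_iff₀ hs, truncDeriv_mul f k s]
  exact hf.truncF_le k hs.le

/-- Replacing `1 / s` by `1 / (s + ε)` costs a factor close to `1` on the support of the cutoff. -/
theorem truncDeriv_mul_le (hf : IsNonlinearity f) {k : ℕ} {δ ε s : ℝ} (hε : 0 ≤ ε)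
    (hδ : (k + 1) * ε ≤ δ) (hs : 0 ≤ s) : truncDeriv f k s * (s + ε) ≤ (1 + δ) * f s := by
  have h1 := truncDeriv_mul f k s
  have h0 := hf.truncF_le k hs
  have h2 : truncDeriv f k s * ε ≤ δ * truncF f k s := by
    rcases le_total ((k + 1) * s) 1 with h | h
    · simp [truncDeriv, truncF, cutoff_eq_zero h]
    · rw [← h1]
      have : ε ≤ δ * s := by nlinarith
      nlinarith [hf.truncDeriv_nonneg k s]
  have hδ0 : 0 ≤ δ := le_trans (by positivity) hδ
  nlinarith [hf.truncF_nonneg k s]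

theorem hasDerivAt_truncTilde (hf : IsNonlinearity f) (k : ℕ) (s : ℝ) :
    HasDerivAt (truncTilde f k) (truncDeriv f k s) s :=
  intervalIntegral.integral_hasDerivAt_right
    ((hf.continuous_truncDeriv k).intervalIntegrable _ _)
    ((hf.continuous_truncDeriv k).stronglyMeasurableAtFilter _ _)
    (hf.continuous_truncDeriv k).continuousAt

theorem continuous_truncTilde (hf : IsNonlinearity f) (k : ℕ) : Continuous (truncTilde f k) :=
  continuous_iff_continuousAt.2 fun s => (hf.hasDerivAt_truncTilde k s).continuousAt

theorem truncTilde_mono (hf : IsNonlinearity f) (k : ℕ) : Monotone (truncTilde f k) :=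
  monotone_of_hasDerivAt_nonneg (hf.hasDerivAt_truncTilde k) (hf.truncDeriv_nonneg k)

theorem truncTilde_nonneg (hf : IsNonlinearity f) (k : ℕ) {s : ℝ} (hs : 0 ≤ s) :
    0 ≤ truncTilde f k s :=
  intervalIntegral.integral_nonneg hs fun z _ => hf.truncDeriv_nonneg k z

theorem truncTilde_le (hf : IsNonlinearity f) (k : ℕ) {s : ℝ} (hs : 0 ≤ s) :
    truncTilde f k s ≤ fTilde f s :=
  intervalIntegral.integral_mono_on_of_le_Ioo hs
    ((hf.continuous_truncDeriv k).intervalIntegrable _ _) (hf.intervalIntegrable hs)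
    fun _ hz => hf.truncDeriv_le_div k hz.1

theorem tendsto_truncTilde (hf : IsNonlinearity f) {s : ℝ} (hs : 0 ≤ s) :
    Tendsto (fun k => truncTilde f k s) atTop (𝓝 (fTilde f s)) := by
  refine intervalIntegral.tendsto_integral_filter_of_dominated_convergence (fun z => f z / z)
    (Eventually.of_forall fun k => (hf.continuous_truncDeriv k).aestronglyMeasurable)
    (Eventually.of_forall fun k => Eventually.of_forall fun z hz => ?_)
    (hf.intervalIntegrable hs) (Eventually.of_forall fun z hz => ?_)
  · rw [uIoc_of_le hs] at hz
    rw [Real.norm_of_nonneg (hf.truncDeriv_nonneg k z)]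
    exact hf.truncDeriv_le_div k hz.1
  · rw [uIoc_of_le hs] at hz
    refine tendsto_const_nhds.congr' ?_
    filter_upwards [eventually_cutoff_eq_one hz.1] with k hk
    have h := truncDeriv_mul f k z
    rw [truncF, hk, one_mul, abs_of_pos hz.1] at h
    rw [← h, mul_div_cancel_right₀ _ hz.1.ne']

theorem tendsto_truncF (hf : IsNonlinearity f) {s : ℝ} (hs : 0 ≤ s) :
    Tendsto (fun k => truncF f k s) atTop (𝓝 (f s)) := by
  rcases hs.eq_or_lt with rfl | hs
  · simp [truncF, hf.map_zero]
  · refine tendsto_const_nhds.congr' ?_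
    filter_upwards [eventually_cutoff_eq_one hs] with k hk
    rw [truncF, hk, one_mul, abs_of_pos hs]

theorem integral_truncTilde_le (hf : IsNonlinearity f) (k : ℕ) {s : ℝ} (hs : 0 ≤ s) :
    ∫ z in (0 : ℝ)..s, truncTilde f k z ≤ s * truncTilde f k s := by
  have := intervalIntegral.integral_mono_on (μ := volume) hs
    ((hf.continuous_truncTilde k).intervalIntegrable 0 s)
    (by simp : IntervalIntegrable (fun _ => truncTilde f k s) volume 0 s) fun z hz =>
      hf.truncTilde_mono k hz.2
  simpa using this

theorem integral_truncF_le (hf : IsNonlinearity f) (k : ℕ) {s : ℝ} (hs : 0 ≤ s) :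
    ∫ z in (0 : ℝ)..s, truncF f k z ≤ s * truncTilde f k s := by
  rw [truncTilde, ← intervalIntegral.integral_const_mul]
  have hc : Continuous fun z => s * truncDeriv f k z := (hf.continuous_truncDeriv k).const_mul s
  refine intervalIntegral.integral_mono_on hs ((hf.continuous_truncF k).intervalIntegrable _ _)
    (hc.intervalIntegrable _ _) fun z hz => ?_
  rw [← truncDeriv_mul f k z, mul_comm]
  exact mul_le_mul_of_nonneg_right hz.2 (hf.truncDeriv_nonneg k z)

end IsNonlinearity

/-! ### Young inequalities and absorption -/

theorem mul_le_mul_sq_add {δ : ℝ} (hδ : 0 < δ) (x y : ℝ) : x * y ≤ δ * x ^ 2 + y ^ 2 / (4 * δ) := by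
  have h : δ * x ^ 2 + y ^ 2 / (4 * δ) - x * y = (2 * δ * x - y) ^ 2 / (4 * δ) := by
    field_simp; ring
  have : 0 ≤ (2 * δ * x - y) ^ 2 / (4 * δ) := by positivity
  linarith

/-- Young's inequality with a small parameter. -/
theorem exists_rpow_mul_le {θ : ℝ} (h0 : 0 ≤ θ) (h1 : θ < 1) {C δ : ℝ} (hC : 0 ≤ C) (hδ : 0 < δ) :
    ∃ C', 0 ≤ C' ∧ ∀ X b : ℝ, 0 ≤ X → 0 ≤ b →
      C * (X ^ θ * b) ≤ δ * X + C' * b ^ (1 / (1 - θ)) := by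
  have h1' : 0 < 1 - θ := by linarith
  refine ⟨(1 - θ) * (C * δ ^ (-θ)) ^ (1 / (1 - θ)), by positivity, fun X b hX hb => ?_⟩
  have h := Real.geom_mean_le_arith_mean2_weighted h0 h1'.le
    (p₁ := δ * X) (p₂ := (C * δ ^ (-θ) * b) ^ (1 / (1 - θ))) (by positivity) (by positivity)
    (by ring)
  rw [← Real.rpow_mul (by positivity), one_div_mul_cancel h1'.ne', Real.rpow_one,
    Real.mul_rpow hδ.le hX] at h
  have e : δ ^ θ * X ^ θ * (C * δ ^ (-θ) * b) = C * (X ^ θ * b) := by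
    have : δ ^ θ * δ ^ (-θ) = 1 := by rw [← Real.rpow_add hδ]; simp
    linear_combination (C * X ^ θ * b) * this
  rw [e, Real.mul_rpow (by positivity) hb] at h
  have h2 : θ * (δ * X) ≤ δ * X := mul_le_of_le_one_left (by positivity) h1.le
  linarith

theorem exists_mul_le_pow_four {δ : ℝ} (hδ : 0 < δ) :
    ∃ C, 0 ≤ C ∧ ∀ x y : ℝ, 0 ≤ x → 0 ≤ y → x * y ≤ δ * x ^ 4 + C * y ^ (4 / 3 : ℝ) := by
  obtain ⟨C, hC, h⟩ := exists_rpow_mul_le (θ := 1 / 4) (by norm_num) (by norm_num) zero_le_one hδ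
  refine ⟨C, hC, fun x y hx hy => ?_⟩
  have := h (x ^ 4) y (by positivity) hy
  rw [one_mul, ← Real.rpow_natCast x 4, ← Real.rpow_mul hx] at this
  norm_num at this
  convert! this using 3

/-- Absorption of the error terms of the weighted Bochner inequality. The letters stand for the
terms of the energy estimate at a point, divided by suitable powers of the cutoff. -/
theorem exists_bochner_young {c₁ c₂ γ κ δ : ℝ} (hc₁ : 0 < c₁) (hγ : 0 ≤ γ) (hδ : 0 < δ) :
    ∃ C, 0 ≤ C ∧ ∀ A B e r s Φ : ℝ, 0 ≤ r → 0 ≤ e → e ^ 2 = A * B →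
      c₁ * A ^ 2 + c₂ * (r * A) ≤
          Φ + c₂ * (A * |s|) + γ * (s - r) ^ 2 + e ^ 2 / 2 + |s - r| * e + κ * (A * e) →
      c₁ / 2 * A ^ 2 + c₂ * (r * A) ≤ Φ + (γ * (1 + δ) + δ) * r ^ 2 + C * (s ^ 2 + B ^ 2) := by
  have young : ∀ δ : ℝ, 0 < δ → ∀ c : ℝ, ∃ C, 0 ≤ C ∧ ∀ x y : ℝ,
      x * (c * y) ≤ δ * x ^ 2 + C * y ^ 2 := by
    intro δ hδ c
    refine ⟨c ^ 2 / (4 * δ), by positivity, fun x y => ?_⟩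
    refine (mul_le_mul_sq_add hδ x (c * y)).trans_eq ?_
    ring
  obtain ⟨C₁, hC₁, y1⟩ := young (c₁ / 8) (by positivity) c₂
  obtain ⟨C₂, hC₂, y2⟩ := young δ hδ 1
  obtain ⟨C₃, hC₃, y3⟩ := young (c₁ / 8) (by positivity) (1 / 2)
  obtain ⟨C₄, hC₄, y4⟩ := young 1 one_pos 1
  obtain ⟨C₆, hC₆, y6⟩ := young (c₁ / 8) (by positivity) (C₄ + C₂)
  obtain ⟨C₇, hC₇, y7⟩ := young (c₁ / 16) (by positivity) κ
  obtain ⟨C₈, hC₈, y8⟩ := young (c₁ / 16) (by positivity) C₇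
  refine ⟨C₁ + γ * (1 + 1 / δ) + 1 + C₃ + C₆ + C₈, by positivity,
    fun A B e r s Φ hr he heAB h => ?_⟩
  replace y1 := y1 A |s|
  replace y2 := y2 r e
  replace y3 := y3 A B
  replace y4 := y4 |s| e
  replace y6 := y6 A B
  replace y7 := y7 A e
  replace y8 := y8 A B
  have y9 : |s - r| * e ≤ |s| * e + r * e := by
    rw [← add_mul]
    refine mul_le_mul_of_nonneg_right ((abs_sub _ _).trans ?_) he
    rw [abs_of_nonneg hr]
  have hsq : γ * (s - r) ^ 2 ≤ γ * ((1 + δ) * r ^ 2 + (1 + 1 / δ) * s ^ 2) := by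
    refine mul_le_mul_of_nonneg_left ?_ hγ
    have hd : (1 + δ) * r ^ 2 + (1 + 1 / δ) * s ^ 2 - (s - r) ^ 2 = (δ * r + s) ^ 2 / δ := by
      field_simp; ring
    have : 0 ≤ (δ * r + s) ^ 2 / δ := by positivity
    linarith
  rw [sq_abs] at y1 y4
  rw [heAB] at h y2 y4 y7
  have q1 := sq_nonneg s
  have q2 := sq_nonneg B
  have hδ' : 0 ≤ γ * (1 + 1 / δ) := by positivity
  set g := γ * (1 + 1 / δ) with hg
  have e1 : γ * ((1 + δ) * r ^ 2 + (1 + 1 / δ) * s ^ 2) = γ * (1 + δ) * r ^ 2 + g * s ^ 2 := by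
    rw [hg]; ring
  rw [e1] at hsq
  have hfin : 0 ≤ C₁ * B ^ 2 + g * B ^ 2 + 1 * B ^ 2 + C₃ * s ^ 2 + C₆ * s ^ 2 + C₈ * s ^ 2 := by
    positivity
  clear_value g
  linarith

/-- The weighted Bochner inequality, the equation tested with `φ h(u)`, and `f ≤ p f̃` combine to a
bound for `A² + r A`, provided `γ p < c₂`. -/
theorem exists_bochner_absorption {c₁ c₂ γ κ p : ℝ} (hc₁ : 0 < c₁) (hγ : 0 ≤ γ)
    (hp : 0 ≤ p) (hγp : γ * p < c₂) :
    ∃ δ > 0, ∀ K, 0 ≤ K → ∃ c > 0, ∃ C, 0 ≤ C ∧ ∃ l, 0 ≤ l ∧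
      ∀ A B e r s ν Z o₂ Φ₂ Φ₃ : ℝ, 0 ≤ A → 0 ≤ r → 0 ≤ e → 0 ≤ Z → 0 ≤ o₂ →
        e ^ 2 = A * B →
        ν ≤ Φ₂ + (1 + δ) * (r * A) + δ * A ^ 2 + K * (B ^ 2 + Z) →
        c₁ * A ^ 2 + c₂ * (r * A) ≤
          Φ₃ + c₂ * (A * |s|) + γ * (s - r) ^ 2 + e ^ 2 / 2 + |s - r| * e + κ * (A * e) →
        r ^ 2 ≤ p * ν + o₂ →
        c * (A ^ 2 + r * A) ≤ Φ₃ + l * Φ₂ + C * (s ^ 2 + B ^ 2 + Z + o₂) := by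
  obtain ⟨δ, hδ, hδ1, hδ2⟩ : ∃ δ > 0, (γ * (1 + δ) + δ) * p * (1 + δ) < (c₂ + γ * p) / 2 ∧
      (γ * (1 + δ) + δ) * p * δ < c₁ / 4 := by
    have t1 : Tendsto (fun δ : ℝ => (γ * (1 + δ) + δ) * p * (1 + δ)) (𝓝[>] 0) (𝓝 (γ * p)) := by
      have : Continuous (fun δ : ℝ => (γ * (1 + δ) + δ) * p * (1 + δ)) := by fun_prop
      have h := this.tendsto 0
      simp only [add_zero, mul_one] at h
      exact h.mono_left nhdsWithin_le_nhds
    have t2 : Tendsto (fun δ : ℝ => (γ * (1 + δ) + δ) * p * δ) (𝓝[>] 0) (𝓝 0) := by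
      have : Continuous (fun δ : ℝ => (γ * (1 + δ) + δ) * p * δ) := by fun_prop
      have h := this.tendsto 0
      simp only [mul_zero] at h
      exact h.mono_left nhdsWithin_le_nhds
    have h := ((t1.eventually_lt_const (by linarith : γ * p < (c₂ + γ * p) / 2)).and
      (t2.eventually_lt_const (by linarith : 0 < c₁ / 4))).and self_mem_nhdsWithin
    obtain ⟨δ, h, hδ⟩ := h.exists
    exact ⟨δ, hδ, h⟩
  refine ⟨δ, hδ, fun K hK => ?_⟩
  obtain ⟨C₀, hC₀, young⟩ := exists_bochner_young (c₂ := c₂) (κ := κ) hc₁ hγ hδ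
  have hg0 : 0 ≤ γ * (1 + δ) + δ := by positivity
  generalize γ * (1 + δ) + δ = g at hδ1 hδ2 young hg0
  refine ⟨min (c₁ / 4) ((c₂ - γ * p) / 2), lt_min (by linarith) (by linarith), C₀ + g * p * K + g,
    by positivity, g * p, by positivity,
    fun A B e r s ν Z o₂ Φ₂ Φ₃ hA hr he hZ ho₂ heAB h2 h3 h4 => ?_⟩
  have step := young A B e r s Φ₃ hr he heAB h3
  have hr2 : g * r ^ 2 ≤ g * p * Φ₂ + (c₂ + γ * p) / 2 * (r * A) + c₁ / 4 * A ^ 2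
      + g * p * K * (B ^ 2 + Z) + g * o₂ := by
    have h5 : r ^ 2 ≤ p * (Φ₂ + (1 + δ) * (r * A) + δ * A ^ 2 + K * (B ^ 2 + Z)) + o₂ :=
      h4.trans (add_le_add_left (mul_le_mul_of_nonneg_left h2 hp) _)
    have h6 := mul_le_mul_of_nonneg_left h5 hg0
    have h7 : g * p * (1 + δ) * (r * A) ≤ (c₂ + γ * p) / 2 * (r * A) :=
      mul_le_mul_of_nonneg_right hδ1.le (by positivity)
    have h8 : g * p * δ * A ^ 2 ≤ c₁ / 4 * A ^ 2 :=
      mul_le_mul_of_nonneg_right hδ2.le (by positivity)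
    clear young step h2 h3 h4
    linarith
  have hmin : min (c₁ / 4) ((c₂ - γ * p) / 2) * (A ^ 2 + r * A) ≤
      c₁ / 4 * A ^ 2 + (c₂ - γ * p) / 2 * (r * A) := by
    rw [mul_add]
    exact add_le_add (mul_le_mul_of_nonneg_right (min_le_left _ _) (by positivity))
      (mul_le_mul_of_nonneg_right (min_le_right _ _) (by positivity))
  have hfin : 0 ≤ C₀ * (Z + o₂) + g * p * K * (s ^ 2 + o₂) + g * (s ^ 2 + B ^ 2 + Z) := by
    positivity
  refine hmin.trans ?_
  clear young hmin h2 h3 h4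
  linarith

/-! ### The integral relations at a point -/

/-- The one-dimensional counterpart of `exists_bochner_absorption`. -/
theorem bochner_absorption_one {A B e r s Φ : ℝ} (hA : 0 ≤ A) (hr : 0 ≤ r)
    (heAB : e ^ 2 = A * B) (h : A ^ 2 + 3 * (r * A) ≤ Φ + 3 * (A * |s|) + A * e) :
    1 / 2 * (A ^ 2 + r * A) ≤ Φ + 9 * (s ^ 2 + B ^ 2) := by
  have h1 := mul_le_mul_sq_add (by norm_num : (0 : ℝ) < 1 / 4) A (3 * |s|)
  have h2 := mul_le_mul_sq_add (by norm_num : (0 : ℝ) < 1 / 8) A e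
  have h3 := mul_le_mul_sq_add (by norm_num : (0 : ℝ) < 1 / 8) A (2 * B)
  rw [mul_pow, sq_abs] at h1
  rw [heAB] at h2
  have h1' : A * (3 * |s|) ≤ 1 / 4 * A ^ 2 + 9 * s ^ 2 := h1.trans_eq (by ring)
  have h2' : A * e ≤ 1 / 8 * A ^ 2 + 2 * (A * B) := h2.trans_eq (by ring)
  have h3' : A * (2 * B) ≤ 1 / 8 * A ^ 2 + 8 * B ^ 2 := h3.trans_eq (by ring)
  linarith [mul_nonneg hr hA, sq_nonneg B]

/-- Elimination of the time derivative `s` and of the gradient terms `A`, `r A` between the three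
pointwise relations. The functionals `Φ₁`, `Φ₂`, `Φ₃` enter the result with nonnegative
coefficients, so it can be integrated. -/
theorem exists_energy_elimination {c C l δ K : ℝ} (hc : 0 < c) (hC : 0 ≤ C) (hl : 0 ≤ l)
    (hδ : 0 < δ) (hK : 0 ≤ K) :
    ∃ M, 0 ≤ M ∧ ∃ l₁, 0 ≤ l₁ ∧ ∃ l₂, 0 ≤ l₂ ∧ ∃ l₃, 0 ≤ l₃ ∧
      ∀ A B e r s ν Z o₁ o₂ Φ₁ Φ₂ Φ₃ : ℝ, 0 ≤ A → 0 ≤ r → 0 ≤ Z → 0 ≤ o₁ → 0 ≤ o₂ →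
        e ^ 2 = A * B →
        s ^ 2 ≤ Φ₁ + B ^ 2 + Z + o₁ + e ^ 2 / 2 + |s| * e →
        ν ≤ Φ₂ + (1 + δ) * (r * A) + δ * A ^ 2 + K * (B ^ 2 + Z) →
        c * (A ^ 2 + r * A) ≤ Φ₃ + l * Φ₂ + C * (s ^ 2 + B ^ 2 + Z + o₂) →
        ν ≤ l₁ * Φ₁ + l₂ * Φ₂ + l₃ * Φ₃ + M * (B ^ 2 + Z + (o₁ + o₂)) := by
  have hC2 : 0 ≤ (2 * C) ^ 2 / (2 * c) := by positivity
  generalize hD : (2 * C) ^ 2 / (2 * c) = D at hC2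
  set t := 2 * (1 + δ) / c with ht
  have ht0 : 0 ≤ t := by positivity
  refine ⟨t * (3 * C + D) + K, by positivity, t * (2 * C), by positivity, 1 + t * l, by positivity,
    t, ht0, fun A B e r s ν Z o₁ o₂ Φ₁ Φ₂ Φ₃ hA hr hZ ho₁ ho₂ heAB h1 h2 h3 => ?_⟩
  have y1 := mul_le_mul_sq_add (by norm_num : (0 : ℝ) < 1 / 2) |s| e
  have y2 := mul_le_mul_sq_add (half_pos hc) A (2 * C * B)
  rw [sq_abs] at y1
  have hs : s ^ 2 ≤ 2 * Φ₁ + 2 * (B ^ 2 + Z + o₁) + 2 * (A * B) := by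
    rw [← heAB]; linarith
  have hy2 : 2 * C * (A * B) ≤ c / 2 * A ^ 2 + D * B ^ 2 := by
    have : (2 * C * B) ^ 2 / (4 * (c / 2)) = D * B ^ 2 := by rw [← hD]; ring
    rw [← this]; linarith
  have hrA : 0 ≤ r * A := mul_nonneg hr hA
  have h4 : c / 2 * (A ^ 2 + r * A) ≤ Φ₃ + l * Φ₂ + 2 * C * Φ₁ +
      (3 * C + D) * (B ^ 2 + Z + (o₁ + o₂)) := by
    have h5 := mul_le_mul_of_nonneg_left hs hC
    have h6 : 0 ≤ C * o₁ + 2 * C * o₂ + D * (Z + (o₁ + o₂)) := by positivity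
    have h7 : 0 ≤ c / 2 * (r * A) := by positivity
    linarith
  have h5 : (1 + δ) * (A ^ 2 + r * A) ≤ t * (Φ₃ + l * Φ₂ + 2 * C * Φ₁ +
      (3 * C + D) * (B ^ 2 + Z + (o₁ + o₂))) := by
    refine le_trans (le_of_eq ?_) (mul_le_mul_of_nonneg_left h4 ht0)
    rw [ht]; field_simp
  have h6 : 0 ≤ K * (o₁ + o₂) + A ^ 2 := by positivity
  clear_value t
  linarith

/-- The product of the fourth root of `a⁴ x^(4q) V²` with the power `3/4` of
`(a x^(3q+2) √V h)^(4/3)`. -/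
theorem sq_mul_pow_mul_le {a x V h : ℝ} (q : ℕ) (ha : 0 ≤ a) (hx : 0 ≤ x) (hV : 0 ≤ V)
    (hh : 0 ≤ h) : a ^ 2 * x ^ (4 * q + 2) * (V * h) ≤
      (a ^ 2 * x ^ (2 * q) * V) ^ 2 + (a * x ^ (3 * q + 2) * √V * h) ^ (4 / 3 : ℝ) := by
  have hβ : 0 ≤ a * x ^ (3 * q + 2) * √V * h := by positivity
  have hα : 0 ≤ a * x ^ q * √V := by positivity
  have hV2 := Real.sq_sqrt hV
  have e1 : (a * x ^ q * √V) ^ 4 = (a ^ 2 * x ^ (2 * q) * V) ^ 2 := by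
    have : (a * x ^ q * √V) ^ 2 = a ^ 2 * x ^ (2 * q) * V := by
      rw [mul_pow, mul_pow, hV2, ← pow_mul, mul_comm q 2]
    rw [← this]; ring
  have e2 : a ^ 2 * x ^ (4 * q + 2) * (V * h) =
      (a * x ^ q * √V) * (a * x ^ (3 * q + 2) * √V * h) := by
    nth_rewrite 1 [← hV2]
    ring
  have y := Real.young_inequality_of_nonneg hα hβ (p := 4) (q := 4 / 3)
    (by constructor <;> norm_num)
  have e3 : (a * x ^ q * √V) ^ (4 : ℝ) = (a * x ^ q * √V) ^ 4 := by
    exact_mod_cast Real.rpow_natCast _ 4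
  rw [e2]
  rw [e3, e1] at y
  have p1 : 0 ≤ (a ^ 2 * x ^ (2 * q) * V) ^ 2 := by positivity
  have p2 : 0 ≤ (a * x ^ (3 * q + 2) * √V * h) ^ (4 / 3 : ℝ) := by positivity
  linarith

/-- Young's inequality for the term `h(u) |∇u| |∇φ|` of the equation tested with `φ h(u)`. -/
theorem exists_mul_sqrt_mul_le {δ : ℝ} (hδ : 0 < δ) : ∃ K, 0 ≤ K ∧
    ∀ (a x V h G : ℝ) (q : ℕ), 0 ≤ a → 0 ≤ x → 0 < V → 0 ≤ h → 0 ≤ G →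
      h * (√G * (a * x ^ (4 * q + 3))) ≤ δ * (x ^ (2 * q + 2) * (G * V⁻¹)) ^ 2
        + K * (a * x ^ (3 * q + 2) * √V * h) ^ (4 / 3 : ℝ) := by
  obtain ⟨K, hK, h⟩ := exists_mul_le_pow_four hδ
  refine ⟨K, hK, fun a x V t G q ha hx hV ht hG => ?_⟩
  have hVs : 0 < √V := Real.sqrt_pos.2 hV
  have hβ : 0 ≤ a * x ^ (3 * q + 2) * √V * t := by positivity
  have hα : 0 ≤ x ^ (q + 1) * √G * (√V)⁻¹ := by positivity
  have y := h _ _ hα hβ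
  have e1 : (x ^ (q + 1) * √G * (√V)⁻¹) ^ 4 = (x ^ (2 * q + 2) * (G * V⁻¹)) ^ 2 := by
    have : (x ^ (q + 1) * √G * (√V)⁻¹) ^ 2 = x ^ (2 * q + 2) * (G * V⁻¹) := by
      rw [mul_pow, mul_pow, Real.sq_sqrt hG, inv_pow, Real.sq_sqrt hV.le]; ring
    rw [← this]; ring
  have e2 : (x ^ (q + 1) * √G * (√V)⁻¹) * (a * x ^ (3 * q + 2) * √V * t) =
      t * (√G * (a * x ^ (4 * q + 3))) := by
    have : (√V)⁻¹ * √V = 1 := inv_mul_cancel₀ hVs.ne'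
    linear_combination (x ^ (q + 1) * √G * (a * x ^ (3 * q + 2) * t)) * this
  rw [e1, e2] at y
  exact y

/-- The equation tested with `φ u_t`, at a point. -/
theorem sq_timeDeriv_le {a x V h u G τ ℓ D φt fk Fk : ℝ} (q : ℕ) (ha : 0 ≤ a) (hx : 0 ≤ x)
    (hx1 : x ≤ 1) (hV : 0 ≤ V) (hh : 0 ≤ h) (huV : u ≤ V) (hG : 0 ≤ G)
    (hD : |D| ≤ √G * (a * x ^ (4 * q + 3))) (hφt : |φt| ≤ a ^ 2 * x ^ (4 * q + 3))
    (hFk : 0 ≤ Fk) (hFk' : Fk ≤ u * h) :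
    (x ^ (2 * q + 2) * τ) ^ 2 ≤
      ((x ^ (4 * q + 4) * τ * ℓ - φt * G / 2 + τ * D) + (x ^ (4 * q + 4) * fk * τ + φt * Fk))
      + (a ^ 2 * x ^ (2 * q) * V) ^ 2 + (a * x ^ (3 * q + 2) * √V * h) ^ (4 / 3 : ℝ)
      + x ^ (4 * q + 4) * (|τ - ℓ - fk| * |τ|) + (a * x ^ (2 * q + 1) * √G) ^ 2 / 2
      + |x ^ (2 * q + 2) * τ| * (a * x ^ (2 * q + 1) * √G) := by
  have hpow : x ^ (4 * q + 3) ≤ x ^ (4 * q + 2) := pow_le_pow_of_le_one hx hx1 (by omega)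
  have hφt' : |φt| ≤ a ^ 2 * x ^ (4 * q + 2) :=
    hφt.trans (mul_le_mul_of_nonneg_left hpow (by positivity))
  have b1 : -(φt * Fk) ≤ (a ^ 2 * x ^ (2 * q) * V) ^ 2
      + (a * x ^ (3 * q + 2) * √V * h) ^ (4 / 3 : ℝ) := by
    refine le_trans ?_ (sq_mul_pow_mul_le q ha hx hV hh)
    have h1 : -(φt * Fk) ≤ |φt| * Fk := by
      rw [← abs_of_nonneg hFk, ← abs_mul, abs_of_nonneg hFk]; exact neg_le_abs _
    refine h1.trans (mul_le_mul hφt' (hFk'.trans (mul_le_mul_of_nonneg_right huV hh)) hFk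
      (by positivity))
  have b2 : φt * G / 2 ≤ (a * x ^ (2 * q + 1) * √G) ^ 2 / 2 := by
    have e : (a * x ^ (2 * q + 1) * √G) ^ 2 = a ^ 2 * x ^ (4 * q + 2) * G := by
      rw [mul_pow, Real.sq_sqrt hG]; ring
    rw [e]
    have := mul_le_mul_of_nonneg_right ((le_abs_self φt).trans hφt') hG
    linarith
  have b3 : -(τ * D) ≤ |x ^ (2 * q + 2) * τ| * (a * x ^ (2 * q + 1) * √G) := by
    have h1 : -(τ * D) ≤ |τ| * |D| := by rw [← abs_mul]; exact neg_le_abs _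
    refine h1.trans ((mul_le_mul_of_nonneg_left hD (abs_nonneg τ)).trans_eq ?_)
    rw [abs_mul, abs_of_nonneg (by positivity : 0 ≤ x ^ (2 * q + 2))]
    ring
  have b4 : x ^ (4 * q + 4) * ((τ - ℓ - fk) * τ) ≤ x ^ (4 * q + 4) * (|τ - ℓ - fk| * |τ|) := by
    refine mul_le_mul_of_nonneg_left ?_ (by positivity)
    rw [← abs_mul]; exact le_abs_self _
  have e : (x ^ (2 * q + 2) * τ) ^ 2 = x ^ (4 * q + 4) * τ * τ := by ring
  rw [e]
  linarith

/-- The equation tested with `φ h(u)`, at a point. -/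
theorem mul_trunc_le {a x V h u G τ ℓ D φt H ρ δ K : ℝ} (q : ℕ) (ha : 0 ≤ a) (hx : 0 ≤ x)
    (hx1 : x ≤ 1) (hV : 0 < V) (hh : 0 ≤ h) (huV : u ≤ V) (hG : 0 ≤ G) (hK : 0 ≤ K)
    (hyoung : h * (√G * (a * x ^ (4 * q + 3))) ≤ δ * (x ^ (2 * q + 2) * (G * V⁻¹)) ^ 2
        + K * (a * x ^ (3 * q + 2) * √V * h) ^ (4 / 3 : ℝ))
    (hD : |D| ≤ √G * (a * x ^ (4 * q + 3))) (hφt : |φt| ≤ a ^ 2 * x ^ (4 * q + 3))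
    (hH : 0 ≤ H) (hH' : H ≤ u * h) (hρ : ρ * V ≤ (1 + δ) * (τ - ℓ)) :
    x ^ (4 * q + 4) * ((τ - ℓ) * h) ≤
      ((x ^ (4 * q + 4) * h * τ + φt * H) -
        (x ^ (4 * q + 4) * h * ℓ + x ^ (4 * q + 4) * ρ * G + h * D))
      + (1 + δ) * (x ^ (2 * q + 2) * (τ - ℓ) * (x ^ (2 * q + 2) * (G * V⁻¹)))
      + δ * (x ^ (2 * q + 2) * (G * V⁻¹)) ^ 2
      + (K + 1) * ((a ^ 2 * x ^ (2 * q) * V) ^ 2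
        + (a * x ^ (3 * q + 2) * √V * h) ^ (4 / 3 : ℝ)) := by
  have hpow : x ^ (4 * q + 3) ≤ x ^ (4 * q + 2) := pow_le_pow_of_le_one hx hx1 (by omega)
  have hφt' : |φt| ≤ a ^ 2 * x ^ (4 * q + 2) :=
    hφt.trans (mul_le_mul_of_nonneg_left hpow (by positivity))
  have b1 : -(φt * H) ≤ (a ^ 2 * x ^ (2 * q) * V) ^ 2
      + (a * x ^ (3 * q + 2) * √V * h) ^ (4 / 3 : ℝ) := by
    refine le_trans ?_ (sq_mul_pow_mul_le q ha hx hV.le hh)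
    have h1 : -(φt * H) ≤ |φt| * H := by
      rw [← abs_of_nonneg hH, ← abs_mul, abs_of_nonneg hH]; exact neg_le_abs _
    refine h1.trans (mul_le_mul hφt' (hH'.trans (mul_le_mul_of_nonneg_right huV hh)) hH
      (by positivity))
  have b2 : h * D ≤ h * (√G * (a * x ^ (4 * q + 3))) :=
    mul_le_mul_of_nonneg_left ((le_abs_self D).trans hD) hh
  have b3 : x ^ (4 * q + 4) * ρ * G ≤
      (1 + δ) * (x ^ (2 * q + 2) * (τ - ℓ) * (x ^ (2 * q + 2) * (G * V⁻¹))) := by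
    have h1 : ρ ≤ (1 + δ) * (τ - ℓ) * V⁻¹ := by
      rw [← div_eq_mul_inv, le_div_iff₀ hV]; exact hρ
    have h2 := mul_le_mul_of_nonneg_left h1 (by positivity : 0 ≤ x ^ (4 * q + 4) * G)
    have e : (1 + δ) * (x ^ (2 * q + 2) * (τ - ℓ) * (x ^ (2 * q + 2) * (G * V⁻¹))) =
      x ^ (4 * q + 4) * G * ((1 + δ) * (τ - ℓ) * V⁻¹) := by ring
    rw [e]
    linarith
  have p1 : 0 ≤ K * (a ^ 2 * x ^ (2 * q) * V) ^ 2 := by positivity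
  linarith

/-- The weighted Bochner inequality, at a point. -/
theorem bochner_le {a x V G τ ℓ D Δφ c₁ c₂ γ κ : ℝ} (q : ℕ) (hx : 0 ≤ x) (hV : 0 < V)
    (hG : 0 ≤ G) (hc₂ : 0 ≤ c₂) (hκ : 0 ≤ κ)
    (hD : |D| ≤ √G * (a * x ^ (4 * q + 3))) (hΔ : |Δφ| ≤ a ^ 2 * x ^ (4 * q + 2)) :
    c₁ * (x ^ (2 * q + 2) * (G * V⁻¹)) ^ 2
      + c₂ * (x ^ (2 * q + 2) * (τ - ℓ) * (x ^ (2 * q + 2) * (G * V⁻¹))) ≤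
      (x ^ (4 * q + 4) * (c₁ * (G * V⁻¹) ^ 2 - c₂ * (G * V⁻¹) * ℓ - γ * ℓ ^ 2)
        - Δφ * G / 2 - ℓ * D - κ * (G * V⁻¹) * D)
      + c₂ * (x ^ (2 * q + 2) * (G * V⁻¹) * |x ^ (2 * q + 2) * τ|)
      + γ * (x ^ (2 * q + 2) * τ - x ^ (2 * q + 2) * (τ - ℓ)) ^ 2
      + (a * x ^ (2 * q + 1) * √G) ^ 2 / 2
      + |x ^ (2 * q + 2) * τ - x ^ (2 * q + 2) * (τ - ℓ)| * (a * x ^ (2 * q + 1) * √G)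
      + κ * (x ^ (2 * q + 2) * (G * V⁻¹) * (a * x ^ (2 * q + 1) * √G)) := by
  have b1 : c₂ * (x ^ (2 * q + 2) * (G * V⁻¹) * (x ^ (2 * q + 2) * τ)) ≤
      c₂ * (x ^ (2 * q + 2) * (G * V⁻¹) * |x ^ (2 * q + 2) * τ|) :=
    mul_le_mul_of_nonneg_left (mul_le_mul_of_nonneg_left (le_abs_self _) (by positivity)) hc₂
  have b2 : Δφ * G / 2 ≤ (a * x ^ (2 * q + 1) * √G) ^ 2 / 2 := by
    have e : (a * x ^ (2 * q + 1) * √G) ^ 2 = a ^ 2 * x ^ (4 * q + 2) * G := by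
      rw [mul_pow, Real.sq_sqrt hG]; ring
    rw [e]
    have := mul_le_mul_of_nonneg_right ((le_abs_self Δφ).trans hΔ) hG
    linarith
  have b3 : ℓ * D ≤ |x ^ (2 * q + 2) * τ - x ^ (2 * q + 2) * (τ - ℓ)| *
      (a * x ^ (2 * q + 1) * √G) := by
    have h1 : ℓ * D ≤ |ℓ| * |D| := by rw [← abs_mul]; exact le_abs_self _
    refine h1.trans ((mul_le_mul_of_nonneg_left hD (abs_nonneg ℓ)).trans_eq ?_)
    rw [show x ^ (2 * q + 2) * τ - x ^ (2 * q + 2) * (τ - ℓ) = x ^ (2 * q + 2) * ℓ by ring,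
      abs_mul, abs_of_nonneg (by positivity : 0 ≤ x ^ (2 * q + 2))]
    ring
  have b4 : κ * (G * V⁻¹) * D ≤
      κ * (x ^ (2 * q + 2) * (G * V⁻¹) * (a * x ^ (2 * q + 1) * √G)) := by
    have := mul_le_mul_of_nonneg_left ((le_abs_self D).trans hD)
      (by positivity : 0 ≤ κ * (G * V⁻¹))
    refine this.trans_eq ?_
    ring
  have e1 : c₁ * (x ^ (2 * q + 2) * (G * V⁻¹)) ^ 2
      + c₂ * (x ^ (2 * q + 2) * (τ - ℓ) * (x ^ (2 * q + 2) * (G * V⁻¹))) =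
      x ^ (4 * q + 4) * (c₁ * (G * V⁻¹) ^ 2 - c₂ * (G * V⁻¹) * ℓ - γ * ℓ ^ 2)
      + c₂ * (x ^ (2 * q + 2) * (G * V⁻¹) * (x ^ (2 * q + 2) * τ))
      + γ * (x ^ (2 * q + 2) * τ - x ^ (2 * q + 2) * (τ - ℓ)) ^ 2 := by ring
  rw [e1]
  linarith

/-- The Bochner identity in one space dimension, at a point. -/
theorem bochner_one_le {a x V G τ ℓ D : ℝ} (q : ℕ) (hx : 0 ≤ x) (hV : 0 < V)
    (hG : 0 ≤ G) (hD : |D| ≤ √G * (a * x ^ (4 * q + 3))) :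
    (x ^ (2 * q + 2) * (G * V⁻¹)) ^ 2
      + 3 * (x ^ (2 * q + 2) * (τ - ℓ) * (x ^ (2 * q + 2) * (G * V⁻¹))) ≤
      (x ^ (4 * q + 4) * ((G * V⁻¹) ^ 2 - 3 * (G * V⁻¹) * ℓ) - (G * V⁻¹) * D)
      + 3 * (x ^ (2 * q + 2) * (G * V⁻¹) * |x ^ (2 * q + 2) * τ|)
      + x ^ (2 * q + 2) * (G * V⁻¹) * (a * x ^ (2 * q + 1) * √G) := by
  have b1 : x ^ (2 * q + 2) * (G * V⁻¹) * (x ^ (2 * q + 2) * τ) ≤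
      x ^ (2 * q + 2) * (G * V⁻¹) * |x ^ (2 * q + 2) * τ| :=
    mul_le_mul_of_nonneg_left (le_abs_self _) (by positivity)
  have b4 : (G * V⁻¹) * D ≤ x ^ (2 * q + 2) * (G * V⁻¹) * (a * x ^ (2 * q + 1) * √G) := by
    have := mul_le_mul_of_nonneg_left ((le_abs_self D).trans hD) (by positivity : 0 ≤ G * V⁻¹)
    refine this.trans_eq ?_
    ring
  have e1 : (x ^ (2 * q + 2) * (G * V⁻¹)) ^ 2
      + 3 * (x ^ (2 * q + 2) * (τ - ℓ) * (x ^ (2 * q + 2) * (G * V⁻¹))) =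
      x ^ (4 * q + 4) * ((G * V⁻¹) ^ 2 - 3 * (G * V⁻¹) * ℓ)
      + 3 * (x ^ (2 * q + 2) * (G * V⁻¹) * (x ^ (2 * q + 2) * τ)) := by ring
  rw [e1]
  linarith

/-! ### Parabolic cutoffs and the terms of the energy estimate -/

section

variable {n : ℕ}

theorem dirDeriv_eq_zero_of_notMem_tsupport {φ : SpaceTime n → ℝ} {z : SpaceTime n}
    (hz : z ∉ tsupport φ) (e : SpaceTime n) : dirDeriv e φ z = 0 := by
  simp [dirDeriv, fderiv_of_notMem_tsupport ℝ hz]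

theorem tsupport_dirDeriv_subset (φ : SpaceTime n → ℝ) (e : SpaceTime n) :
    tsupport (dirDeriv e φ) ⊆ tsupport φ :=
  closure_minimal (fun _ hz => by_contra fun h => hz (dirDeriv_eq_zero_of_notMem_tsupport h e))
    (isClosed_tsupport φ)

theorem spaceLaplacian_eq_zero_of_notMem_tsupport {φ : SpaceTime n → ℝ} {z : SpaceTime n}
    (hz : z ∉ tsupport φ) : spaceLaplacian φ z = 0 :=
  Finset.sum_eq_zero fun _ _ =>
    dirDeriv_eq_zero_of_notMem_tsupport (fun h => hz (tsupport_dirDeriv_subset φ _ h)) _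

theorem gradInner_eq_zero_of_notMem_tsupport {φ : SpaceTime n → ℝ} {z : SpaceTime n}
    (hz : z ∉ tsupport φ) (j : Jet n) : j.gradInner φ z = 0 :=
  Finset.sum_eq_zero fun i _ => by rw [dirDeriv_eq_zero_of_notMem_tsupport hz, mul_zero]

theorem Jet.gradSq_nonneg (j : Jet n) : 0 ≤ j.gradSq := Finset.sum_nonneg fun _ _ => sq_nonneg _

theorem Jet.abs_gradInner_le {φ : SpaceTime n → ℝ} {z : SpaceTime n} {b : ℝ} (hb : 0 ≤ b)
    (h : ∑ i, dirDeriv (spaceDir i) φ z ^ 2 ≤ b ^ 2) (j : Jet n) :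
    |j.gradInner φ z| ≤ √j.gradSq * b := by
  have hcs := Finset.sum_mul_sq_le_sq_mul_sq Finset.univ (fun i => j.2.2.1 i)
    (fun i => dirDeriv (spaceDir i) φ z)
  refine abs_le_of_sq_le_sq ?_ (by positivity)
  rw [mul_pow, Real.sq_sqrt j.gradSq_nonneg]
  exact hcs.trans (mul_le_mul_of_nonneg_left h j.gradSq_nonneg)

/-- A cutoff `ψ` on space-time at parabolic scale `1 / a`: the derivatives of the power
`ψ ^ (4 q + 4)` are bounded by lower powers of `ψ` and the powers of `a` given by the scaling. -/
structure ParabolicCutoff (q : ℕ) (a : ℝ) (ψ : SpaceTime n → ℝ) : Prop where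
  contDiff : ContDiff ℝ ∞ ψ
  hasCompactSupport : HasCompactSupport ψ
  nonneg : ∀ z, 0 ≤ ψ z
  le_one : ∀ z, ψ z ≤ 1
  scale_nonneg : 0 ≤ a
  grad_le : ∀ z, ∑ i, dirDeriv (spaceDir i) (fun z => ψ z ^ (4 * q + 4)) z ^ 2 ≤
    (a * ψ z ^ (4 * q + 3)) ^ 2
  time_le : ∀ z, |dirDeriv (timeDir n) (fun z => ψ z ^ (4 * q + 4)) z| ≤ a ^ 2 * ψ z ^ (4 * q + 3)
  laplacian_le : ∀ z, |spaceLaplacian (fun z => ψ z ^ (4 * q + 4)) z| ≤ a ^ 2 * ψ z ^ (4 * q + 2)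

namespace ParabolicCutoff

variable {q : ℕ} {a : ℝ} {ψ : SpaceTime n → ℝ}

theorem contDiff_pow (hψ : ParabolicCutoff q a ψ) (m : ℕ) : ContDiff ℝ ∞ (fun z => ψ z ^ m) :=
  hψ.contDiff.pow m

theorem hasCompactSupport_pow (hψ : ParabolicCutoff q a ψ) {m : ℕ} (hm : m ≠ 0) :
    HasCompactSupport (fun z => ψ z ^ m) :=
  hψ.hasCompactSupport.comp_left (g := fun x => x ^ m) (zero_pow hm)

theorem pow_eq_zero_of_notMem {z : SpaceTime n} (hz : z ∉ tsupport ψ) {m : ℕ} (hm : m ≠ 0) :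
    ψ z ^ m = 0 := by
  rw [image_eq_zero_of_notMem_tsupport hz, zero_pow hm]

theorem abs_gradInner_le (hψ : ParabolicCutoff q a ψ) (z : SpaceTime n) (j : Jet n) :
    |j.gradInner (fun z => ψ z ^ (4 * q + 4)) z| ≤ √j.gradSq * (a * ψ z ^ (4 * q + 3)) :=
  Jet.abs_gradInner_le (mul_nonneg hψ.scale_nonneg (pow_nonneg (hψ.nonneg z) _)) (hψ.grad_le z) j

end ParabolicCutoff

/-- The term `ψ^(2q+2) |∇u|² / (u + ε)` of the energy estimate. -/
noncomputable def gradTerm (q : ℕ) (ψ : SpaceTime n → ℝ) (ε : ℝ) (z : SpaceTime n) (j : Jet n) :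
    ℝ :=
  ψ z ^ (2 * q + 2) * (j.gradSq * (j.shift ε)⁻¹)

/-- The term `ψ^(2q+2) (u_t - Δu)`, which is `ψ^(2q+2) f(u)` for a solution. -/
def reactionTerm (q : ℕ) (ψ : SpaceTime n → ℝ) (z : SpaceTime n) (j : Jet n) : ℝ :=
  ψ z ^ (2 * q + 2) * (j.2.1 - j.2.2.2)

/-- The term `ψ^(2q+2) u_t`. -/
def timeTerm (q : ℕ) (ψ : SpaceTime n → ℝ) (z : SpaceTime n) (j : Jet n) : ℝ :=
  ψ z ^ (2 * q + 2) * j.2.1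

/-- The lower order term `a² ψ^(2q) (u + ε)`. -/
def valueTerm (q : ℕ) (a : ℝ) (ψ : SpaceTime n → ℝ) (ε : ℝ) (z : SpaceTime n) (j : Jet n) : ℝ :=
  a ^ 2 * ψ z ^ (2 * q) * j.shift ε

/-- The square root of `gradTerm * valueTerm`. -/
noncomputable def crossTerm (q : ℕ) (a : ℝ) (ψ : SpaceTime n → ℝ) (z : SpaceTime n) (j : Jet n) :
    ℝ :=
  a * ψ z ^ (2 * q + 1) * √j.gradSq

theorem crossTerm_sq {ε : ℝ} (hε : 0 < ε) (q : ℕ) (a : ℝ) (ψ : SpaceTime n → ℝ) (z : SpaceTime n)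
    (j : Jet n) : crossTerm q a ψ z j ^ 2 = gradTerm q ψ ε z j * valueTerm q a ψ ε z j := by
  rw [crossTerm, gradTerm, valueTerm, mul_pow, Real.sq_sqrt j.gradSq_nonneg]
  have : (j.shift ε)⁻¹ * j.shift ε = 1 := inv_mul_cancel₀ (j.shift_pos hε).ne'
  linear_combination (-(a ^ 2 * ψ z ^ (4 * q + 2) * j.gradSq)) * this

/-- An integrand, depending on the parameter `ε` and on a test function, whose integral is
nonpositive for all nonnegative functions. -/
structure IsNonposFunctional (Ψ : ℝ → (SpaceTime n → ℝ) → SpaceTime n → Jet n → ℝ) : Prop where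
  tame : ∀ ε > 0, ∀ φ, ContDiff ℝ ∞ φ → HasCompactSupport φ → Tame (Ψ ε φ)
  eq_zero : ∀ ε φ, ∀ z ∉ tsupport φ, ∀ j, Ψ ε φ z j = 0
  integral_nonpos : ∀ ε > 0, ∀ φ, ContDiff ℝ ∞ φ → HasCompactSupport φ → (∀ z, 0 ≤ φ z) →
    ∀ v, ContDiff ℝ ∞ v → (∀ z, 0 ≤ v z) → ∫ z, Ψ ε φ z (jetOf v z) ≤ 0

theorem isNonposFunctional_bochnerIntegrandOne :
    IsNonposFunctional (n := 1) bochnerIntegrandOne where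
  tame _ hε _ hφ hc := tame_bochnerIntegrandOne hε hφ hc
  eq_zero ε φ z hz j := by
    simp [bochnerIntegrandOne, gradInner_eq_zero_of_notMem_tsupport hz,
      image_eq_zero_of_notMem_tsupport hz]
  integral_nonpos ε hε φ hφ hc _ v hv hv0 :=
    (integral_bochnerIntegrandOne_eq_zero hφ hc hv hv0 hε).le

theorem bochnerIntegrand_eq_zero (κ ε : ℝ) {φ : SpaceTime n → ℝ} {z : SpaceTime n}
    (hz : z ∉ tsupport φ) (j : Jet n) : bochnerIntegrand κ ε φ z j = 0 := by
  simp [bochnerIntegrand, gradInner_eq_zero_of_notMem_tsupport hz,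
    image_eq_zero_of_notMem_tsupport hz, spaceLaplacian_eq_zero_of_notMem_tsupport hz]

theorem isNonposFunctional_bochnerIntegrand (hn : 0 < n) (κ : ℝ) :
    IsNonposFunctional (n := n) (bochnerIntegrand κ) where
  tame _ hε _ hφ hc := tame_bochnerIntegrand κ hε hφ hc
  eq_zero ε _ _ hz j := bochnerIntegrand_eq_zero κ ε hz j
  integral_nonpos ε hε _ hφ hc hφ0 _ hv hv0 :=
    integral_bochnerIntegrand_nonpos hn hφ hc hφ0 hv hv0 hε
      ((tame_bochnerIntegrand κ hε hφ hc).integrable_jetOf hc.isCompact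
        (fun _ hz j => bochnerIntegrand_eq_zero κ ε hz j) hv)

/-- The condition on the exponent is exactly what allows a choice of the parameter `κ`. -/
theorem exists_bochner_parameter {N p : ℝ} (hN : 1 < N) (hp : 0 ≤ p)
    (hpN : p < N * (N + 2) / (N - 1) ^ 2) :
    ∃ κ, 0 < κ ∧ 0 < κ - κ ^ 2 * ((N - 1) / N) ∧ (N - 1) / N * p < κ * ((N + 2) / N) := by
  have h1 : 0 < N - 1 := by linarith
  have h0 : 0 < N := by linarith
  rw [lt_div_iff₀ (by positivity)] at hpN
  have hlt : p * (N - 1) / (N + 2) < N / (N - 1) := by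
    rw [div_lt_div_iff₀ (by linarith) h1]; nlinarith
  obtain ⟨κ, hκ1, hκ2⟩ := exists_between hlt
  have hκ0 : 0 < κ := lt_of_le_of_lt (by positivity) hκ1
  refine ⟨κ, hκ0, ?_, ?_⟩
  · rw [lt_div_iff₀ h1] at hκ2
    have e : κ - κ ^ 2 * ((N - 1) / N) = κ * (N - κ * (N - 1)) / N := by field_simp
    rw [e]
    exact div_pos (mul_pos hκ0 (by linarith)) h0
  · rw [div_lt_iff₀ (by linarith)] at hκ1
    have e1 : (N - 1) / N * p = p * (N - 1) / N := by ring
    have e2 : κ * ((N + 2) / N) = κ * (N + 2) / N := by ring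
    rw [e1, e2]
    exact div_lt_div_of_pos_right hκ1 h0

/-- Absorption in the weighted Bochner inequality. In dimension one the squared reaction term does
not occur, and no bound for it is needed. -/
theorem exists_isNonposFunctional {p : ℝ}
    (hp : n = 1 ∨ 2 ≤ n ∧ 0 ≤ p ∧ p < (n : ℝ) * ((n : ℝ) + 2) / ((n : ℝ) - 1) ^ 2) :
    ∃ δ > 0, ∃ Ψ, IsNonposFunctional (n := n) Ψ ∧
      ∀ K, 0 ≤ K → ∃ c > 0, ∃ C, 0 ≤ C ∧ ∃ l, 0 ≤ l ∧
        ∀ (q : ℕ) (a : ℝ) (ψ : SpaceTime n → ℝ), ParabolicCutoff q a ψ →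
        ∀ ε > 0, ∀ (z : SpaceTime n) (j : Jet n) (ν Z o₂ Φ₂ : ℝ), 0 ≤ reactionTerm q ψ z j →
          0 ≤ Z → 0 ≤ o₂ →
          ν ≤ Φ₂ + (1 + δ) * (reactionTerm q ψ z j * gradTerm q ψ ε z j)
            + δ * gradTerm q ψ ε z j ^ 2 + K * (valueTerm q a ψ ε z j ^ 2 + Z) →
          (2 ≤ n → reactionTerm q ψ z j ^ 2 ≤ p * ν + o₂) →
          c * (gradTerm q ψ ε z j ^ 2 + reactionTerm q ψ z j * gradTerm q ψ ε z j) ≤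
            Ψ ε (fun z => ψ z ^ (4 * q + 4)) z j + l * Φ₂ +
            C * (timeTerm q ψ z j ^ 2 + valueTerm q a ψ ε z j ^ 2 + Z + o₂) := by
  have hA : ∀ {q : ℕ} {a : ℝ} {ψ : SpaceTime n → ℝ} {ε : ℝ}, ParabolicCutoff q a ψ → 0 < ε →
      ∀ (z : SpaceTime n) (j : Jet n), 0 ≤ gradTerm q ψ ε z j := fun hψ hε z j =>
    mul_nonneg (pow_nonneg (hψ.nonneg z) _)
      (mul_nonneg j.gradSq_nonneg (inv_nonneg.2 (j.shift_pos hε).le))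
  rcases hp with rfl | ⟨hn, hp0, hp⟩
  · refine ⟨1, one_pos, bochnerIntegrandOne, isNonposFunctional_bochnerIntegrandOne,
      fun K hK => ⟨1 / 2, by norm_num, 9, by norm_num, 0, le_rfl, ?_⟩⟩
    intro q a ψ hψ ε hε z j ν Z o₂ Φ₂ hr hZ ho₂ _ _
    have h := bochner_one_le (τ := j.2.1) (ℓ := j.2.2.2) q (hψ.nonneg z) (j.shift_pos hε)
      j.gradSq_nonneg (hψ.abs_gradInner_le z j)
    have h' := bochner_absorption_one (A := gradTerm q ψ ε z j) (B := valueTerm q a ψ ε z j)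
      (e := crossTerm q a ψ z j) (r := reactionTerm q ψ z j) (s := timeTerm q ψ z j)
      (Φ := bochnerIntegrandOne ε (fun z => ψ z ^ (4 * q + 4)) z j)
      (hA hψ hε z j) hr (crossTerm_sq hε q a ψ z j) h
    linarith
  · have hn1 : (1 : ℝ) < n := by exact_mod_cast hn
    have hn0 : (0 : ℝ) < n := by linarith
    obtain ⟨κ, hκ, hc₁, hγp⟩ := exists_bochner_parameter hn1 hp0 hp
    have hγ : (0 : ℝ) ≤ (n - 1) / n := div_nonneg (by linarith) hn0.le
    obtain ⟨δ, hδ, H⟩ := exists_bochner_absorption (κ := κ) hc₁ hγ hp0 hγp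
    refine ⟨δ, hδ, bochnerIntegrand κ, isNonposFunctional_bochnerIntegrand (by omega) κ,
      fun K hK => ?_⟩
    obtain ⟨c, hc, C, hC, l, hl, H⟩ := H K hK
    refine ⟨c, hc, C, hC, l, hl, ?_⟩
    intro q a ψ hψ ε hε z j ν Z o₂ Φ₂ hr hZ ho₂ h2 h4
    have h := bochner_le (τ := j.2.1) (ℓ := j.2.2.2) (c₁ := κ - κ ^ 2 * (((n : ℝ) - 1) / n))
      (c₂ := κ * (((n : ℝ) + 2) / n)) (γ := ((n : ℝ) - 1) / n) (κ := κ) q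
      (hψ.nonneg z) (j.shift_pos hε) j.gradSq_nonneg (by positivity) hκ.le
      (hψ.abs_gradInner_le z j) (hψ.laplacian_le z)
    refine H (gradTerm q ψ ε z j) (valueTerm q a ψ ε z j) (crossTerm q a ψ z j)
      (reactionTerm q ψ z j) (timeTerm q ψ z j) ν Z o₂ Φ₂ _ (hA hψ hε z j) hr ?_ hZ ho₂
      (crossTerm_sq hε q a ψ z j) h2 h (h4 hn)
    exact mul_nonneg (mul_nonneg hψ.scale_nonneg (pow_nonneg (hψ.nonneg z) _)) (Real.sqrt_nonneg _)

end

/-! ### The energy estimate with truncation -/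

section

variable {n : ℕ}

theorem tame_comp {h : ℝ → ℝ} (hh : Continuous h)
    (hb : ∃ (C : ℝ) (m : ℕ), ∀ s, |h s| ≤ C * (1 + |s|) ^ m) :
    Tame (fun (_ : SpaceTime n) (j : Jet n) => h j.1) := by
  obtain ⟨C, m, hb⟩ := hb
  refine ⟨hh.comp (continuous_fst.comp continuous_snd), |C|, m, fun z j => (hb j.1).trans ?_⟩
  refine mul_le_mul (le_abs_self C) (pow_le_pow_left₀ (by positivity) ?_ m) (by positivity)
    (abs_nonneg C)
  have : |j.1| ≤ ‖j‖ := norm_fst_le j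
  linarith

theorem exists_abs_primitive_le {g : ℝ → ℝ}
    (hb : ∃ (C : ℝ) (m : ℕ), ∀ s, |g s| ≤ C * (1 + |s|) ^ m) :
    ∃ (C : ℝ) (m : ℕ), ∀ s, |∫ z in (0 : ℝ)..s, g z| ≤ C * (1 + |s|) ^ m := by
  obtain ⟨C, m, hb⟩ := hb
  refine ⟨|C|, m + 1, fun s => ?_⟩
  have h := intervalIntegral.norm_integral_le_of_norm_le_const (a := (0 : ℝ)) (b := s) (f := g)
    (C := |C| * (1 + |s|) ^ m) fun x hx => (hb x).trans ?_
  · rw [Real.norm_eq_abs, sub_zero] at h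
    refine h.trans ?_
    rw [pow_succ, ← mul_assoc]
    refine mul_le_mul_of_nonneg_left ?_ (by positivity)
    linarith
  · have hxs : |x| ≤ |s| := by
      rcases le_total 0 s with h | h
      · rw [uIoc_of_le h] at hx
        rw [abs_of_pos hx.1, abs_of_nonneg h]; exact hx.2
      · rw [uIoc_of_ge h] at hx
        rw [abs_of_nonpos hx.2, abs_of_nonpos h]; linarith [hx.1]
    exact mul_le_mul (le_abs_self C) (pow_le_pow_left₀ (by positivity) (by linarith) m)
      (by positivity) (abs_nonneg C)

namespace IsNonlinearity

variable {f : ℝ → ℝ}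

theorem growth_truncF (hf : IsNonlinearity f) (k : ℕ) :
    ∃ (C : ℝ) (m : ℕ), ∀ s, |truncF f k s| ≤ C * (1 + |s|) ^ m := by
  obtain ⟨C, hC⟩ := hf.exists_abs_truncF_le k
  exact ⟨C, 0, by simpa using hC⟩

theorem growth_truncDeriv (hf : IsNonlinearity f) (k : ℕ) :
    ∃ (C : ℝ) (m : ℕ), ∀ s, |truncDeriv f k s| ≤ C * (1 + |s|) ^ m := by
  obtain ⟨C, hC⟩ := hf.exists_abs_truncDeriv_le k
  exact ⟨C, 0, by simpa using hC⟩

theorem growth_truncTilde (hf : IsNonlinearity f) (k : ℕ) :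
    ∃ (C : ℝ) (m : ℕ), ∀ s, |truncTilde f k s| ≤ C * (1 + |s|) ^ m :=
  exists_abs_primitive_le (hf.growth_truncDeriv k)

theorem tame_truncF (hf : IsNonlinearity f) (k : ℕ) :
    Tame (fun (_ : SpaceTime n) (j : Jet n) => truncF f k j.1) :=
  tame_comp (hf.continuous_truncF k) (hf.growth_truncF k)

theorem tame_truncDeriv (hf : IsNonlinearity f) (k : ℕ) :
    Tame (fun (_ : SpaceTime n) (j : Jet n) => truncDeriv f k j.1) :=
  tame_comp (hf.continuous_truncDeriv k) (hf.growth_truncDeriv k)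

theorem tame_truncTilde (hf : IsNonlinearity f) (k : ℕ) :
    Tame (fun (_ : SpaceTime n) (j : Jet n) => truncTilde f k j.1) :=
  tame_comp (hf.continuous_truncTilde k) (hf.growth_truncTilde k)

end IsNonlinearity

theorem hasDerivAt_primitive {g : ℝ → ℝ} (hg : Continuous g) (s : ℝ) :
    HasDerivAt (fun s => ∫ z in (0 : ℝ)..s, g z) (g s) s :=
  intervalIntegral.integral_hasDerivAt_right (hg.intervalIntegrable _ _)
    (hg.stronglyMeasurableAtFilter _ _) hg.continuousAt

theorem tame_primitive {g : ℝ → ℝ} (hg : Continuous g)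
    (hb : ∃ (C : ℝ) (m : ℕ), ∀ s, |g s| ≤ C * (1 + |s|) ^ m) :
    Tame (fun (_ : SpaceTime n) (j : Jet n) => ∫ z in (0 : ℝ)..j.1, g z) :=
  tame_comp (h := fun s => ∫ z in (0 : ℝ)..s, g z)
    (continuous_iff_continuousAt.2 fun s => (hasDerivAt_primitive hg s).continuousAt)
    (exists_abs_primitive_le hb)

theorem Tame.rpow {Φ : SpaceTime n → Jet n → ℝ} (h : Tame Φ) {r : ℝ} (hr : 0 ≤ r) :
    Tame (fun z j => Φ z j ^ r) := by
  obtain ⟨N, hN⟩ := exists_nat_ge r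
  refine Tame.of_abs_le (((tame_const 1).add h.abs).pow N)
    (h.1.rpow_const fun _ => Or.inr hr) fun z j => ?_
  refine (Real.abs_rpow_le_abs_rpow _ _).trans ?_
  have h1 : (1 : ℝ) ≤ 1 + |Φ z j| := by linarith [abs_nonneg (Φ z j)]
  calc |Φ z j| ^ r ≤ (1 + |Φ z j|) ^ r := Real.rpow_le_rpow (abs_nonneg _) (by linarith) hr
    _ ≤ (1 + |Φ z j|) ^ (N : ℝ) := Real.rpow_le_rpow_of_exponent_le h1 hN
    _ = (1 + |Φ z j|) ^ N := Real.rpow_natCast _ _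

theorem Tame.sqrt {Φ : SpaceTime n → Jet n → ℝ} (h : Tame Φ) : Tame (fun z j => √(Φ z j)) := by
  simp only [Real.sqrt_eq_rpow]
  exact h.rpow (by norm_num)

/-- The lower order term `(a ψ^(3q+2) √(u + ε) h(u))^(4/3)`, where `h` is the truncation of `f̃`. -/
noncomputable def truncTerm (f : ℝ → ℝ) (k q : ℕ) (a : ℝ) (ψ : SpaceTime n → ℝ) (ε : ℝ)
    (z : SpaceTime n) (j : Jet n) : ℝ :=
  (a * ψ z ^ (3 * q + 2) * √(j.shift ε) * truncTilde f k j.1) ^ (4 / 3 : ℝ)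

/-- The error caused by the truncation of `f` and of `f̃`. -/
noncomputable def errorTerm (f : ℝ → ℝ) (p : ℝ) (k q : ℕ) (ψ : SpaceTime n → ℝ)
    (z : SpaceTime n) (j : Jet n) : ℝ :=
  ψ z ^ (4 * q + 4) * (|j.2.1 - j.2.2.2 - truncF f k j.1| * |j.2.1|) +
  ψ z ^ (4 * q + 4) * ((j.2.1 - j.2.2.2) * (p * fTilde f |j.1| - p * truncTilde f k j.1))

/-- The functional arising from the multiplication of the equation by `φ u_t`; the reaction term is
truncated. -/
noncomputable def timeFunctional (f : ℝ → ℝ) (k : ℕ) (φ : SpaceTime n → ℝ) (z : SpaceTime n)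
    (j : Jet n) : ℝ :=
  (φ z * j.2.1 * j.2.2.2 - dirDeriv (timeDir n) φ z * j.gradSq / 2 + j.2.1 * j.gradInner φ z) +
  (φ z * truncF f k j.1 * j.2.1 + dirDeriv (timeDir n) φ z * ∫ s in (0 : ℝ)..j.1, truncF f k s)

/-- The functional arising from the multiplication of the equation by `φ h(u)`, where `h` is the
truncation of `f̃`. -/
noncomputable def reactionFunctional (f : ℝ → ℝ) (k : ℕ) (φ : SpaceTime n → ℝ) (z : SpaceTime n)
    (j : Jet n) : ℝ :=
  (φ z * truncTilde f k j.1 * j.2.1 +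
    dirDeriv (timeDir n) φ z * ∫ s in (0 : ℝ)..j.1, truncTilde f k s) -
  (φ z * truncTilde f k j.1 * j.2.2.2 + φ z * truncDeriv f k j.1 * j.gradSq +
    truncTilde f k j.1 * j.gradInner φ z)

section functionals

variable {f : ℝ → ℝ} {φ : SpaceTime n → ℝ} {u : SpaceTime n → ℝ} {J : SpaceTime n → Jet n}

theorem integrable_timeFunctional (hf : IsNonlinearity f) (k : ℕ) (hφ : ContDiff ℝ ∞ φ)
    (hc : HasCompactSupport φ) (hJ : SobolevJet u J) :
    Integrable (fun z => timeFunctional f k φ z (J z)) ∧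
      ∫ z, timeFunctional f k φ z (J z) = 0 := by
  have tφ := tame_coeff hφ.continuous hc
  have tt := tame_dirDeriv hφ hc (timeDir n)
  have t1 : Tame (fun z (j : Jet n) => φ z * j.2.1 * j.2.2.2 -
      dirDeriv (timeDir n) φ z * j.gradSq / 2 + j.2.1 * j.gradInner φ z) := by
    refine (Tame.sub ((tφ.mul tame_timeDeriv).mul tame_laplacian) ?_).add
      (tame_timeDeriv.mul (tame_gradInner hφ hc))
    simp only [div_eq_mul_inv]
    exact (tt.mul tame_gradSq).mul (tame_const _)
  have t2 : Tame (fun z (j : Jet n) => φ z * truncF f k j.1 * j.2.1 +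
      dirDeriv (timeDir n) φ z * ∫ s in (0 : ℝ)..j.1, truncF f k s) :=
    ((tφ.mul (hf.tame_truncF k)).mul tame_timeDeriv).add
      (tt.mul (tame_primitive (hf.continuous_truncF k) (hf.growth_truncF k)))
  have z1 : ∀ z ∉ tsupport φ, ∀ j : Jet n, φ z * j.2.1 * j.2.2.2 -
      dirDeriv (timeDir n) φ z * j.gradSq / 2 + j.2.1 * j.gradInner φ z = 0 := fun z hz j => by
    simp [image_eq_zero_of_notMem_tsupport hz, dirDeriv_eq_zero_of_notMem_tsupport hz,
      gradInner_eq_zero_of_notMem_tsupport hz]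
  have z2 : ∀ z ∉ tsupport φ, ∀ j : Jet n, φ z * truncF f k j.1 * j.2.1 +
      dirDeriv (timeDir n) φ z * ∫ s in (0 : ℝ)..j.1, truncF f k s = 0 := fun z hz j => by
    simp [image_eq_zero_of_notMem_tsupport hz, dirDeriv_eq_zero_of_notMem_tsupport hz]
  have i1 := hJ.integrable t1 hc.isCompact z1
  have i2 := hJ.integrable t2 hc.isCompact z2
  refine ⟨i1.add i2, ?_⟩
  simp only [timeFunctional]
  rw [integral_add i1 i2, hJ.integral_eq_zero t1 hc.isCompact z1 fun v hv _ =>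
      integral_timeDeriv_mul_laplacian hφ hc hv,
    hJ.integral_eq_zero t2 hc.isCompact z2 fun v hv _ => integral_comp_mul_timeDeriv hφ hc hv
      (hf.continuous_truncF k) (hasDerivAt_primitive (hf.continuous_truncF k)), add_zero]

theorem integrable_reactionFunctional (hf : IsNonlinearity f) (k : ℕ) (hφ : ContDiff ℝ ∞ φ)
    (hc : HasCompactSupport φ) (hJ : SobolevJet u J) :
    Integrable (fun z => reactionFunctional f k φ z (J z)) ∧
      ∫ z, reactionFunctional f k φ z (J z) = 0 := by
  have tφ := tame_coeff hφ.continuous hc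
  have tt := tame_dirDeriv hφ hc (timeDir n)
  have t1 : Tame (fun z (j : Jet n) => φ z * truncTilde f k j.1 * j.2.1 +
      dirDeriv (timeDir n) φ z * ∫ s in (0 : ℝ)..j.1, truncTilde f k s) :=
    ((tφ.mul (hf.tame_truncTilde k)).mul tame_timeDeriv).add
      (tt.mul (tame_primitive (hf.continuous_truncTilde k) (hf.growth_truncTilde k)))
  have t2 : Tame (fun z (j : Jet n) => φ z * truncTilde f k j.1 * j.2.2.2 +
      φ z * truncDeriv f k j.1 * j.gradSq + truncTilde f k j.1 * j.gradInner φ z) :=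
    (((tφ.mul (hf.tame_truncTilde k)).mul tame_laplacian).add
      ((tφ.mul (hf.tame_truncDeriv k)).mul tame_gradSq)).add
      ((hf.tame_truncTilde k).mul (tame_gradInner hφ hc))
  have z1 : ∀ z ∉ tsupport φ, ∀ j : Jet n, φ z * truncTilde f k j.1 * j.2.1 +
      dirDeriv (timeDir n) φ z * ∫ s in (0 : ℝ)..j.1, truncTilde f k s = 0 := fun z hz j => by
    simp [image_eq_zero_of_notMem_tsupport hz, dirDeriv_eq_zero_of_notMem_tsupport hz]
  have z2 : ∀ z ∉ tsupport φ, ∀ j : Jet n, φ z * truncTilde f k j.1 * j.2.2.2 +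
      φ z * truncDeriv f k j.1 * j.gradSq + truncTilde f k j.1 * j.gradInner φ z = 0 :=
    fun z hz j => by
    simp [image_eq_zero_of_notMem_tsupport hz, gradInner_eq_zero_of_notMem_tsupport hz]
  have i1 := hJ.integrable t1 hc.isCompact z1
  have i2 := hJ.integrable t2 hc.isCompact z2
  refine ⟨i1.sub i2, ?_⟩
  simp only [reactionFunctional]
  rw [integral_sub i1 i2, hJ.integral_eq_zero t2 hc.isCompact z2 fun v hv _ =>
      integral_comp_mul_laplacian hφ hc hv (hf.continuous_truncDeriv k)
        (hf.hasDerivAt_truncTilde k),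
    hJ.integral_eq_zero t1 hc.isCompact z1 fun v hv _ => integral_comp_mul_timeDeriv hφ hc hv
      (hf.continuous_truncTilde k) (hasDerivAt_primitive (hf.continuous_truncTilde k)), sub_zero]

end functionals

section integrability

variable {f : ℝ → ℝ} {u : SpaceTime n → ℝ} {J : SpaceTime n → Jet n} {q : ℕ} {a : ℝ}
  {ψ : SpaceTime n → ℝ}

theorem ParabolicCutoff.tame_pow (hψ : ParabolicCutoff q a ψ) {m : ℕ} (hm : m ≠ 0) :
    Tame (fun z (_ : Jet n) => ψ z ^ m) :=
  tame_coeff (hψ.contDiff_pow m).continuous (hψ.hasCompactSupport_pow hm)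

theorem tame_reaction : Tame (fun (_ : SpaceTime n) (j : Jet n) => j.2.1 - j.2.2.2) :=
  tame_timeDeriv.sub tame_laplacian

theorem integrable_valueTerm_sq (hψ : ParabolicCutoff q a ψ) (hq : q ≠ 0) (hJ : SobolevJet u J)
    (ε : ℝ) : Integrable (fun z => valueTerm q a ψ ε z (J z) ^ 2) := by
  refine hJ.integrable (Φ := fun z j => valueTerm q a ψ ε z j ^ 2) (Tame.pow (Tame.mul (Tame.mul
    (tame_const _) (hψ.tame_pow (by omega))) (tame_shift ε)) 2) hψ.hasCompactSupport.isCompact ?_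
  intro z hz j
  simp [valueTerm, image_eq_zero_of_notMem_tsupport hz, hq]

theorem integrable_truncTerm (hf : IsNonlinearity f) (k : ℕ) (hψ : ParabolicCutoff q a ψ)
    (hJ : SobolevJet u J) (ε : ℝ) : Integrable (fun z => truncTerm f k q a ψ ε z (J z)) := by
  refine hJ.integrable (Φ := fun z j => truncTerm f k q a ψ ε z j) (Tame.rpow (Tame.mul (Tame.mul
    (Tame.mul (tame_const _) (hψ.tame_pow (by omega))) (tame_shift ε).sqrt) (hf.tame_truncTilde k))
    (by norm_num)) hψ.hasCompactSupport.isCompact ?_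
  intro z hz j
  rw [truncTerm, image_eq_zero_of_notMem_tsupport hz, zero_pow (by omega)]
  simp

theorem integrable_errorTerm (hf : IsNonlinearity f) {p : ℝ}
    (hg : ∃ (C : ℝ) (N : ℕ), ∀ s, 0 ≤ s → |p * fTilde f s| ≤ C * (1 + s) ^ N) (k : ℕ)
    (hψ : ParabolicCutoff q a ψ) (hJ : SobolevJet u J) :
    Integrable (fun z => errorTerm f p k q ψ z (J z)) := by
  have t1 : Tame (fun (_ : SpaceTime n) (j : Jet n) => p * fTilde f |j.1|) := by
    refine tame_comp (h := fun s => p * fTilde f |s|) (continuous_const.mul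
      (hf.continuousOn_fTilde.comp_continuous continuous_abs fun s => abs_nonneg s)) ?_
    obtain ⟨C, N, h⟩ := hg
    exact ⟨C, N, fun s => h |s| (abs_nonneg s)⟩
  refine hJ.integrable (Φ := fun z j => errorTerm f p k q ψ z j) (Tame.add (Tame.mul
    (hψ.tame_pow (by omega)) (Tame.mul (tame_reaction.sub (hf.tame_truncF k)).abs
      tame_timeDeriv.abs)) (Tame.mul (hψ.tame_pow (by omega)) (tame_reaction.mul (t1.sub
      ((tame_const p).mul (hf.tame_truncTilde k)))))) hψ.hasCompactSupport.isCompact ?_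
  intro z hz j
  rw [errorTerm, ParabolicCutoff.pow_eq_zero_of_notMem hz (by omega), zero_mul, zero_mul, zero_add]

theorem integrable_reaction_mul_truncTilde (hf : IsNonlinearity f) (k : ℕ)
    (hψ : ParabolicCutoff q a ψ) (hJ : SobolevJet u J) :
    Integrable (fun z => ψ z ^ (4 * q + 4) *
      (((J z).2.1 - (J z).2.2.2) * truncTilde f k (J z).1)) := by
  refine hJ.integrable (Φ := fun z j => ψ z ^ (4 * q + 4) *
      ((j.2.1 - j.2.2.2) * truncTilde f k j.1)) (Tame.mul
    (hψ.tame_pow (by omega)) (tame_reaction.mul (hf.tame_truncTilde k)))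
    hψ.hasCompactSupport.isCompact ?_
  intro z hz j
  rw [ParabolicCutoff.pow_eq_zero_of_notMem hz (by omega), zero_mul]

end integrability

/-- The energy estimate for the truncated problem: `f(u) h(u)` is controlled by lower order terms
and by the truncation error. -/
theorem exists_energy_estimate_shift {f : ℝ → ℝ} (hf : IsNonlinearity f) {p : ℝ} (hp0 : 0 ≤ p)
    (hp : n = 1 ∨ 2 ≤ n ∧ 0 ≤ p ∧ p < (n : ℝ) * ((n : ℝ) + 2) / ((n : ℝ) - 1) ^ 2)
    (hfp : 2 ≤ n → ∀ s, 0 < s → f s ≤ p * fTilde f s)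
    (hg : ∃ (C : ℝ) (N : ℕ), ∀ s, 0 ≤ s → |p * fTilde f s| ≤ C * (1 + s) ^ N) :
    ∃ δ > 0, ∃ M, 0 ≤ M ∧ ∀ (q : ℕ) (a : ℝ) (ψ : SpaceTime n → ℝ), q ≠ 0 → ParabolicCutoff q a ψ →
      ∀ (u : SpaceTime n → ℝ) (J : SpaceTime n → Jet n), SobolevJet u J →
      (∀ᵐ z, (J z).2.1 - (J z).2.2.2 = f (u z)) →
      ∀ (k : ℕ) (ε : ℝ), 0 < ε → (k + 1) * ε ≤ δ →
        ∫ z, ψ z ^ (4 * q + 4) * (((J z).2.1 - (J z).2.2.2) * truncTilde f k (J z).1) ≤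
          M * ((∫ z, valueTerm q a ψ ε z (J z) ^ 2) + (∫ z, truncTerm f k q a ψ ε z (J z)) +
            ∫ z, errorTerm f p k q ψ z (J z)) := by
  obtain ⟨δ, hδ, Ψ, hΨ, H⟩ := exists_isNonposFunctional hp
  obtain ⟨K₀, hK₀, young⟩ := exists_mul_sqrt_mul_le hδ
  obtain ⟨c, hc, C, hC, l, hl, H⟩ := H (K₀ + 1) (by linarith)
  obtain ⟨M, hM, l₁, hl₁, l₂, hl₂, l₃, hl₃, E⟩ := exists_energy_elimination hc hC hl hδ
    (by linarith : 0 ≤ K₀ + 1)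
  refine ⟨δ, hδ, M, hM, fun q a ψ hq hψ u J hJ hueq k ε hε hkε => ?_⟩
  have hφ := hψ.contDiff_pow (4 * q + 4)
  have hφc := hψ.hasCompactSupport_pow (m := 4 * q + 4) (by omega)
  obtain ⟨i1, e1⟩ := integrable_timeFunctional hf k hφ hφc hJ
  obtain ⟨i2, e2⟩ := integrable_reactionFunctional hf k hφ hφc hJ
  have i3 := hJ.integrable (hΨ.tame ε hε _ hφ hφc) hφc.isCompact (hΨ.eq_zero ε _)
  have e3 := hJ.integral_nonpos (hΨ.tame ε hε _ hφ hφc) hφc.isCompact (hΨ.eq_zero ε _)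
    (hΨ.integral_nonpos ε hε _ hφ hφc fun z => pow_nonneg (hψ.nonneg z) _)
  have i4 := integrable_valueTerm_sq hψ hq hJ ε
  have i5 := integrable_truncTerm hf k hψ hJ ε
  have i6 := integrable_errorTerm hf hg k hψ hJ
  have i0 := integrable_reaction_mul_truncTilde hf k hψ hJ
  have key : ∀ᵐ z, ψ z ^ (4 * q + 4) * (((J z).2.1 - (J z).2.2.2) * truncTilde f k (J z).1) ≤
      l₁ * timeFunctional f k (fun z => ψ z ^ (4 * q + 4)) z (J z) +
      l₂ * reactionFunctional f k (fun z => ψ z ^ (4 * q + 4)) z (J z) +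
      l₃ * Ψ ε (fun z => ψ z ^ (4 * q + 4)) z (J z) +
      M * (valueTerm q a ψ ε z (J z) ^ 2 + truncTerm f k q a ψ ε z (J z) +
        errorTerm f p k q ψ z (J z)) := by
    filter_upwards [hueq, hJ.nonneg] with z hz hu0
    rw [← hJ.fst_eq z] at hu0 hz
    generalize J z = j at hz hu0
    have hx := hψ.nonneg z
    have hx1 := hψ.le_one z
    have hV := j.shift_pos hε
    have huV : j.1 ≤ j.shift ε := by
      have := le_max_left j.1 0
      simp only [Jet.shift]; linarith
    have hVu : j.shift ε = j.1 + ε := by rw [Jet.shift, max_eq_left hu0]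
    have hh := hf.truncTilde_nonneg k hu0
    have hF : 0 ≤ j.2.1 - j.2.2.2 := by rw [hz]; exact hf.nonneg hu0
    have hD := hψ.abs_gradInner_le z j
    have hZ : 0 ≤ truncTerm f k q a ψ ε z j := by
      have := hψ.scale_nonneg
      exact Real.rpow_nonneg (by positivity) _
    have hr : 0 ≤ reactionTerm q ψ z j := mul_nonneg (pow_nonneg hx _) hF
    have hA : 0 ≤ gradTerm q ψ ε z j :=
      mul_nonneg (pow_nonneg hx _) (mul_nonneg j.gradSq_nonneg (inv_nonneg.2 hV.le))
    have ho₁ : 0 ≤ ψ z ^ (4 * q + 4) * (|j.2.1 - j.2.2.2 - truncF f k j.1| * |j.2.1|) := by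
      positivity
    have ho₂ : 0 ≤ ψ z ^ (4 * q + 4) * ((j.2.1 - j.2.2.2) *
        (p * fTilde f |j.1| - p * truncTilde f k j.1)) := by
      refine mul_nonneg (pow_nonneg hx _) (mul_nonneg hF ?_)
      rw [abs_of_nonneg hu0, ← mul_sub]
      exact mul_nonneg hp0 (sub_nonneg.2 (hf.truncTilde_le k hu0))
    have b1 := sq_timeDeriv_le (τ := j.2.1) (ℓ := j.2.2.2) (fk := truncF f k j.1) q
      hψ.scale_nonneg hx hx1 hV.le hh huV j.gradSq_nonneg hD (hψ.time_le z)
      (intervalIntegral.integral_nonneg hu0 fun s _ => hf.truncF_nonneg k s)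
      (hf.integral_truncF_le k hu0)
    have b2 := mul_trunc_le (τ := j.2.1) (ℓ := j.2.2.2) (ρ := truncDeriv f k j.1) q
      hψ.scale_nonneg hx hx1 hV hh huV j.gradSq_nonneg hK₀
      (young a (ψ z) _ _ _ q hψ.scale_nonneg hx hV hh j.gradSq_nonneg) hD (hψ.time_le z)
      (intervalIntegral.integral_nonneg hu0 fun s hs => hf.truncTilde_nonneg k hs.1)
      (hf.integral_truncTilde_le k hu0)
      (by rw [hVu, hz]; exact hf.truncDeriv_mul_le hε.le hkε hu0)
    have b4 : 2 ≤ n → reactionTerm q ψ z j ^ 2 ≤ p * (ψ z ^ (4 * q + 4) *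
        ((j.2.1 - j.2.2.2) * truncTilde f k j.1)) + ψ z ^ (4 * q + 4) * ((j.2.1 - j.2.2.2) *
        (p * fTilde f |j.1| - p * truncTilde f k j.1)) := by
      intro hn2
      have h1 : j.2.1 - j.2.2.2 ≤ p * fTilde f |j.1| := by
        rw [hz, abs_of_nonneg hu0]
        rcases hu0.eq_or_lt with h | h
        · rw [← h, hf.map_zero, IsNonlinearity.fTilde_zero, mul_zero]
        · exact hfp hn2 _ h
      have h2 := mul_le_mul_of_nonneg_left h1
        (mul_nonneg (pow_nonneg hx (4 * q + 4)) hF)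
      have e : reactionTerm q ψ z j ^ 2 =
        ψ z ^ (4 * q + 4) * (j.2.1 - j.2.2.2) * (j.2.1 - j.2.2.2) := by
        rw [reactionTerm]; ring
      rw [e]
      linarith
    have b3 := H q a ψ hψ ε hε z j _ _ _ _ hr hZ ho₂ b2 b4
    have b5 := E (gradTerm q ψ ε z j) (valueTerm q a ψ ε z j) (crossTerm q a ψ z j)
      (reactionTerm q ψ z j) (timeTerm q ψ z j) _ (truncTerm f k q a ψ ε z j) _ _
      (timeFunctional f k (fun z => ψ z ^ (4 * q + 4)) z j) _ _ hA hr hZ ho₁ ho₂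
      (crossTerm_sq hε q a ψ z j) b1 b2 b3
    exact b5
  have iM := (((i1.const_mul l₁).add (i2.const_mul l₂)).add (i3.const_mul l₃)).add
    (((i4.add i5).add i6).const_mul M)
  refine (integral_mono_ae i0 iM key).trans ?_
  rw [integral_add' (((i1.const_mul l₁).add (i2.const_mul l₂)).add (i3.const_mul l₃))
      (((i4.add i5).add i6).const_mul M), integral_add' ((i1.const_mul l₁).add (i2.const_mul l₂))
      (i3.const_mul l₃), integral_add' (i1.const_mul l₁) (i2.const_mul l₂), integral_const_mul,
    integral_const_mul, integral_const_mul, integral_const_mul, e1, e2,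
    integral_add' (i4.add i5) i6, integral_add' i4 i5]
  have := mul_nonpos_of_nonneg_of_nonpos hl₃ e3
  linarith

end

/-! ### Absorption of the lower order terms -/

/-- Absorption of `(a x^(3q+2) √s h)^(4/3)` into `x^(4q+4) F h`, up to a power of `a`. -/
theorem exists_truncTerm_absorption {θ K β C : ℝ} (q : ℕ) (h0 : 0 ≤ θ) (h1 : θ < 1) (hK : 0 ≤ K)
    (hβ : 0 < β) (hθβ : β ≤ 4 / 3 / (1 - θ)) (hq : 3 * (q + 1) * θ ≤ 3 * q + 2) (hC : 0 ≤ C) :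
    ∃ C', 0 ≤ C' ∧ ∀ a x s h F : ℝ, 0 ≤ a → a ≤ 1 → 0 ≤ x → x ≤ 1 → 0 ≤ h → 0 ≤ F →
      (√s * h) ^ (4 / 3 : ℝ) ≤ K * (F * h) ^ θ →
      C * (a * x ^ (3 * q + 2) * √s * h) ^ (4 / 3 : ℝ) ≤
        1 / 2 * (x ^ (4 * q + 4) * (F * h)) + C' * a ^ β := by
  obtain ⟨C', hC', H⟩ := exists_rpow_mul_le h0 h1 (mul_nonneg hC hK) (one_half_pos (α := ℝ))
  refine ⟨C', hC', fun a x s h F ha ha1 hx hx1 hh hF hs => ?_⟩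
  have H := H (x ^ (4 * q + 4) * (F * h)) (a ^ (4 / 3 : ℝ)) (by positivity) (by positivity)
  rw [← Real.rpow_mul ha, ← mul_div_assoc, mul_one] at H
  have h2 : (x ^ (3 * q + 2)) ^ (4 / 3 : ℝ) ≤ (x ^ (4 * q + 4)) ^ θ := by
    rw [← Real.rpow_natCast, ← Real.rpow_mul hx, ← Real.rpow_natCast, ← Real.rpow_mul hx]
    refine Real.rpow_le_rpow_of_exponent_ge' hx hx1 (by positivity) ?_
    push_cast
    linarith
  calc C * (a * x ^ (3 * q + 2) * √s * h) ^ (4 / 3 : ℝ)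
      = C * (a ^ (4 / 3 : ℝ) * (x ^ (3 * q + 2)) ^ (4 / 3 : ℝ) * (√s * h) ^ (4 / 3 : ℝ)) := by
        rw [mul_assoc (a * _), Real.mul_rpow (by positivity) (by positivity),
          Real.mul_rpow (by positivity) (by positivity)]
    _ ≤ C * (a ^ (4 / 3 : ℝ) * (x ^ (4 * q + 4)) ^ θ * (K * (F * h) ^ θ)) := by gcongr
    _ = C * K * ((x ^ (4 * q + 4) * (F * h)) ^ θ * a ^ (4 / 3 : ℝ)) := by
        rw [Real.mul_rpow (by positivity : 0 ≤ x ^ (4 * q + 4)) (by positivity)]; ring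
    _ ≤ _ := H.trans (add_le_add_right (mul_le_mul_of_nonneg_left
          (Real.rpow_le_rpow_of_exponent_ge' ha ha1 hβ.le hθβ) hC') _)

/-- Absorption of `(a² x^(2q) s)²` into `x^(4q+4) F w`, up to a power of `a`. -/
theorem exists_valueTerm_absorption {θ K β C : ℝ} (q : ℕ) (h0 : 0 ≤ θ) (h1 : θ < 1) (hK : 0 ≤ K)
    (hβ : 0 < β) (hθβ : β ≤ 4 / (1 - θ)) (hq : (q + 1) * θ ≤ q) (hC : 0 ≤ C) :
    ∃ C', 0 ≤ C' ∧ ∀ a x s w F : ℝ, 0 ≤ a → a ≤ 1 → 0 ≤ x → x ≤ 1 → 0 ≤ w → 0 ≤ F →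
      s ^ 2 ≤ K * (F * w) ^ θ →
      C * (a ^ 2 * x ^ (2 * q) * s) ^ 2 ≤ 1 / 2 * (x ^ (4 * q + 4) * (F * w)) + C' * a ^ β := by
  obtain ⟨C', hC', H⟩ := exists_rpow_mul_le h0 h1 (mul_nonneg hC hK) (one_half_pos (α := ℝ))
  refine ⟨C', hC', fun a x s w F ha ha1 hx hx1 hw hF hs => ?_⟩
  have H := H (x ^ (4 * q + 4) * (F * w)) (a ^ (4 : ℝ)) (by positivity) (by positivity)
  rw [← Real.rpow_mul ha, ← mul_div_assoc, mul_one] at H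
  have h2 : x ^ (4 * q) ≤ (x ^ (4 * q + 4)) ^ θ := by
    rw [← Real.rpow_natCast, ← Real.rpow_natCast x (4 * q + 4), ← Real.rpow_mul hx]
    refine Real.rpow_le_rpow_of_exponent_ge' hx hx1 (by positivity) ?_
    push_cast
    linarith
  calc C * (a ^ 2 * x ^ (2 * q) * s) ^ 2
      = C * (a ^ (4 : ℝ) * x ^ (4 * q) * s ^ 2) := by
        rw [show (4 : ℝ) = (4 : ℕ) by norm_num, Real.rpow_natCast]; ring
    _ ≤ C * (a ^ (4 : ℝ) * (x ^ (4 * q + 4)) ^ θ * (K * (F * w) ^ θ)) := by gcongr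
    _ = C * K * ((x ^ (4 * q + 4) * (F * w)) ^ θ * a ^ (4 : ℝ)) := by
        rw [Real.mul_rpow (by positivity : 0 ≤ x ^ (4 * q + 4)) (by positivity)]; ring
    _ ≤ _ := H.trans (add_le_add_right (mul_le_mul_of_nonneg_left
          (Real.rpow_le_rpow_of_exponent_ge' ha ha1 hβ.le hθβ) hC') _)

/-- The condition `f(s) ≥ c s^m f̃(s)^(2m-1)` with an exponent `m > 2/3`, in the form used for the
lower order terms. -/
theorem rpow_sqrt_mul_le {c m s w h F : ℝ} (hc : 0 < c) (hm : 2 / 3 < m) (hs : 0 ≤ s) (hh : 0 ≤ h)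
    (hhw : h ≤ w) (hF : 0 ≤ F) (hf : c * s ^ m * w ^ (2 * m - 1) ≤ F) :
    (√s * h) ^ (4 / 3 : ℝ) ≤ c ^ (-(2 / (3 * m))) * (F * h) ^ (2 / (3 * m)) := by
  have hm0 : 0 < m := by linarith
  have h1 : c * (√s * h) ^ (2 * m) ≤ F * h := by
    have e1 : √s ^ (2 * m) = s ^ m := by
      rw [Real.sqrt_eq_rpow, ← Real.rpow_mul hs]; congr 1; ring
    have e2 : h ^ (2 * m) = h ^ (2 * m - 1) * h := by
      rw [← Real.rpow_add_one' hh (by linarith)]; congr 1; ring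
    rw [Real.mul_rpow (Real.sqrt_nonneg _) hh, e1, e2, ← mul_assoc, ← mul_assoc]
    refine mul_le_mul_of_nonneg_right (le_trans ?_ hf) hh
    have := Real.rpow_le_rpow hh hhw (by linarith : 0 ≤ 2 * m - 1)
    gcongr
  have h2 : (√s * h) ^ (2 * m) ≤ c⁻¹ * (F * h) := by
    rw [inv_mul_eq_div, le_div_iff₀ hc]; linarith
  have h3 := Real.rpow_le_rpow (by positivity) h2 (by positivity : 0 ≤ 2 / (3 * m))
  rw [← Real.rpow_mul (by positivity), Real.mul_rpow (inv_nonneg.2 hc.le) (by positivity),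
    Real.inv_rpow hc.le, ← Real.rpow_neg hc.le] at h3
  convert! h3 using 2
  field_simp
  norm_num

/-- The bound of `s²` by a power of `f f̃`, from the lower bound on `f` and its integrated form
`s^m ≤ C f̃^(2-2m)`. -/
theorem sq_le_mul_rpow {c m s w F C : ℝ} (hc : 0 < c) (hm : 2 / 3 < m) (hm1 : m < 1) (hs : 0 ≤ s)
    (hw : 0 ≤ w) (hF : 0 ≤ F) (hf : c * s ^ m * w ^ (2 * m - 1) ≤ F)
    (hsw : s ^ m ≤ C * w ^ (2 - 2 * m)) :
    s ^ 2 ≤ C ^ 2 * c ^ (-((2 - 2 * m) / m)) * (F * w) ^ ((2 - 2 * m) / m) := by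
  have hm0 : 0 < m := by linarith
  have hθ : 0 ≤ (2 - 2 * m) / m := div_nonneg (by linarith) hm0.le
  have h1 : s ^ m * w ^ (2 * m) ≤ c⁻¹ * (F * w) := by
    have e2 : w ^ (2 * m) = w ^ (2 * m - 1) * w := by
      rw [← Real.rpow_add_one' hw (by linarith)]; congr 1; ring
    rw [inv_mul_eq_div, le_div_iff₀ hc, e2]
    have := mul_le_mul_of_nonneg_right hf hw
    linarith
  have h3 := Real.rpow_le_rpow (by positivity) h1 hθ
  rw [Real.mul_rpow (by positivity) (by positivity), ← Real.rpow_mul hs, ← Real.rpow_mul hw,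
    Real.mul_rpow (by positivity) (by positivity), Real.inv_rpow hc.le, ← Real.rpow_neg hc.le,
    mul_div_cancel₀ _ hm0.ne', show 2 * m * ((2 - 2 * m) / m) = (2 - 2 * m) * (2 : ℕ) by
      field_simp; push_cast; ring, Real.rpow_mul hw, Real.rpow_natCast] at h3
  have h4 : s ^ (2 * m) ≤ C ^ 2 * (w ^ (2 - 2 * m)) ^ 2 := by
    have e : s ^ (2 * m) = (s ^ m) ^ 2 := by
      rw [mul_comm, Real.rpow_mul hs, Real.rpow_two]
    rw [e, ← mul_pow]
    exact pow_le_pow_left₀ (by positivity) hsw 2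
  calc s ^ 2 = s ^ (2 - 2 * m) * s ^ (2 * m) := by
        rw [← Real.rpow_add' hs (by norm_num), sub_add_cancel, Real.rpow_two]
    _ ≤ s ^ (2 - 2 * m) * (C ^ 2 * (w ^ (2 - 2 * m)) ^ 2) := by gcongr
    _ = C ^ 2 * (s ^ (2 - 2 * m) * (w ^ (2 - 2 * m)) ^ 2) := by ring
    _ ≤ _ := by rw [mul_assoc]; gcongr

namespace IsNonlinearity

variable {f : ℝ → ℝ}

/-- The differential inequality `s f̃' = f ≥ c s^m f̃^(2m-1)`, integrated. -/
theorem monotoneOn_rpow_fTilde_sub (hf : IsNonlinearity f) {c m : ℝ} (hm : 0 < m) (hm1 : m < 1)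
    {D : Set ℝ} (hD : Convex ℝ D) (hD0 : D ⊆ Ici 0)
    (h : ∀ s ∈ interior D, c * s ^ m * fTilde f s ^ (2 * m - 1) ≤ f s) :
    MonotoneOn (fun s => fTilde f s ^ (2 - 2 * m) - (2 - 2 * m) * c / m * s ^ m) D := by
  have hI : ∀ s ∈ interior D, 0 < s := fun s hs => by
    have := interior_mono hD0 hs
    rwa [interior_Ici] at this
  have hd : ∀ s : ℝ, 0 < s → HasDerivAt
      (fun s => fTilde f s ^ (2 - 2 * m) - (2 - 2 * m) * c / m * s ^ m)
      (f s / s * (2 - 2 * m) * fTilde f s ^ (2 - 2 * m - 1) -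
        (2 - 2 * m) * c / m * (m * s ^ (m - 1))) s := fun s hs =>
    ((hf.hasDerivAt_fTilde hs).rpow_const (Or.inl (hf.fTilde_pos hs).ne')).sub
      ((Real.hasDerivAt_rpow_const (Or.inl hs.ne')).const_mul _)
  refine monotoneOn_of_deriv_nonneg hD ?_ (fun s hs =>
    (hd s (hI s hs)).differentiableAt.differentiableWithinAt) fun s hs => ?_
  · refine ContinuousOn.sub ?_ ?_
    · exact (hf.continuousOn_fTilde.mono hD0).rpow_const fun _ _ => Or.inr (by linarith)
    · exact continuousOn_const.mul (continuousOn_id.rpow_const fun _ _ => Or.inr hm.le)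
  · have hs0 := hI s hs
    have hw := hf.fTilde_pos hs0
    rw [(hd s hs0).deriv]
    have h1 : c * s ^ m * fTilde f s ^ (2 * m - 1) * fTilde f s ^ (2 - 2 * m - 1) / s ≤
        f s * fTilde f s ^ (2 - 2 * m - 1) / s := by
      have := h s hs
      gcongr
    rw [mul_assoc _ (_ ^ _), ← Real.rpow_add hw, show 2 * m - 1 + (2 - 2 * m - 1) = 0 by ring,
      Real.rpow_zero, mul_one, mul_div_assoc, ← Real.rpow_sub_one hs0.ne'] at h1
    have h2 := mul_le_mul_of_nonneg_left h1 (by linarith : 0 ≤ 2 - 2 * m)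
    have e : (2 - 2 * m) * c / m * (m * s ^ (m - 1)) = (2 - 2 * m) * (c * s ^ (m - 1)) := by
      field_simp
    rw [e]
    have e2 : f s / s * (2 - 2 * m) * fTilde f s ^ (2 - 2 * m - 1) =
      (2 - 2 * m) * (f s * fTilde f s ^ (2 - 2 * m - 1) / s) := by ring
    rw [e2]
    linarith

theorem exists_rpow_le_fTilde_of_le_one (hf : IsNonlinearity f) {c m : ℝ} (hc : 0 < c) (hm : 0 < m)
    (hm1 : m < 1) (h : ∀ s ∈ Ioc (0 : ℝ) 1, c * s ^ m * fTilde f s ^ (2 * m - 1) ≤ f s) :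
    ∃ C, ∀ s, 0 ≤ s → s ≤ 1 → s ^ m ≤ C * fTilde f s ^ (2 - 2 * m) := by
  have hκ : 0 < (2 - 2 * m) * c / m := div_pos (mul_pos (by linarith) hc) hm
  refine ⟨((2 - 2 * m) * c / m)⁻¹, fun s hs hs1 => ?_⟩
  have := hf.monotoneOn_rpow_fTilde_sub hm hm1 (convex_Icc 0 1) (fun s hs => hs.1) (c := c)
    (fun s hs => h s (by rw [interior_Icc] at hs; exact ⟨hs.1, hs.2.le⟩))
    (left_mem_Icc.2 zero_le_one) ⟨hs, hs1⟩ hs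
  simp only [fTilde_zero] at this
  rw [Real.zero_rpow (by linarith), Real.zero_rpow hm.ne', mul_zero, sub_zero] at this
  rw [inv_mul_eq_div, le_div_iff₀ hκ]
  linarith

theorem exists_rpow_le_fTilde_of_one_le (hf : IsNonlinearity f) {c m : ℝ} (hc : 0 < c) (hm : 0 < m)
    (hm1 : m < 1) (h : ∀ s ∈ Ioi (1 : ℝ), c * s ^ m * fTilde f s ^ (2 * m - 1) ≤ f s) :
    ∃ C, ∀ s, 1 ≤ s → s ^ m ≤ C * fTilde f s ^ (2 - 2 * m) := by
  have hκ : 0 < (2 - 2 * m) * c / m := div_pos (mul_pos (by linarith) hc) hm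
  have hw := Real.rpow_pos_of_pos (hf.fTilde_pos one_pos) (2 - 2 * m)
  set κ := (2 - 2 * m) * c / m with hκ_def
  set w := fTilde f 1 ^ (2 - 2 * m) with hw_def
  refine ⟨κ⁻¹ + w⁻¹, fun s hs => ?_⟩
  have := hf.monotoneOn_rpow_fTilde_sub hm hm1 (convex_Ici 1)
    (Ici_subset_Ici.2 zero_le_one) (c := c)
    (fun s hs => h s (by rwa [interior_Ici] at hs)) self_mem_Ici hs hs
  simp only [Real.one_rpow, mul_one] at this
  rw [← hκ_def, ← hw_def] at this
  have hmono := Real.rpow_le_rpow (hf.fTilde_nonneg zero_le_one) (hf.fTilde_mono zero_le_one hs)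
    (by linarith : 0 ≤ 2 - 2 * m)
  rw [← hw_def] at hmono
  set W := fTilde f s ^ (2 - 2 * m)
  have h1 : 1 ≤ w⁻¹ * W := by rw [inv_mul_eq_div, le_div_iff₀ hw]; linarith
  have h2 : s ^ m - 1 ≤ κ⁻¹ * W := by rw [inv_mul_eq_div, le_div_iff₀ hκ]; linarith
  linarith

/-- For large `s` the exponent of the lower bound may be decreased. -/
theorem exists_lower_bound_exponent_le (hf : IsNonlinearity f) {c m m' : ℝ} (hc : 0 < c)
    (hm : m' ≤ m) (h : ∀ s ∈ Ioi (1 : ℝ), c * s ^ m * fTilde f s ^ (2 * m - 1) ≤ f s) :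
    ∃ c' > 0, ∀ s ∈ Ioi (1 : ℝ), c' * s ^ m' * fTilde f s ^ (2 * m' - 1) ≤ f s := by
  have h1 := hf.fTilde_pos one_pos
  refine ⟨c * fTilde f 1 ^ (2 * (m - m')), by positivity, fun s hs => le_trans ?_ (h s hs)⟩
  have hs1 : (1 : ℝ) ≤ s := le_of_lt hs
  have hs0 : (0 : ℝ) < s := by linarith
  have hw := hf.fTilde_pos hs0
  have e1 : s ^ m = s ^ (m - m') * s ^ m' := by rw [← Real.rpow_add hs0]; congr 1; ring
  have e2 : fTilde f s ^ (2 * m - 1) = fTilde f s ^ (2 * (m - m')) * fTilde f s ^ (2 * m' - 1) := by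
    rw [← Real.rpow_add hw]; congr 1; ring
  have h2 := Real.rpow_le_rpow h1.le (hf.fTilde_mono zero_le_one hs1)
    (by linarith : 0 ≤ 2 * (m - m'))
  have h3 := Real.one_le_rpow hs1 (by linarith : 0 ≤ m - m')
  rw [e1, e2]
  calc c * fTilde f 1 ^ (2 * (m - m')) * s ^ m' * fTilde f s ^ (2 * m' - 1)
      = c * (1 * s ^ m') * (fTilde f 1 ^ (2 * (m - m')) * fTilde f s ^ (2 * m' - 1)) := by ring
    _ ≤ _ := by gcongr

end IsNonlinearity

/-- The lower order terms of the energy estimate, with a cutoff at scale `1 / a`, can be absorbed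
into the main term up to `O(a^β)`. -/
structure IsSubcritical (f : ℝ → ℝ) (q : ℕ) (β : ℝ) : Prop where
  truncTerm_le : ∀ C, 0 ≤ C → ∃ C', 0 ≤ C' ∧ ∀ a x s h : ℝ, 0 ≤ a → a ≤ 1 → 0 ≤ x → x ≤ 1 →
    0 ≤ s → 0 ≤ h → h ≤ fTilde f s →
    C * (a * x ^ (3 * q + 2) * √s * h) ^ (4 / 3 : ℝ) ≤
      1 / 2 * (x ^ (4 * q + 4) * (f s * h)) + C' * a ^ β
  valueTerm_le : ∀ C, 0 ≤ C → ∃ C', 0 ≤ C' ∧ ∀ a x s : ℝ, 0 ≤ a → a ≤ 1 → 0 ≤ x → x ≤ 1 → 0 ≤ s →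
    C * (a ^ 2 * x ^ (2 * q) * s) ^ 2 ≤
      1 / 2 * (x ^ (4 * q + 4) * (f s * fTilde f s)) + C' * a ^ β

theorem isSubcritical_of_le {f : ℝ → ℝ} (hf : IsNonlinearity f) {θ₁ θ₂ η₁ η₂ K β : ℝ} {q : ℕ}
    (hβ : 0 < β) (hK : 0 ≤ K)
    (hθ : ∀ θ ∈ ({θ₁, θ₂} : Set ℝ), 0 ≤ θ ∧ θ < 1 ∧ β ≤ 4 / 3 / (1 - θ) ∧
      3 * (q + 1) * θ ≤ 3 * q + 2)
    (hη : ∀ η ∈ ({η₁, η₂} : Set ℝ), 0 ≤ η ∧ η < 1 ∧ β ≤ 4 / (1 - η) ∧ (q + 1) * η ≤ q)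
    (h₁ : ∀ s h, 0 ≤ s → s ≤ 1 → 0 ≤ h → h ≤ fTilde f s →
      (√s * h) ^ (4 / 3 : ℝ) ≤ K * (f s * h) ^ θ₁)
    (h₂ : ∀ s h, 1 < s → 0 ≤ h → h ≤ fTilde f s →
      (√s * h) ^ (4 / 3 : ℝ) ≤ K * (f s * h) ^ θ₂)
    (h₃ : ∀ s, 0 ≤ s → s ≤ 1 → s ^ 2 ≤ K * (f s * fTilde f s) ^ η₁)
    (h₄ : ∀ s, 1 < s → s ^ 2 ≤ K * (f s * fTilde f s) ^ η₂) : IsSubcritical f q β where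
  truncTerm_le C hC := by
    obtain ⟨a1, a2, a3, a4⟩ := hθ θ₁ (by simp)
    obtain ⟨b1, b2, b3, b4⟩ := hθ θ₂ (by simp)
    obtain ⟨C₁, hC₁, H₁⟩ := exists_truncTerm_absorption q a1 a2 hK hβ a3 a4 hC
    obtain ⟨C₂, hC₂, H₂⟩ := exists_truncTerm_absorption q b1 b2 hK hβ b3 b4 hC
    refine ⟨C₁ + C₂, by positivity, fun a x s h ha ha1 hx hx1 hs hh hhf => ?_⟩
    have hp := Real.rpow_nonneg ha β
    rcases le_or_gt s 1 with h1 | h1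
    · nlinarith [H₁ a x s h (f s) ha ha1 hx hx1 hh (hf.nonneg hs) (h₁ s h hs h1 hh hhf),
        mul_nonneg hC₂ hp]
    · nlinarith [H₂ a x s h (f s) ha ha1 hx hx1 hh (hf.nonneg hs) (h₂ s h h1 hh hhf),
        mul_nonneg hC₁ hp]
  valueTerm_le C hC := by
    obtain ⟨a1, a2, a3, a4⟩ := hη η₁ (by simp)
    obtain ⟨b1, b2, b3, b4⟩ := hη η₂ (by simp)
    obtain ⟨C₁, hC₁, H₁⟩ := exists_valueTerm_absorption q a1 a2 hK hβ a3 a4 hC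
    obtain ⟨C₂, hC₂, H₂⟩ := exists_valueTerm_absorption q b1 b2 hK hβ b3 b4 hC
    refine ⟨C₁ + C₂, by positivity, fun a x s ha ha1 hx hx1 hs => ?_⟩
    have hp := Real.rpow_nonneg ha β
    rcases le_or_gt s 1 with h1 | h1
    · nlinarith [H₁ a x s _ (f s) ha ha1 hx hx1 (hf.fTilde_nonneg hs) (hf.nonneg hs) (h₃ s hs h1),
        mul_nonneg hC₂ hp]
    · nlinarith [H₂ a x s _ (f s) ha ha1 hx hx1 (hf.fTilde_nonneg hs) (hf.nonneg hs) (h₄ s h1),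
        mul_nonneg hC₁ hp]

/-- The Young exponents `2 / (3m)` and `(2 - 2m) / m` are less than one because `m > 2/3`, and both
lead to the power `4m / (3m - 2)` of the scale; `q` has to be large for the powers of the cutoff. -/
theorem exponent_bounds {m β : ℝ} {q : ℕ} (hm : 2 / 3 < m) (hβ : β * (3 * m - 2) ≤ 4 * m)
    (hq : m ≤ (q + 1) * (3 * m - 2)) :
    (0 ≤ 2 / (3 * m) ∧ 2 / (3 * m) < 1 ∧ β ≤ 4 / 3 / (1 - 2 / (3 * m)) ∧
      3 * (q + 1) * (2 / (3 * m)) ≤ 3 * q + 2) ∧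
    (m < 1 → 0 ≤ (2 - 2 * m) / m ∧ (2 - 2 * m) / m < 1 ∧ β ≤ 4 / (1 - (2 - 2 * m) / m) ∧
      (q + 1) * ((2 - 2 * m) / m) ≤ q) := by
  have hm0 : 0 < m := by linarith
  have h3 : 0 < 3 * m - 2 := by linarith
  refine ⟨⟨by positivity, ?_, ?_, ?_⟩, fun hm1 => ⟨div_nonneg (by linarith) hm0.le, ?_, ?_, ?_⟩⟩
  · rw [div_lt_one (by positivity)]; linarith
  · have e : 1 - 2 / (3 * m) = (3 * m - 2) / (3 * m) := by field_simp
    rw [e, div_div_eq_mul_div, le_div_iff₀ h3]; linarith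
  · rw [mul_div_assoc', div_le_iff₀ (by positivity)]; linarith
  · rw [div_lt_one hm0]; linarith
  · have e : 1 - (2 - 2 * m) / m = (3 * m - 2) / m := by field_simp; ring
    rw [e, div_div_eq_mul_div, le_div_iff₀ h3]; linarith
  · rw [mul_div_assoc', div_le_iff₀ hm0]; linarith

/-- The upper bound on `m₁` is equivalent to `n + 2 < 4 m₁ / (3 m₁ - 2)`. -/
theorem exists_isSubcritical {n : ℕ} (hn : 1 ≤ n) {f : ℝ → ℝ} (hf : IsNonlinearity f)
    {m₁ m₂ c : ℝ} (hm₂ : 2 / 3 < m₂) (hm : m₂ < m₁)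
    (hm₁ : m₁ < 2 * ((n : ℝ) + 2) / (3 * (n : ℝ) + 2)) (hc : 0 < c)
    (hf₁ : ∀ s ∈ Ioc (0 : ℝ) 1, c * s ^ m₁ * fTilde f s ^ (2 * m₁ - 1) ≤ f s)
    (hf₂ : ∀ s ∈ Ioi (1 : ℝ), c * s ^ m₂ * fTilde f s ^ (2 * m₂ - 1) ≤ f s) :
    ∃ (q : ℕ) (β : ℝ), q ≠ 0 ∧ (n : ℝ) + 2 < β ∧ IsSubcritical f q β := by
  have hn1 : (1 : ℝ) ≤ n := by exact_mod_cast hn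
  rw [lt_div_iff₀ (by positivity)] at hm₁
  -- the exponent for large values, decreased below `1`
  obtain ⟨m, hm_def⟩ : ∃ m, m = min m₂ (9 / 10) := ⟨_, rfl⟩
  have hm' : 2 / 3 < m := by rw [hm_def]; exact lt_min hm₂ (by norm_num)
  have hm'1 : m < 1 := by rw [hm_def]; exact (min_le_right _ _).trans_lt (by norm_num)
  have hmm : m ≤ m₂ := by rw [hm_def]; exact min_le_left _ _
  obtain ⟨c', hc', hf₂'⟩ := hf.exists_lower_bound_exponent_le hc hmm hf₂
  have h1 : 0 < 3 * m₁ - 2 := by linarith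
  have h2 : 0 < 3 * m - 2 := by linarith
  obtain ⟨q, hq⟩ := exists_nat_ge (1 + m₁ / (3 * m₁ - 2) + m / (3 * m - 2))
  have d1 : 0 ≤ m₁ / (3 * m₁ - 2) := div_nonneg (by linarith) h1.le
  have d2 : 0 ≤ m / (3 * m - 2) := div_nonneg (by linarith) h2.le
  have q1 : m₁ ≤ (q + 1) * (3 * m₁ - 2) := by
    rw [← div_le_iff₀ h1]; linarith
  have q2 : m ≤ (q + 1) * (3 * m - 2) := by
    rw [← div_le_iff₀ h2]; linarith
  have hq0 : q ≠ 0 := by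
    rintro rfl
    push_cast at hq
    linarith
  have hs₁ : ∀ s h, 0 ≤ s → s ≤ 1 → 0 ≤ h → h ≤ fTilde f s → (√s * h) ^ (4 / 3 : ℝ) ≤
      c ^ (-(2 / (3 * m₁))) * (f s * h) ^ (2 / (3 * m₁)) := fun s h hs hs1 hh hhf => by
    refine rpow_sqrt_mul_le hc (by linarith) hs hh hhf (hf.nonneg hs) ?_
    rcases hs.eq_or_lt with rfl | hs
    · rw [Real.zero_rpow (by linarith), mul_zero, zero_mul, hf.map_zero]
    · exact hf₁ s ⟨hs, hs1⟩
  have hs₂ : ∀ s h, 1 < s → 0 ≤ h → h ≤ fTilde f s → (√s * h) ^ (4 / 3 : ℝ) ≤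
      c' ^ (-(2 / (3 * m))) * (f s * h) ^ (2 / (3 * m)) := fun s h hs hh hhf =>
    rpow_sqrt_mul_le hc' hm' (by linarith) hh hhf (hf.nonneg (by linarith)) (hf₂' s hs)
  obtain ⟨C₂, hC₂'⟩ := hf.exists_rpow_le_fTilde_of_one_le hc' (by linarith) hm'1 hf₂'
  have hs₄ : ∀ s, 1 < s → s ^ 2 ≤ C₂ ^ 2 * c' ^ (-((2 - 2 * m) / m)) *
      (f s * fTilde f s) ^ ((2 - 2 * m) / m) := fun s hs =>
    sq_le_mul_rpow hc' hm' hm'1 (by linarith) (hf.fTilde_nonneg (by linarith))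
      (hf.nonneg (by linarith)) (hf₂' s hs) (hC₂' s hs.le)
  -- for small values the bound `s ≤ 1` suffices in dimension one, where `m₁` may exceed `1`
  obtain ⟨β, η, K, hβ, hβm, hK, hη, hs₃⟩ : ∃ β η K : ℝ, (n : ℝ) + 2 < β ∧
      β * (3 * m₁ - 2) ≤ 4 * m₁ ∧ 0 ≤ K ∧
      (0 ≤ η ∧ η < 1 ∧ β ≤ 4 / (1 - η) ∧ (q + 1) * η ≤ q) ∧
      ∀ s, 0 ≤ s → s ≤ 1 → s ^ 2 ≤ K * (f s * fTilde f s) ^ η := by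
    rcases hn.eq_or_lt with rfl | hn2
    · have hβ : (3 : ℝ) < 4 * m₁ / (3 * m₁ - 2) := by
        rw [lt_div_iff₀ h1]; push_cast at hm₁; linarith
      refine ⟨min 4 (4 * m₁ / (3 * m₁ - 2)), 0, 1, ?_, ?_, zero_le_one,
        ⟨le_rfl, one_pos, by simp, by simp⟩, fun s hs hs1 => ?_⟩
      · push_cast
        exact lt_min (by norm_num) (by linarith)
      · rw [← le_div_iff₀ h1]; exact min_le_right _ _
      · rw [Real.rpow_zero, mul_one]; exact pow_le_one₀ hs hs1
    · have hn2' : (2 : ℝ) ≤ n := by exact_mod_cast hn2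
      have hm₁1 : m₁ < 1 := by nlinarith
      have hb : 4 * m₁ / (3 * m₁ - 2) * (3 * m₁ - 2) ≤ 4 * m₁ := by
        rw [div_mul_cancel₀ _ h1.ne']
      obtain ⟨C₁, hC₁'⟩ := hf.exists_rpow_le_fTilde_of_le_one hc (by linarith) hm₁1 hf₁
      refine ⟨4 * m₁ / (3 * m₁ - 2), (2 - 2 * m₁) / m₁, C₁ ^ 2 * c ^ (-((2 - 2 * m₁) / m₁)), ?_, hb,
        by positivity, (exponent_bounds (by linarith) hb q1).2 hm₁1, fun s hs hs1 => ?_⟩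
      · rw [lt_div_iff₀ h1]; linarith
      · refine sq_le_mul_rpow hc (by linarith) hm₁1 hs (hf.fTilde_nonneg hs)
          (hf.nonneg hs) ?_ (hC₁' s hs hs1)
        rcases hs.eq_or_lt with rfl | hs
        · rw [Real.zero_rpow (by linarith), mul_zero, zero_mul, hf.map_zero]
        · exact hf₁ s ⟨hs, hs1⟩
  have hβm' : β * (3 * m - 2) ≤ 4 * m := by
    have h3 : β ≤ 4 * m₁ / (3 * m₁ - 2) := by rwa [le_div_iff₀ h1]
    rw [← le_div_iff₀ h2]
    refine h3.trans ?_
    rw [div_le_div_iff₀ h1 h2]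
    nlinarith
  have b1 := exponent_bounds (by linarith : 2 / 3 < m₁) hβm q1
  have b2 := exponent_bounds hm' hβm' q2
  have wK : ∀ (K' K : ℝ) {X : ℝ}, 0 ≤ X → K' ≤ K → K' * X ≤ K * X :=
    fun _ _ _ hX h => mul_le_mul_of_nonneg_right h hX
  have k1 : 0 ≤ c ^ (-(2 / (3 * m₁))) := by positivity
  have k2 : 0 ≤ c' ^ (-(2 / (3 * m))) := by positivity
  have k4 : 0 ≤ C₂ ^ 2 * c' ^ (-((2 - 2 * m) / m)) := by positivity
  refine ⟨q, β, hq0, hβ, isSubcritical_of_le hf (θ₁ := 2 / (3 * m₁)) (θ₂ := 2 / (3 * m)) (η₁ := η)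
    (η₂ := (2 - 2 * m) / m) (K := c ^ (-(2 / (3 * m₁))) + c' ^ (-(2 / (3 * m))) + K +
      C₂ ^ 2 * c' ^ (-((2 - 2 * m) / m))) (by linarith) (by positivity) ?_ ?_ ?_ ?_ ?_ ?_⟩
  · rintro θ (rfl | rfl)
    exacts [b1.1, b2.1]
  · rintro θ (rfl | rfl)
    exacts [hη, b2.2 hm'1]
  · exact fun s h hs hs1 hh hhf => (hs₁ s h hs hs1 hh hhf).trans
      (wK _ _ (Real.rpow_nonneg (mul_nonneg (hf.nonneg hs) hh) _) (by linarith))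
  · exact fun s h hs hh hhf => (hs₂ s h hs hh hhf).trans
      (wK _ _ (Real.rpow_nonneg (mul_nonneg (hf.nonneg (by linarith)) hh) _) (by linarith))
  · exact fun s hs hs1 => (hs₃ s hs hs1).trans (wK _ _ (Real.rpow_nonneg
      (mul_nonneg (hf.nonneg hs) (hf.fTilde_nonneg hs)) _) (by linarith))
  · exact fun s hs => (hs₄ s hs).trans (wK _ _ (Real.rpow_nonneg
      (mul_nonneg (hf.nonneg (by linarith)) (hf.fTilde_nonneg (by linarith))) _) (by linarith))

/-! ### Removal of the regularization and of the truncation -/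

section

variable {n : ℕ}

section limits

variable {f : ℝ → ℝ} {u : SpaceTime n → ℝ} {J : SpaceTime n → Jet n} {q : ℕ} {a : ℝ}
  {ψ : SpaceTime n → ℝ}

theorem tendsto_integral_valueTerm_sq (hψ : ParabolicCutoff q a ψ) (hq : q ≠ 0)
    (hJ : SobolevJet u J) {ε : ℕ → ℝ} {δ : ℝ} (hε : ∀ m, 0 ≤ ε m) (hεδ : ∀ m, ε m ≤ δ)
    (hlim : Tendsto ε atTop (𝓝 0)) :
    Tendsto (fun m => ∫ z, valueTerm q a ψ (ε m) z (J z) ^ 2) atTop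
      (𝓝 (∫ z, valueTerm q a ψ 0 z (J z) ^ 2)) := by
  refine tendsto_integral_of_dominated_convergence (fun z => valueTerm q a ψ δ z (J z) ^ 2)
    (fun m => (integrable_valueTerm_sq hψ hq hJ _).aestronglyMeasurable)
    (integrable_valueTerm_sq hψ hq hJ δ) (fun m => Eventually.of_forall fun z => ?_)
    (Eventually.of_forall fun z => ?_)
  · have h1 := hψ.nonneg z
    have h2 : 0 ≤ (J z).shift (ε m) := add_nonneg (le_max_right _ _) (hε m)
    have h3 : (J z).shift (ε m) ≤ (J z).shift δ := add_le_add_right (hεδ m) _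
    rw [Real.norm_of_nonneg (sq_nonneg _)]
    unfold valueTerm
    gcongr
  · have hc : Continuous fun e => valueTerm q a ψ e z (J z) ^ 2 := by
      unfold valueTerm Jet.shift; fun_prop
    exact (hc.tendsto 0).comp hlim

theorem tendsto_integral_truncTerm (hf : IsNonlinearity f) (k : ℕ) (hψ : ParabolicCutoff q a ψ)
    (hJ : SobolevJet u J) {ε : ℕ → ℝ} {δ : ℝ} (hε : ∀ m, 0 ≤ ε m) (hεδ : ∀ m, ε m ≤ δ)
    (hlim : Tendsto ε atTop (𝓝 0)) :
    Tendsto (fun m => ∫ z, truncTerm f k q a ψ (ε m) z (J z)) atTop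
      (𝓝 (∫ z, truncTerm f k q a ψ 0 z (J z))) := by
  refine tendsto_integral_of_dominated_convergence (fun z => truncTerm f k q a ψ δ z (J z))
    (fun m => (integrable_truncTerm hf k hψ hJ _).aestronglyMeasurable)
    (integrable_truncTerm hf k hψ hJ δ) (fun m => ?_) (Eventually.of_forall fun z => ?_)
  · filter_upwards [hJ.nonneg] with z hz
    rw [← hJ.fst_eq z] at hz
    have h1 := hψ.nonneg z
    have h0 := hψ.scale_nonneg
    have h2 : 0 ≤ (J z).shift (ε m) := add_nonneg (le_max_right _ _) (hε m)
    have h3 : (J z).shift (ε m) ≤ (J z).shift δ := add_le_add_right (hεδ m) _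
    have h4 := hf.truncTilde_nonneg k hz
    unfold truncTerm
    rw [Real.norm_of_nonneg (by positivity)]
    gcongr
  · have hc : Continuous fun e => truncTerm f k q a ψ e z (J z) := by
      unfold truncTerm Jet.shift
      refine Continuous.rpow_const (by fun_prop) fun _ => Or.inr (by norm_num)
    exact (hc.tendsto 0).comp hlim

/-- The truncation error vanishes in the limit, by dominated convergence. -/
theorem tendsto_integral_errorTerm (hf : IsNonlinearity f) {p : ℝ} (hp : 0 ≤ p)
    (hg : ∃ (C : ℝ) (N : ℕ), ∀ s, 0 ≤ s → |p * fTilde f s| ≤ C * (1 + s) ^ N)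
    (hψ : ParabolicCutoff q a ψ) (hJ : SobolevJet u J)
    (hu : ∀ᵐ z, (J z).2.1 - (J z).2.2.2 = f (u z)) :
    Tendsto (fun k => ∫ z, errorTerm f p k q ψ z (J z)) atTop (𝓝 0) := by
  have hz : (0 : ℝ) = ∫ z : SpaceTime n, (0 : ℝ) := by simp
  rw [hz]
  have htame : Tame (fun z (j : Jet n) => ψ z ^ (4 * q + 4) * (|j.2.1 - j.2.2.2| * |j.2.1|) +
      ψ z ^ (4 * q + 4) * (|j.2.1 - j.2.2.2| * |p * fTilde f (|j.1|)|)) := by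
    have t1 : Tame (fun (_ : SpaceTime n) (j : Jet n) => p * fTilde f |j.1|) := by
      refine tame_comp (h := fun s => p * fTilde f |s|) (continuous_const.mul
        (hf.continuousOn_fTilde.comp_continuous continuous_abs fun s => abs_nonneg s)) ?_
      obtain ⟨C, N, h⟩ := hg
      exact ⟨C, N, fun s => h |s| (abs_nonneg s)⟩
    exact ((hψ.tame_pow (by omega)).mul (tame_reaction.abs.mul tame_timeDeriv.abs)).add
      ((hψ.tame_pow (by omega)).mul (tame_reaction.abs.mul t1.abs))
  refine tendsto_integral_of_dominated_convergence
    (fun z => ψ z ^ (4 * q + 4) * (|(J z).2.1 - (J z).2.2.2| * |(J z).2.1|) +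
      ψ z ^ (4 * q + 4) * (|(J z).2.1 - (J z).2.2.2| * |p * fTilde f (|(J z).1|)|))
    (fun k => (integrable_errorTerm hf hg k hψ hJ).aestronglyMeasurable)
    (hJ.integrable htame hψ.hasCompactSupport.isCompact fun z hz j => ?_) (fun k => ?_) ?_
  · rw [ParabolicCutoff.pow_eq_zero_of_notMem hz (by omega), zero_mul, zero_mul, zero_add]
  · filter_upwards [hJ.nonneg, hu] with z hz hu
    rw [← hJ.fst_eq z] at hz hu
    have h1 := hψ.nonneg z
    have h2 := hf.nonneg hz
    have h3 := hf.truncF_nonneg k (J z).1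
    have h4 := hf.truncF_le k hz
    have h5 := hf.truncTilde_nonneg k hz
    have h6 := hf.truncTilde_le k hz
    rw [errorTerm, hu, abs_of_nonneg hz, abs_of_nonneg h2,
      abs_of_nonneg (mul_nonneg hp (h5.trans h6)), abs_of_nonneg (sub_nonneg.2 h4)]
    have h7 : 0 ≤ p * fTilde f (J z).1 - p * truncTilde f k (J z).1 := by
      rw [← mul_sub]; exact mul_nonneg hp (sub_nonneg.2 h6)
    have h8 := mul_nonneg hp h5
    have h9 := sub_nonneg.2 h4
    rw [Real.norm_of_nonneg (by positivity)]
    gcongr <;> linarith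
  · filter_upwards [hJ.nonneg, hu] with z hz hu
    rw [← hJ.fst_eq z] at hz hu
    unfold errorTerm
    rw [hu, abs_of_nonneg hz]
    have l1 := hf.tendsto_truncF hz
    have l2 := hf.tendsto_truncTilde hz
    have := ((((tendsto_const_nhds (x := f (J z).1)).sub l1).abs.mul_const |(J z).2.1|).const_mul
      (ψ z ^ (4 * q + 4))).add ((((tendsto_const_nhds (x := p * fTilde f (J z).1)).sub
      (l2.const_mul p)).const_mul (f (J z).1)).const_mul (ψ z ^ (4 * q + 4)))
    simpa using this

end limits

/-- The energy estimate with a truncated reaction, in the limit `ε → 0`. -/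
theorem exists_energy_estimate {f : ℝ → ℝ} (hf : IsNonlinearity f) {p : ℝ} (hp0 : 0 ≤ p)
    (hp : n = 1 ∨ 2 ≤ n ∧ 0 ≤ p ∧ p < (n : ℝ) * ((n : ℝ) + 2) / ((n : ℝ) - 1) ^ 2)
    (hfp : 2 ≤ n → ∀ s, 0 < s → f s ≤ p * fTilde f s)
    (hg : ∃ (C : ℝ) (N : ℕ), ∀ s, 0 ≤ s → |p * fTilde f s| ≤ C * (1 + s) ^ N) :
    ∃ M, 0 ≤ M ∧ ∀ (q : ℕ) (a : ℝ) (ψ : SpaceTime n → ℝ), q ≠ 0 → ParabolicCutoff q a ψ →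
      ∀ (u : SpaceTime n → ℝ) (J : SpaceTime n → Jet n), SobolevJet u J →
      (∀ᵐ z, (J z).2.1 - (J z).2.2.2 = f (u z)) → ∀ k : ℕ,
        ∫ z, ψ z ^ (4 * q + 4) * (((J z).2.1 - (J z).2.2.2) * truncTilde f k (J z).1) ≤
          M * ((∫ z, valueTerm q a ψ 0 z (J z) ^ 2) + (∫ z, truncTerm f k q a ψ 0 z (J z)) +
            ∫ z, errorTerm f p k q ψ z (J z)) := by
  obtain ⟨δ, hδ, M, hM, H⟩ := exists_energy_estimate_shift hf hp0 hp hfp hg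
  refine ⟨M, hM, fun q a ψ hq hψ u J hJ hu k => ?_⟩
  have hε : ∀ m : ℕ, 0 < δ / (k + 1) * (1 / ((m : ℝ) + 1)) := fun m => by positivity
  have hε1 : ∀ m : ℕ, δ / (k + 1) * (1 / ((m : ℝ) + 1)) ≤ δ / (k + 1) := fun m => by
    refine mul_le_of_le_one_right (by positivity) ?_
    rw [div_le_one (by positivity)]
    linarith [(Nat.cast_nonneg m : (0 : ℝ) ≤ m)]
  have hlim : Tendsto (fun m : ℕ => δ / (k + 1) * (1 / ((m : ℝ) + 1))) atTop (𝓝 0) := by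
    simpa using tendsto_one_div_add_atTop_nhds_zero_nat.const_mul (δ / ((k : ℝ) + 1))
  refine ge_of_tendsto' ((((tendsto_integral_valueTerm_sq hψ hq hJ (fun m => (hε m).le) hε1
    hlim).add (tendsto_integral_truncTerm hf k hψ hJ (fun m => (hε m).le) hε1
    hlim)).add_const _).const_mul M) fun m => H q a ψ hq hψ u J hJ hu k _ (hε m) ?_
  calc (k + 1) * (δ / (k + 1) * (1 / ((m : ℝ) + 1))) ≤ (k + 1) * (δ / (k + 1)) := by
        gcongr; exact hε1 m
    _ = δ := by field_simp

/-- A nonnegative function which is the pointwise limit of functions with integrals bounded by a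
convergent sequence. -/
theorem integrable_and_integral_le_of_tendsto {α : Type*} [MeasurableSpace α] {μ : Measure α}
    {F : ℕ → α → ℝ} {G : α → ℝ} {B : ℕ → ℝ} {b : ℝ} (hF : ∀ k, Integrable (F k) μ)
    (hF0 : ∀ k, 0 ≤ᵐ[μ] F k) (hlim : ∀ᵐ z ∂μ, Tendsto (fun k => F k z) atTop (𝓝 (G z)))
    (hB : ∀ k, ∫ z, F k z ∂μ ≤ B k) (hb : Tendsto B atTop (𝓝 b)) :
    Integrable G μ ∧ ∫ z, G z ∂μ ≤ b := by
  have hGm : AEStronglyMeasurable G μ :=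
    aestronglyMeasurable_of_tendsto_ae atTop (fun k => (hF k).aestronglyMeasurable) hlim
  have hG0 : 0 ≤ᵐ[μ] G := by
    filter_upwards [hlim, ae_all_iff.2 hF0] with z h1 h2 using ge_of_tendsto' h1 h2
  have hb0 : 0 ≤ b := ge_of_tendsto' hb fun k => (integral_nonneg_of_ae (hF0 k)).trans (hB k)
  have key : ∫⁻ z, ENNReal.ofReal (G z) ∂μ ≤ ENNReal.ofReal b := by
    calc ∫⁻ z, ENNReal.ofReal (G z) ∂μ
        = ∫⁻ z, liminf (fun k => ENNReal.ofReal (F k z)) atTop ∂μ := by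
          refine lintegral_congr_ae ?_
          filter_upwards [hlim] with z hz
          exact ((ENNReal.tendsto_ofReal hz).liminf_eq).symm
      _ ≤ liminf (fun k => ∫⁻ z, ENNReal.ofReal (F k z) ∂μ) atTop :=
          lintegral_liminf_le' fun k => (hF k).aemeasurable.ennreal_ofReal
      _ ≤ liminf (fun k => ENNReal.ofReal (B k)) atTop := by
          refine liminf_le_liminf (Eventually.of_forall fun k => ?_)
          rw [← ofReal_integral_eq_lintegral_ofReal (hF k) (hF0 k)]
          exact ENNReal.ofReal_le_ofReal (hB k)
      _ = ENNReal.ofReal b := (ENNReal.tendsto_ofReal hb).liminf_eq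
  have hGi : Integrable G μ := by
    refine ⟨hGm, ?_⟩
    rw [hasFiniteIntegral_iff_ofReal hG0]
    exact key.trans_lt ENNReal.ofReal_lt_top
  refine ⟨hGi, ?_⟩
  rwa [← ofReal_integral_eq_lintegral_ofReal hGi hG0, ENNReal.ofReal_le_ofReal_iff hb0] at key

/-- The integral estimate: for a cutoff at scale `1 / a`, the integral of `f(u) f̃(u)` is
`O(a^β)` times the volume of the support. -/
theorem exists_integral_le {f : ℝ → ℝ} (hf : IsNonlinearity f) {p : ℝ} (hp0 : 0 ≤ p)
    (hp : n = 1 ∨ 2 ≤ n ∧ 0 ≤ p ∧ p < (n : ℝ) * ((n : ℝ) + 2) / ((n : ℝ) - 1) ^ 2)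
    (hfp : 2 ≤ n → ∀ s, 0 < s → f s ≤ p * fTilde f s)
    (hg : ∃ (C : ℝ) (N : ℕ), ∀ s, 0 ≤ s → |p * fTilde f s| ≤ C * (1 + s) ^ N)
    {q : ℕ} (hq : q ≠ 0) {β : ℝ} (hsub : IsSubcritical f q β) :
    ∃ C, 0 ≤ C ∧ ∀ (a : ℝ) (ψ : SpaceTime n → ℝ), a ≤ 1 → ParabolicCutoff q a ψ →
      ∀ (u : SpaceTime n → ℝ) (J : SpaceTime n → Jet n), SobolevJet u J →
      (∀ᵐ z, (J z).2.1 - (J z).2.2.2 = f (u z)) →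
        Integrable (fun z => ψ z ^ (4 * q + 4) * (f (u z) * fTilde f (u z))) ∧
        ∫ z, ψ z ^ (4 * q + 4) * (f (u z) * fTilde f (u z)) ≤
          C * (a ^ β * volume.real (tsupport ψ)) := by
  obtain ⟨M, hM, H⟩ := exists_energy_estimate hf hp0 hp hfp hg
  obtain ⟨C₁, hC₁, H₁⟩ := hsub.truncTerm_le M hM
  obtain ⟨C₂, hC₂, H₂⟩ := hsub.valueTerm_le (2 * M) (by positivity)
  refine ⟨4 * C₁ + 2 * C₂, by positivity, fun a ψ ha hψ u J hJ hu => ?_⟩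
  have H := H q a ψ hq hψ u J hJ hu
  have iI : ∀ C : ℝ, Integrable ((tsupport ψ).indicator fun _ => C) := fun C =>
    (integrableOn_const hψ.hasCompactSupport.isCompact.measure_lt_top.ne).integrable_indicator
      (isClosed_tsupport ψ).measurableSet
  have eI : ∀ C : ℝ, ∫ z, (tsupport ψ).indicator (fun _ => C) z = C * volume.real (tsupport ψ) :=
    fun C => by
    rw [integral_indicator (isClosed_tsupport ψ).measurableSet, setIntegral_const, smul_eq_mul,
      mul_comm]
  have i0 := fun k => integrable_reaction_mul_truncTilde hf k hψ hJ
  have i1 := fun k => integrable_truncTerm hf k hψ hJ 0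
  have i2 := integrable_valueTerm_sq hψ hq hJ 0
  have b1 : ∀ k, M * ∫ z, truncTerm f k q a ψ 0 z (J z) ≤
      1 / 2 * (∫ z, ψ z ^ (4 * q + 4) * (((J z).2.1 - (J z).2.2.2) * truncTilde f k (J z).1)) +
      C₁ * a ^ β * volume.real (tsupport ψ) := fun k => by
    rw [← eI, ← integral_const_mul, ← integral_const_mul,
      ← integral_add ((i0 k).const_mul _) (iI _)]
    refine integral_mono_ae ((i1 k).const_mul _) (((i0 k).const_mul _).add (iI _)) ?_
    filter_upwards [hJ.nonneg, hu] with z hz hu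
    rw [← hJ.fst_eq z] at hz hu
    by_cases hzs : z ∈ tsupport ψ
    · simp only [indicator_of_mem hzs, hu]
      have := H₁ a (ψ z) (J z).1 (truncTilde f k (J z).1) hψ.scale_nonneg ha (hψ.nonneg z)
        (hψ.le_one z) hz (hf.truncTilde_nonneg k hz) (hf.truncTilde_le k hz)
      rwa [truncTerm, Jet.shift, max_eq_left hz, add_zero]
    · simp only [indicator_of_notMem hzs, truncTerm, image_eq_zero_of_notMem_tsupport hzs]
      simp
  have hlim : ∀ᵐ z, Tendsto (fun k => ψ z ^ (4 * q + 4) *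
      (((J z).2.1 - (J z).2.2.2) * truncTilde f k (J z).1)) atTop
      (𝓝 (ψ z ^ (4 * q + 4) * (f (u z) * fTilde f (u z)))) := by
    filter_upwards [hJ.nonneg, hu] with z hz hu
    rw [hJ.fst_eq z, hu]
    exact ((hf.tendsto_truncTilde hz).const_mul _).const_mul _
  obtain ⟨i3, b2⟩ := integrable_and_integral_le_of_tendsto
    (B := fun k => 2 * M * (∫ z, valueTerm q a ψ 0 z (J z) ^ 2) +
      2 * C₁ * a ^ β * volume.real (tsupport ψ) + 2 * M * ∫ z, errorTerm f p k q ψ z (J z)) i0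
    (fun k => by
      filter_upwards [hJ.nonneg, hu] with z hz hu
      rw [← hJ.fst_eq z] at hz hu
      rw [hu]
      exact mul_nonneg (pow_nonneg (hψ.nonneg z) _)
        (mul_nonneg (hf.nonneg hz) (hf.truncTilde_nonneg k hz))) hlim
    (fun k => by linarith [H k, b1 k])
    (((tendsto_integral_errorTerm hf hp0 hg hψ hJ hu).const_mul (2 * M)).const_add _)
  refine ⟨i3, ?_⟩
  have b3 : 2 * M * ∫ z, valueTerm q a ψ 0 z (J z) ^ 2 ≤
      1 / 2 * (∫ z, ψ z ^ (4 * q + 4) * (f (u z) * fTilde f (u z))) +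
      C₂ * a ^ β * volume.real (tsupport ψ) := by
    rw [← eI, ← integral_const_mul, ← integral_const_mul, ← integral_add (i3.const_mul _) (iI _)]
    refine integral_mono_ae (i2.const_mul _) ((i3.const_mul _).add (iI _)) ?_
    filter_upwards [hJ.nonneg] with z hz
    by_cases hzs : z ∈ tsupport ψ
    · simp only [indicator_of_mem hzs]
      have := H₂ a (ψ z) (u z) hψ.scale_nonneg ha (hψ.nonneg z) (hψ.le_one z) hz
      rwa [valueTerm, Jet.shift, hJ.fst_eq z, max_eq_left hz, add_zero]
    · simp only [indicator_of_notMem hzs, valueTerm, image_eq_zero_of_notMem_tsupport hzs]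
      simp [hq]
  linarith

end

/-! ### Construction of the cutoffs -/

section

variable {n : ℕ}

theorem exists_abs_dirDeriv_le {χ : SpaceTime n → ℝ} (hχ : ContDiff ℝ ∞ χ)
    (hc : HasCompactSupport χ) (e : SpaceTime n) : ∃ C, 0 ≤ C ∧ ∀ z, |dirDeriv e χ z| ≤ C := by
  obtain ⟨C, hC⟩ := (hc.fderiv_apply ℝ e).exists_bound_of_continuous
    (contDiff_dirDeriv hχ e).continuous
  exact ⟨C, (norm_nonneg _).trans (hC 0), hC⟩

theorem dirDeriv_pow_succ {χ : SpaceTime n → ℝ} (hχ : ContDiff ℝ ∞ χ) (e z : SpaceTime n) (m : ℕ) :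
    dirDeriv e (fun z => χ z ^ (m + 1)) z = (m + 1) * χ z ^ m * dirDeriv e χ z := by
  have := dirDeriv_comp (e := e) (hasDerivAt_pow (m + 1) (χ z)) (hχ.differentiable (by simp) z)
  simpa using this

theorem dirDeriv_const (c : ℝ) (e z : SpaceTime n) : dirDeriv e (fun _ => c) z = 0 := by
  simp [dirDeriv]

/-- The derivatives of a power of a cutoff are controlled by lower powers. -/
theorem exists_parabolicCutoff {χ : SpaceTime n → ℝ} (hχ : ContDiff ℝ ∞ χ)
    (hc : HasCompactSupport χ) (h0 : ∀ z, 0 ≤ χ z) (h1 : ∀ z, χ z ≤ 1) (q : ℕ) :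
    ∃ a, ParabolicCutoff q a χ := by
  choose D hD0 hD using fun i => exists_abs_dirDeriv_le hχ hc (spaceDir (n := n) i)
  obtain ⟨T, hT0, hT⟩ := exists_abs_dirDeriv_le hχ hc (timeDir n)
  choose E hE0 hE using fun i => exists_abs_dirDeriv_le (contDiff_dirDeriv hχ (spaceDir i))
    (hc.fderiv_apply ℝ (spaceDir i)) (spaceDir (n := n) i)
  have hpow : ∀ z m, 0 ≤ χ z ^ m := fun z m => pow_nonneg (h0 z) m
  set N : ℝ := 4 * q + 4 with hN
  have hN0 : 0 ≤ N := by positivity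
  have hN1 : 0 ≤ N - 1 := by
    have : (0 : ℝ) ≤ q := Nat.cast_nonneg q
    rw [hN]; linarith
  have e1 : ∀ e z, dirDeriv e (fun z => χ z ^ (4 * q + 4)) z =
      N * χ z ^ (4 * q + 3) * dirDeriv e χ z := fun e z => by
    rw [dirDeriv_pow_succ hχ e z (4 * q + 3)]; push_cast; ring
  have e2 : ∀ e z, dirDeriv e (dirDeriv e (fun z => χ z ^ (4 * q + 4))) z =
      N * ((N - 1) * χ z ^ (4 * q + 2) * dirDeriv e χ z ^ 2 +
        χ z ^ (4 * q + 3) * dirDeriv e (dirDeriv e χ) z) := fun e z => by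
    have hd : ∀ m, DifferentiableAt ℝ (fun z => χ z ^ m) z := fun m =>
      (hχ.pow m).differentiable (by simp) z
    have hd' := (contDiff_dirDeriv hχ e).differentiable (by simp) z
    rw [show dirDeriv e (fun z => χ z ^ (4 * q + 4)) = fun z =>
      (fun z => N * χ z ^ (4 * q + 3)) z * dirDeriv e χ z from funext (e1 e),
      dirDeriv_mul ((hd _).const_mul N) hd']
    have : dirDeriv e (fun z => N * χ z ^ (4 * q + 3)) z =
        N * ((N - 1) * χ z ^ (4 * q + 2) * dirDeriv e χ z) := by
      have h := dirDeriv_mul (e := e) (a := fun _ => N) (differentiableAt_const N) (hd (4 * q + 3))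
      rw [h, dirDeriv_pow_succ hχ e z (4 * q + 2), dirDeriv_const, hN]
      push_cast
      ring
    rw [this]
    ring
  set A := ∑ i, (N * D i) ^ 2 with hA
  set L := ∑ i, N * ((N - 1) * D i ^ 2 + E i) with hL
  have hA0 : 0 ≤ A := Finset.sum_nonneg fun i _ => sq_nonneg _
  have hL0 : 0 ≤ L := Finset.sum_nonneg fun i _ => mul_nonneg hN0
    (add_nonneg (mul_nonneg hN1 (sq_nonneg _)) (hE0 i))
  have hNT : 0 ≤ N * T := mul_nonneg hN0 hT0
  have ha : A + N * T + L ≤ (1 + A + N * T + L) ^ 2 := by nlinarith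
  refine ⟨1 + A + N * T + L, hχ, hc, h0, h1, by positivity, fun z => ?_, fun z => ?_, fun z => ?_⟩
  · calc ∑ i, dirDeriv (spaceDir i) (fun z => χ z ^ (4 * q + 4)) z ^ 2
        ≤ ∑ i, (N * D i) ^ 2 * (χ z ^ (4 * q + 3)) ^ 2 := by
          refine Finset.sum_le_sum fun i _ => ?_
          rw [e1, ← mul_pow, mul_right_comm]
          refine sq_le_sq' ?_ ?_ <;> nlinarith [abs_le.1 (hD i z),
            mul_nonneg hN0 (hpow z (4 * q + 3))]
      _ = A * (χ z ^ (4 * q + 3)) ^ 2 := by rw [hA, Finset.sum_mul]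
      _ ≤ _ := by
          rw [mul_pow]
          exact mul_le_mul_of_nonneg_right (by linarith) (sq_nonneg _)
  · rw [e1, abs_mul, abs_of_nonneg (mul_nonneg hN0 (hpow z _))]
    calc N * χ z ^ (4 * q + 3) * |dirDeriv (timeDir n) χ z|
        ≤ N * χ z ^ (4 * q + 3) * T :=
          mul_le_mul_of_nonneg_left (hT z) (mul_nonneg hN0 (hpow z _))
      _ = N * T * χ z ^ (4 * q + 3) := by ring
      _ ≤ _ := mul_le_mul_of_nonneg_right (by linarith) (hpow z _)
  · rw [spaceLaplacian]
    refine (Finset.abs_sum_le_sum_abs _ _).trans ?_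
    calc ∑ i, |dirDeriv (spaceDir i) (dirDeriv (spaceDir i) fun z => χ z ^ (4 * q + 4)) z|
        ≤ ∑ i, N * ((N - 1) * D i ^ 2 + E i) * χ z ^ (4 * q + 2) := by
          refine Finset.sum_le_sum fun i _ => ?_
          rw [e2, abs_mul, abs_of_nonneg hN0, mul_assoc N (_ + E i)]
          refine mul_le_mul_of_nonneg_left ((abs_add_le _ _).trans ?_) hN0
          rw [abs_mul, abs_mul, abs_mul, abs_of_nonneg hN1, abs_of_nonneg (hpow z _),
            abs_of_nonneg (hpow z _), abs_of_nonneg (sq_nonneg _), add_mul]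
          have h3 : χ z ^ (4 * q + 3) ≤ χ z ^ (4 * q + 2) :=
            pow_le_pow_of_le_one (h0 z) (h1 z) (by omega)
          have h4 : dirDeriv (spaceDir i) χ z ^ 2 ≤ D i ^ 2 := sq_le_sq' (abs_le.1 (hD i z)).1
            (abs_le.1 (hD i z)).2
          refine add_le_add ?_ ?_
          · calc (N - 1) * χ z ^ (4 * q + 2) * dirDeriv (spaceDir i) χ z ^ 2
                ≤ (N - 1) * χ z ^ (4 * q + 2) * D i ^ 2 :=
                  mul_le_mul_of_nonneg_left h4 (mul_nonneg hN1 (hpow z _))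
              _ = _ := by ring
          · rw [mul_comm]
            exact mul_le_mul (hE i z) h3 (hpow z _) (hE0 i)
      _ = L * χ z ^ (4 * q + 2) := by rw [hL, Finset.sum_mul]
      _ ≤ _ := mul_le_mul_of_nonneg_right (by linarith) (hpow z _)

/-- The parabolic dilation `(x, t) ↦ (b x, b² t)`. -/
noncomputable def parabolicScaling (n : ℕ) (b : ℝ) : SpaceTime n →L[ℝ] SpaceTime n :=
  (b • ContinuousLinearMap.fst ℝ _ _).prod (b ^ 2 • ContinuousLinearMap.snd ℝ _ _)

theorem parabolicScaling_apply (b : ℝ) (z : SpaceTime n) :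
    parabolicScaling n b z = (b • z.1, b ^ 2 * z.2) := rfl

theorem parabolicScaling_spaceDir (b : ℝ) (i : Fin n) :
    parabolicScaling n b (spaceDir i) = b • spaceDir i := by
  simp [parabolicScaling_apply, spaceDir]

theorem parabolicScaling_timeDir (b : ℝ) :
    parabolicScaling n b (timeDir n) = b ^ 2 • timeDir n := by
  simp [parabolicScaling_apply, timeDir]

theorem dirDeriv_comp_parabolicScaling {χ : SpaceTime n → ℝ} (hχ : ContDiff ℝ ∞ χ) (b s : ℝ)
    {e : SpaceTime n} (he : parabolicScaling n b e = s • e) :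
    dirDeriv e (fun z => χ (parabolicScaling n b z)) =
      fun z => s * dirDeriv e χ (parabolicScaling n b z) := by
  funext z
  have h := ((hχ.differentiable (by simp) (parabolicScaling n b z)).hasFDerivAt.comp z
    (parabolicScaling n b).hasFDerivAt).fderiv
  simp only [Function.comp_def] at h
  simp [dirDeriv, h, he]

theorem tsupport_comp_parabolicScaling_subset {χ : SpaceTime n → ℝ} {r b : ℝ} (hb : 0 < b)
    (h : tsupport χ ⊆ Metric.closedBall 0 r) :
    tsupport (fun z => χ (parabolicScaling n b z)) ⊆
      Metric.closedBall 0 (r / b) ×ˢ Metric.closedBall 0 (r / b ^ 2) := by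
  refine closure_minimal (fun z hz => ?_) (Metric.isClosed_closedBall.prod
    Metric.isClosed_closedBall)
  have h1 := h (subset_tsupport χ hz)
  rw [parabolicScaling_apply, mem_closedBall_zero_iff, Prod.norm_def, sup_le_iff] at h1
  simp only [norm_smul, norm_mul, norm_pow, Real.norm_eq_abs, abs_of_pos hb] at h1
  refine ⟨?_, ?_⟩
  · rw [mem_closedBall_zero_iff, le_div_iff₀ hb]; linarith [h1.1]
  · rw [mem_closedBall_zero_iff, le_div_iff₀ (by positivity), Real.norm_eq_abs]; linarith [h1.2]

theorem ParabolicCutoff.comp_parabolicScaling {q : ℕ} {a r b : ℝ} {ψ : SpaceTime n → ℝ}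
    (hψ : ParabolicCutoff q a ψ) (hb : 0 < b) (hr : tsupport ψ ⊆ Metric.closedBall 0 r) :
    ParabolicCutoff q (a * b) (fun z => ψ (parabolicScaling n b z)) := by
  have hφ := hψ.contDiff_pow (4 * q + 4)
  have e1 := fun i : Fin n => dirDeriv_comp_parabolicScaling hφ b b (parabolicScaling_spaceDir b i)
  have e2 := dirDeriv_comp_parabolicScaling hφ b (b ^ 2) (parabolicScaling_timeDir b)
  refine ⟨hψ.contDiff.comp (parabolicScaling n b).contDiff, ?_, fun z => hψ.nonneg _,
    fun z => hψ.le_one _, mul_nonneg hψ.scale_nonneg hb.le, fun z => ?_, fun z => ?_, fun z => ?_⟩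
  · exact ((isCompact_closedBall _ _).prod (isCompact_closedBall _ _)).of_isClosed_subset
      (isClosed_tsupport _) (tsupport_comp_parabolicScaling_subset hb hr)
  · simp only [e1, mul_pow, ← Finset.mul_sum]
    have := mul_le_mul_of_nonneg_left (hψ.grad_le (parabolicScaling n b z)) (sq_nonneg b)
    rw [mul_pow] at this
    linarith
  · rw [e2, abs_mul, abs_of_nonneg (sq_nonneg b), mul_pow]
    have := mul_le_mul_of_nonneg_left (hψ.time_le (parabolicScaling n b z)) (sq_nonneg b)
    linarith
  · have e3 : spaceLaplacian (fun z => ψ (parabolicScaling n b z) ^ (4 * q + 4)) z =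
        b ^ 2 * spaceLaplacian (fun z => ψ z ^ (4 * q + 4)) (parabolicScaling n b z) := by
      simp only [spaceLaplacian, Finset.mul_sum]
      refine Finset.sum_congr rfl fun i _ => ?_
      rw [e1 i]
      have hd : ContDiff ℝ ∞ (fun z => b * dirDeriv (spaceDir i) (fun z => ψ z ^ (4 * q + 4)) z) :=
        contDiff_const.mul (contDiff_dirDeriv hφ _)
      have h1 := congr_fun (dirDeriv_comp_parabolicScaling hd b b
        (parabolicScaling_spaceDir b i)) z
      rw [h1]
      have h2 := dirDeriv_mul (e := spaceDir i) (z := parabolicScaling n b z) (a := fun _ => b)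
        (differentiableAt_const b) ((contDiff_dirDeriv hφ (spaceDir i)).differentiable (by simp) _)
      rw [h2, dirDeriv_const]
      ring
    rw [e3, abs_mul, abs_of_nonneg (sq_nonneg b), mul_pow]
    have := mul_le_mul_of_nonneg_left (hψ.laplacian_le (parabolicScaling n b z)) (sq_nonneg b)
    linarith

theorem volume_real_prod_closedBall {r s : ℝ} (hr : 0 ≤ r) (hs : 0 ≤ s) :
    volume.real ((Metric.closedBall 0 r ×ˢ Metric.closedBall 0 s : Set (SpaceTime n))) =
      r ^ n * s * (volume.real (Metric.ball (0 : EuclideanSpace ℝ (Fin n)) 1) *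
        volume.real (Metric.ball (0 : ℝ) 1)) := by
  rw [measureReal_def, Measure.volume_eq_prod, Measure.prod_prod, ENNReal.toReal_mul,
    Measure.addHaar_closedBall _ _ hr, Measure.addHaar_closedBall _ _ hs,
    finrank_euclideanSpace_fin, Module.finrank_self, ENNReal.toReal_mul, ENNReal.toReal_mul,
    ENNReal.toReal_ofReal (by positivity), ENNReal.toReal_ofReal (by positivity), pow_one]
  simp only [measureReal_def]
  ring

/-- Cutoffs at all large parabolic scales. -/
theorem exists_parabolicCutoff_seq (n q : ℕ) :
    ∃ (ψ : ℕ → SpaceTime n → ℝ) (a V : ℝ), 0 ≤ a ∧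
      (∀ k : ℕ, ParabolicCutoff q (a / (k + 1)) (ψ k)) ∧
      (∀ k : ℕ, volume.real (tsupport (ψ k)) ≤ V * ((k : ℝ) + 1) ^ (n + 2)) ∧
      ∀ z, ∀ᶠ k in atTop, ψ k z = 1 := by
  let χ : ContDiffBump (0 : SpaceTime n) := ⟨1, 2, one_pos, one_lt_two⟩
  obtain ⟨a, hχ⟩ := exists_parabolicCutoff χ.contDiff χ.hasCompactSupport (fun _ => χ.nonneg)
    (fun _ => χ.le_one) q
  have hsupp : tsupport χ ⊆ Metric.closedBall 0 2 := χ.tsupport_eq.subset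
  have hb : ∀ k : ℕ, 0 < ((k : ℝ) + 1)⁻¹ := fun k => by positivity
  refine ⟨fun k z => χ (parabolicScaling n ((k : ℝ) + 1)⁻¹ z), a,
    2 ^ (n + 1) * (volume.real (Metric.ball (0 : EuclideanSpace ℝ (Fin n)) 1) *
      volume.real (Metric.ball (0 : ℝ) 1)), hχ.scale_nonneg, fun k => ?_, fun k => ?_, fun z => ?_⟩
  · rw [div_eq_mul_inv]
    exact hχ.comp_parabolicScaling (hb k) hsupp
  · refine (measureReal_mono (tsupport_comp_parabolicScaling_subset (hb k) hsupp)
      ((isCompact_closedBall _ _).prod (isCompact_closedBall _ _)).measure_lt_top.ne).trans_eq ?_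
    rw [volume_real_prod_closedBall (by positivity) (by positivity)]
    simp only [inv_pow, div_inv_eq_mul, mul_pow]
    ring
  · obtain ⟨N, hN⟩ := exists_nat_ge ‖z‖
    filter_upwards [eventually_ge_atTop N] with k hk
    refine χ.one_of_mem_closedBall ?_
    have h1 : ‖z‖ ≤ (k : ℝ) + 1 := by
      have : (N : ℝ) ≤ k := by exact_mod_cast hk
      linarith
    have h2 : (1 : ℝ) ≤ (k : ℝ) + 1 := by linarith [(Nat.cast_nonneg k : (0 : ℝ) ≤ k)]
    change _ ∈ Metric.closedBall _ 1
    rw [mem_closedBall_zero_iff, parabolicScaling_apply, Prod.norm_def, sup_le_iff]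
    simp only [norm_smul, norm_mul, norm_pow, Real.norm_eq_abs, abs_of_pos (hb k)]
    constructor
    · rw [inv_mul_le_one₀ (by positivity)]
      exact (norm_fst_le z).trans h1
    · rw [inv_pow, inv_mul_le_one₀ (by positivity)]
      have h3 := norm_snd_le z
      rw [Real.norm_eq_abs] at h3
      nlinarith

end

/-! ### The Liouville theorem -/

/-- A solution vanishes when the lower order terms are of order `a^β` with `β > n + 2`, because
the volume of the support of a cutoff at scale `1 / a` is of order `a^(-(n+2))`. -/
theorem ae_eq_zero_of_isSubcritical {n : ℕ} {f : ℝ → ℝ} (hf : IsNonlinearity f) {p : ℝ}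
    (hp0 : 0 ≤ p) (hp : n = 1 ∨ 2 ≤ n ∧ 0 ≤ p ∧ p < (n : ℝ) * ((n : ℝ) + 2) / ((n : ℝ) - 1) ^ 2)
    (hfp : 2 ≤ n → ∀ s, 0 < s → f s ≤ p * fTilde f s)
    (hg : ∃ (C : ℝ) (N : ℕ), ∀ s, 0 ≤ s → |p * fTilde f s| ≤ C * (1 + s) ^ N)
    {q : ℕ} (hq : q ≠ 0) {β : ℝ} (hβ : (n : ℝ) + 2 < β) (hsub : IsSubcritical f q β)
    {u : SpaceTime n → ℝ} {J : SpaceTime n → Jet n} (hJ : SobolevJet u J)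
    (hu : ∀ᵐ z, (J z).2.1 - (J z).2.2.2 = f (u z)) : ∀ᵐ z, u z = 0 := by
  obtain ⟨C, hC, H⟩ := exists_integral_le hf hp0 hp hfp hg hq hsub
  obtain ⟨ψ, a, V, ha, hψ, hV, hψ1⟩ := exists_parabolicCutoff_seq n q
  obtain ⟨N, hN⟩ := exists_nat_ge a
  have hle : ∀ k : ℕ, a / ((k + N : ℕ) + 1) ≤ 1 := fun k => by
    rw [div_le_one (by positivity)]
    push_cast
    linarith [(Nat.cast_nonneg k : (0 : ℝ) ≤ k)]
  have hpos : ∀ᵐ z, 0 ≤ f (u z) * fTilde f (u z) := by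
    filter_upwards [hJ.nonneg] with z hz using mul_nonneg (hf.nonneg hz) (hf.fTilde_nonneg hz)
  have hlim : Tendsto (fun k : ℕ => C * (a ^ β * V) * (((k + N : ℕ) : ℝ) + 1) ^ (-(β - (n + 2))))
      atTop (𝓝 0) := by
    have h1 : Tendsto (fun k : ℕ => ((k + N : ℕ) : ℝ) + 1) atTop atTop :=
      tendsto_atTop_add_const_right _ _
        (tendsto_natCast_atTop_atTop.comp (tendsto_add_atTop_nat N))
    simpa using ((tendsto_rpow_neg_atTop (sub_pos.2 hβ)).comp h1).const_mul (C * (a ^ β * V))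
  obtain ⟨hint, hint0⟩ := integrable_and_integral_le_of_tendsto
    (F := fun k z => ψ (k + N) z ^ (4 * q + 4) * (f (u z) * fTilde f (u z)))
    (G := fun z => f (u z) * fTilde f (u z)) (μ := volume)
    (fun k => (H _ _ (hle k) (hψ (k + N)) u J hJ hu).1)
    (fun k => by
      filter_upwards [hpos] with z hz using mul_nonneg (pow_nonneg ((hψ _).nonneg z) _) hz)
    (Eventually.of_forall fun z => by
      refine tendsto_const_nhds.congr' ?_
      filter_upwards [(tendsto_add_atTop_nat N).eventually (hψ1 z)] with k hk
      rw [hk, one_pow, one_mul])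
    (fun k => by
      refine (H _ _ (hle k) (hψ (k + N)) u J hJ hu).2.trans ?_
      have h0 : (0 : ℝ) < ((k + N : ℕ) : ℝ) + 1 := by positivity
      refine (mul_le_mul_of_nonneg_left (mul_le_mul_of_nonneg_left (hV (k + N))
        (Real.rpow_nonneg (div_nonneg ha h0.le) β)) hC).trans_eq ?_
      rw [Real.div_rpow ha h0.le, neg_sub, Real.rpow_sub h0,
        show ((n : ℝ) + 2) = ((n + 2 : ℕ) : ℝ) by push_cast; ring, Real.rpow_natCast]
      ring) hlim
  have h0 := (integral_eq_zero_iff_of_nonneg_ae hpos hint).1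
    (le_antisymm hint0 (integral_nonneg_of_ae hpos))
  filter_upwards [h0, hJ.nonneg] with z hz hz0
  by_contra hne
  have h : 0 < u z := lt_of_le_of_ne hz0 (Ne.symm hne)
  exact (mul_pos (hf.pos _ h) (hf.fTilde_pos h)).ne' hz

theorem theorem5p2 (n : ℕ) (hn : 1 ≤ n) (f : ℝ → ℝ)
    (hf_cont : ContinuousOn f (Ici 0)) (hf_pos : ∀ s : ℝ, 0 < s → 0 < f s)
    (hf_int : IntegrableOn (fun z : ℝ => f z / z) (Ioc 0 1) volume)
    (hf_BV : n = 1 ∨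
      ∃ p : ℝ, 1 < p ∧ p < (n : ℝ) * ((n : ℝ) + 2) / ((n : ℝ) - 1) ^ 2 ∧
        ∀ s : ℝ, 0 < s → f s ≤ p * fTilde f s)
    (m₁ m₂ c : ℝ) (hm₂ : 2 / 3 < m₂) (hm : m₂ < m₁)
    (hm₁ : m₁ < 2 * ((n : ℝ) + 2) / (3 * (n : ℝ) + 2)) (hc : 0 < c)
    (hf₁ : ∀ s ∈ Ioc (0 : ℝ) 1, c * s ^ m₁ * fTilde f s ^ (2 * m₁ - 1) ≤ f s)
    (hf₂ : ∀ s ∈ Ioi (1 : ℝ), c * s ^ m₂ * fTilde f s ^ (2 * m₂ - 1) ≤ f s) :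
    ¬ ∃ u : SpaceTime n → ℝ, IsStrongSolution f u ∧ ¬ (∀ᵐ z, u z = 0) := by
  rintro ⟨u, ⟨hu0, ut, Du, D2u, hmem, heq⟩, hne⟩
  have hf : IsNonlinearity f := ⟨hf_cont, hf_pos, hf_int⟩
  obtain ⟨q, β, hq, hβ, hsub⟩ := exists_isSubcritical hn hf hm₂ hm hm₁ hc hf₁ hf₂
  have hJ := sobolevJet_of_forall_mem hu0 hmem
  have hu : ∀ᵐ z, (sobolevJet u ut Du D2u z).2.1 - (sobolevJet u ut Du D2u z).2.2.2 = f (u z) := heq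
  refine hne ?_
  by_cases hn1 : n = 1
  · -- in dimension one the comparison of `f` and `f̃` is not needed
    exact ae_eq_zero_of_isSubcritical hf (p := 0) le_rfl (Or.inl hn1) (fun h => by omega)
      ⟨0, 0, fun s _ => by simp⟩ hq hβ hsub hJ hu
  · obtain ⟨p, hp1, hp, hfp⟩ := hf_BV.resolve_left hn1
    have hp0 : 0 ≤ p := by linarith
    obtain ⟨C, N, hC, hg⟩ := hf.exists_fTilde_le hfp
    refine ae_eq_zero_of_isSubcritical hf hp0 (Or.inr ⟨by omega, hp0, hp⟩) (fun _ => hfp)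
      ⟨p * C, N, fun s hs => ?_⟩ hq hβ hsub hJ hu
    rw [abs_of_nonneg (mul_nonneg hp0 (hf.fTilde_nonneg hs)), mul_assoc]
    exact mul_le_mul_of_nonneg_left (hg s hs) hp0
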